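/- Let $-1\le a_1<a_2<a_3<a_4\le 1$, $\Gamma=[-1,a_1]\cup[a_2,a_3]\cup[a_4,1]$, and let $R(z)=\sqrt{\prod_{j=1}^4(z-a_j)}$ be the branch that is holomorphic off the bands $[a_1,a_2]\cup[a_3,a_4]$ with $R(z)\sim z^2$ as $z\to\infty$; on the bands $R$ takes its boundary values from the upper half plane. Let $H[f](x)=\frac1\pi\,\mathrm{p.v.}\!\int_\Gamma\frac{f(w)}{w-x}\,dw$ be the finite Hilbert transform on $\Gamma$. For $g:\mathbb R\to\mathbb R$, consider functions $u$ that are holomorphic on $\mathbb C\setminus([a_1,a_2]\cup[a_3,a_4])$, whose values on the open bands are their boundary values from the upper half plane, that are integrable on $[-1,1]$, and that satisfy $$\pi H\big[u(w)\sqrt{1-w^2}\big](x)=g(x)\quad (x\in\operatorname{int}\Gamma),\qquad \int_{a_1}^{a_2}u(x)\,dx=\int_{a_3}^{a_4}u(x)\,dx=0 .\qquad (*)$$ Put $l_1=\sum_{j}a_j$, $l_2=\sum_{i<j}a_ia_j$, $m=\frac{(a_4-a_3)(a_2-a_1)}{(a_4-a_2)(a_3-a_1)}$, let $K(m)=\int_0^{\pi/2}\frac{dy}{\sqrt{1-m\sin^2y}}$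 and $E(m)=\int_0^{\pi/2}\sqrt{1-m\sin^2y}\,dy$ be the complete elliptic integrals of the first and second kind, and $$A=-\tfrac{E(m)}{2K(m)}(a_3-a_1)(a_4-a_2)+\tfrac12(a_3a_4+a_2a_1),$$ $$B=-\tfrac{E(m)}{2K(m)}(a_3-a_1)(a_4-a_2)\,l_1+\tfrac12(a_4a_3-a_2a_1)(a_4+a_3-a_2-a_1),$$ $$C=-\tfrac{2E(m)}{K(m)}(a_3-a_1)(a_4-a_2)+\tfrac12(a_3+a_4-a_2-a_1)^2 .$$ Then, up to arbitrary values at the four points $a_j$: 1. (*) with $g(x)=-x$ has exactly one solution, the density of states $$u(z)=\frac1\pi\,\frac{z^2-\frac12l_1z+A}{R(z)} .$$ 2. (*) with $g(x)=2-4x^2$ has exactly one solution, the density of fluxes $$v(z)=\frac1\pi\,\frac{4z^3-2l_1z^2+(2l_2-\frac12l_1^2)z+B}{R(z)} .$$ 3. The polynomial $z^2-\frac12l_1z+A$ has no zero on $\Gamma$, and for $z\in\Gamma\setminus\{a_1,a_2,a_3,a_4\}$ one has $u(z)\neq0$ and the effective velocity $s=v/u$ is $$s(z)=4z-\frac{Cz-B}{z^2-\frac12l_1z+A}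 .$$ -/

import Mathlib

open Set Filter Topology MeasureTheory

namespace DefNLS

/-- The complete elliptic integral of the first kind, as a function of the parameter `m`. -/
noncomputable def ellipticK (m : ℝ) : ℝ :=
  ∫ y in (0 : ℝ)..(Real.pi / 2), 1 / Real.sqrt (1 - m * Real.sin y ^ 2)

/-- The complete elliptic integral of the second kind, as a function of the parameter `m`. -/
noncomputable def ellipticE (m : ℝ) : ℝ :=
  ∫ y in (0 : ℝ)..(Real.pi / 2), Real.sqrt (1 - m * Real.sin y ^ 2)

/-- The branch of `√((z - a)(z - b))` (for `a < b`) that is holomorphic off `[a, b]` and behaves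
like `z` at infinity. On the cut itself it takes its boundary values from the upper half plane. -/
noncomputable def cutRoot (a b : ℝ) (z : ℂ) : ℂ :=
  (z - a) * ((z - b) / (z - a)) ^ (1 / 2 : ℂ)

/-- The radical `R(z) = √((z - a₁)(z - a₂)(z - a₃)(z - a₄))` with branch cuts `[a₁, a₂]` and
`[a₃, a₄]`, normalized by `R(z) ~ z²` at infinity; on the cuts it takes its boundary values from
the upper half plane. -/
noncomputable def surfaceRoot (a₁ a₂ a₃ a₄ : ℝ) (z : ℂ) : ℂ :=
  cutRoot a₁ a₂ z * cutRoot a₃ a₄ z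

theorem cutRoot_sq (a b : ℝ) (z : ℂ) : cutRoot a b z ^ 2 = (z - a) * (z - b) := by
  unfold cutRoot
  by_cases h : z - a = 0
  · simp [h]
  · rw [mul_pow, ← Complex.cpow_nat_mul]
    norm_num
    field_simp

theorem surfaceRoot_sq (a₁ a₂ a₃ a₄ : ℝ) (z : ℂ) :
    surfaceRoot a₁ a₂ a₃ a₄ z ^ 2 = (z - a₁) * (z - a₂) * (z - a₃) * (z - a₄) := by
  unfold surfaceRoot
  rw [mul_pow, cutRoot_sq, cutRoot_sq]
  ring

theorem tendsto_cutRoot_div (a b : ℝ) :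
    Tendsto (fun z : ℂ => cutRoot a b z / z) (Bornology.cobounded ℂ) (𝓝 1) := by
  have h0 : Tendsto (fun z : ℂ => z⁻¹) (Bornology.cobounded ℂ) (𝓝 0) :=
    tendsto_inv₀_cobounded
  have hne : ∀ c : ℂ, ∀ᶠ z : ℂ in Bornology.cobounded ℂ, z ≠ c := fun c =>
    Bornology.eventually_ne_cobounded c
  have h1 : ∀ c : ℂ, Tendsto (fun z : ℂ => 1 - c * z⁻¹) (Bornology.cobounded ℂ) (𝓝 1) := by
    intro c
    simpa using tendsto_const_nhds.sub (h0.const_mul c)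
  have h2 : Tendsto (fun z : ℂ => (1 - b * z⁻¹) / (1 - a * z⁻¹))
      (Bornology.cobounded ℂ) (𝓝 1) := by
    have h := (h1 b).div (h1 a) one_ne_zero
    rw [div_one] at h
    exact h
  have h3 : Tendsto (fun z : ℂ => ((1 - b * z⁻¹) / (1 - a * z⁻¹)) ^ (1 / 2 : ℂ))
      (Bornology.cobounded ℂ) (𝓝 1) := by
    have := (continuousAt_cpow_const (b := (1 / 2 : ℂ)) Complex.one_mem_slitPlane).tendsto.comp h2
    simpa [Function.comp_def] using this
  have h4 := (h1 a).mul h3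
  rw [one_mul] at h4
  refine h4.congr' ?_
  filter_upwards [hne 0, hne a] with z hz hza
  have hza' : z - a ≠ 0 := sub_ne_zero.2 hza
  have e : (1 - b * z⁻¹) / (1 - a * z⁻¹) = (z - b) / (z - a) := by
    have : (1 - a * z⁻¹ : ℂ) ≠ 0 := by
      intro h
      apply hza'
      have e : z - a = z * (1 - a * z⁻¹) := by field_simp
      rw [e, h, mul_zero]
    rw [div_eq_div_iff this hza']
    field_simp
  rw [e, cutRoot]
  field_simp

/-- The normalization `R(z) ~ z²` at infinity. -/
theorem tendsto_surfaceRoot_div (a₁ a₂ a₃ a₄ : ℝ) :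
    Tendsto (fun z : ℂ => surfaceRoot a₁ a₂ a₃ a₄ z / z ^ 2) (Bornology.cobounded ℂ) (𝓝 1) := by
  have h := (tendsto_cutRoot_div a₁ a₂).mul (tendsto_cutRoot_div a₃ a₄)
  rw [one_mul] at h
  refine h.congr fun z => ?_
  rw [surfaceRoot, div_mul_div_comm, sq]

/-- The spectral support `Γ = [-1, a₁] ∪ [a₂, a₃] ∪ [a₄, 1]` of the genus one condensate. -/
def spectralSupport (a₁ a₂ a₃ a₄ : ℝ) : Set ℝ :=
  Icc (-1) a₁ ∪ Icc a₂ a₃ ∪ Icc a₄ 1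

/-- The bands `[a₁, a₂]` and `[a₃, a₄]`, as a subset of the complex plane. -/
def bandSet (a₁ a₂ a₃ a₄ : ℝ) : Set ℂ :=
  (fun x : ℝ => (x : ℂ)) '' (Icc a₁ a₂ ∪ Icc a₃ a₄)

/-- The set of the four branch points. -/
def branchPoints (a₁ a₂ a₃ a₄ : ℝ) : Set ℂ :=
  {(a₁ : ℂ), (a₂ : ℂ), (a₃ : ℂ), (a₄ : ℂ)}

/-- The finite Hilbert transform `H[f](x) = (1/π) p.v. ∫_Γ f(w) / (w - x) dw` exists at `x` and
equals `h`. -/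
def HasFiniteHilbertTransform (Γ : Set ℝ) (f : ℝ → ℂ) (x : ℝ) (h : ℂ) : Prop :=
  Tendsto (fun ε : ℝ => (1 / (Real.pi : ℂ)) *
      ∫ w in Γ \ Metric.ball x ε, f w / ((w - x : ℝ) : ℂ)) (𝓝[>] 0) (𝓝 h)

/-- `u` solves the condensate equation `π H[u |R₀|] = g` on `Γ`, where
`|R₀(w)| = |√(w² - 1)| = √(1 - w²)`, together with the band vanishing conditions
`∫_{a₁}^{a₂} u = ∫_{a₃}^{a₄} u = 0`. The values of `u` on the bands, which these conditions need,
are those of the analytic continuation of `u` off the bands, taken from the upper half plane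
(those from the lower half plane are their negatives for the solutions in question).
The values of `u` at the four branch points play no role. -/
structure IsCondensateSolution (a₁ a₂ a₃ a₄ : ℝ) (g : ℝ → ℝ) (u : ℂ → ℂ) : Prop where
  differentiableOn : DifferentiableOn ℂ u (bandSet a₁ a₂ a₃ a₄)ᶜ
  boundaryValue : ∀ x ∈ Ioo a₁ a₂ ∪ Ioo a₃ a₄,
    Tendsto u (𝓝[{z : ℂ | 0 < z.im}] (x : ℂ)) (𝓝 (u (x : ℂ)))
  integrableOn : IntegrableOn (fun x : ℝ => u (x : ℂ)) (Icc (-1) 1)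
  hilbert : ∀ x ∈ interior (spectralSupport a₁ a₂ a₃ a₄), ∃ h : ℂ,
    HasFiniteHilbertTransform (spectralSupport a₁ a₂ a₃ a₄)
      (fun w => u (w : ℂ) * (Real.sqrt (1 - w ^ 2) : ℂ)) x h ∧ (Real.pi : ℂ) * h = (g x : ℂ)
  vanish_left : ∫ x in a₁..a₂, u (x : ℂ) = 0
  vanish_right : ∫ x in a₃..a₄, u (x : ℂ) = 0

/-- `l₁`, the sum of the branch points. -/
def l₁ (a₁ a₂ a₃ a₄ : ℝ) : ℝ := a₁ + a₂ + a₃ + a₄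

/-- `l₂`, the second elementary symmetric polynomial of the branch points. -/
def l₂ (a₁ a₂ a₃ a₄ : ℝ) : ℝ :=
  a₁ * a₂ + a₁ * a₃ + a₁ * a₄ + a₂ * a₃ + a₂ * a₄ + a₃ * a₄

/-- The elliptic parameter `m`. -/
noncomputable def ellipticParameter (a₁ a₂ a₃ a₄ : ℝ) : ℝ :=
  ((a₄ - a₃) * (a₂ - a₁)) / ((a₄ - a₂) * (a₃ - a₁))

/-- The ratio `E(m) / K(m)`. -/
noncomputable def ellipticRatio (a₁ a₂ a₃ a₄ : ℝ) : ℝ :=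
  ellipticE (ellipticParameter a₁ a₂ a₃ a₄) / ellipticK (ellipticParameter a₁ a₂ a₃ a₄)

/-- The constant `A`. -/
noncomputable def constA (a₁ a₂ a₃ a₄ : ℝ) : ℝ :=
  -(ellipticRatio a₁ a₂ a₃ a₄ / 2) * (a₃ - a₁) * (a₄ - a₂) + (1 / 2) * (a₃ * a₄ + a₂ * a₁)

/-- The constant `B`. -/
noncomputable def constB (a₁ a₂ a₃ a₄ : ℝ) : ℝ :=
  -(ellipticRatio a₁ a₂ a₃ a₄ / 2) * (a₃ - a₁) * (a₄ - a₂) * l₁ a₁ a₂ a₃ a₄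
    + (1 / 2) * (a₄ * a₃ - a₂ * a₁) * (a₄ + a₃ - a₂ - a₁)

/-- The constant `C`. -/
noncomputable def constC (a₁ a₂ a₃ a₄ : ℝ) : ℝ :=
  -(2 * ellipticRatio a₁ a₂ a₃ a₄) * (a₃ - a₁) * (a₄ - a₂)
    + (1 / 2) * (a₃ + a₄ - a₂ - a₁) ^ 2

/-- The explicit density of states
`u₁(z) = (1/π) (z² - l₁ z / 2 + A) / R(z)`. -/
noncomputable def genusOneDOS (a₁ a₂ a₃ a₄ : ℝ) (z : ℂ) : ℂ :=
  (1 / (Real.pi : ℂ)) *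
    ((z ^ 2 - (1 / 2) * (l₁ a₁ a₂ a₃ a₄ : ℂ) * z + (constA a₁ a₂ a₃ a₄ : ℂ))
      / surfaceRoot a₁ a₂ a₃ a₄ z)

/-- The explicit density of fluxes
`v₁(z) = (1/π) (4 z³ - 2 l₁ z² + (2 l₂ - l₁² / 2) z + B) / R(z)`. -/
noncomputable def genusOneDOF (a₁ a₂ a₃ a₄ : ℝ) (z : ℂ) : ℂ :=
  (1 / (Real.pi : ℂ)) *
    ((4 * z ^ 3 - 2 * (l₁ a₁ a₂ a₃ a₄ : ℂ) * z ^ 2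
        + (2 * (l₂ a₁ a₂ a₃ a₄ : ℂ) - (l₁ a₁ a₂ a₃ a₄ : ℂ) ^ 2 / 2) * z
        + (constB a₁ a₂ a₃ a₄ : ℂ))
      / surfaceRoot a₁ a₂ a₃ a₄ z)

/-- The effective velocity `s = v / u`. -/
noncomputable def effectiveVelocity (u v : ℂ → ℂ) (z : ℂ) : ℂ := v z / u z

end DefNLS

/-! Write `F(z) = ∫_Γ u(w) √(1 - w²) / (w - z) dw` and `S(z) = √(z² - 1)`, cut along `[-1, 1]`.
Inside `Γ` the density is the restriction of a function analytic in a neighbourhood, so by the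
Sokhotski–Plemelj formula `F` equals an analytic function plus or minus `π i u √(1 - z²)` above and
below the axis, and on the axis that analytic function is the principal value. As `S` is `± i √(1 -
z²)` in the two half planes, the equation says exactly that `F = g + π u S` near the interior of
`Γ`, on both sides with the same sign (`exists_cauchyTransform_extension`).

Existence. Take `u = p / (π R)` with `p` a polynomial, and let `q` be a polynomial with `p S / R - q
→ 0` at infinity. The difference `F - (p S / R - q)` continues across the whole real line: inside
`Γ` by Plemelj, and off `Γ` because `R S` has no cuts other than `Γ`. Its singularities at the `aⱼ`
and at `±1` are removable, and it tends to zero, so it vanishes by Liouville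
(`cauchyTransform_weightedDensity`). Hence the principal value is `-q`. Matching at infinity with `q
= z` and `q = 4 z² - 2` fixes every coefficient of `p` but the constant one, which remains free.

The constants. The band conditions say that the integrals of `p / |R|` over the bands vanish. On
`[a₁, a₂]` a Möbius substitution in `sin² θ` turns these into Legendre integrals, and an exact
derivative reduces the quadratic numerator to `E` and `K`; this produces `A`. The reflection `x ↦
-x` gives the other band. The flux numerator is the derivative of `∏ (x - aⱼ)` plus `l₁` times the
numerator of `u`, so its band integrals vanish too.

Uniqueness. If `φ` solves the homogeneous problem then `F = π φ S` off the axis, so `φ R = F R S /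
(π S²)` continues across the bands, while `φ` and `R` are analytic elsewhere. Removable
singularities and Liouville give `φ = k / R` (`IsCondensateSolution.exists_mul_surfaceRoot_eq`). A
band integral of `1 / R` is a nonzero multiple of `K(m)`, so `k = 0`.

Effective velocity. The numerator of `u` has zero weighted mean on each band, hence a root in each
open band; being quadratic it has none on `Γ`. The formula for `s` is then polynomial division. -/

namespace DefNLS

/-! ### The Cauchy transform -/

/-- The Cauchy transform `∫_Γ f(w) / (w - z) dw` of a function on a subset of the real line. -/
noncomputable def cauchyTransform (Γ : Set ℝ) (f : ℝ → ℂ) (z : ℂ) : ℂ :=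
  ∫ w in Γ, f w / ((w : ℂ) - z)

/-- Differentiation under the integral sign. The path `γ` is general because the kernel is needed
both on the real line and on the sides of rectangles. -/
theorem differentiableAt_integral_div_sub {α : Type*} [MeasurableSpace α] {μ : Measure α}
    {f γ : α → ℂ} (hf : Integrable f μ) (hγ : AEStronglyMeasurable γ μ) {z : ℂ} {δ : ℝ}
    (hδ : 0 < δ) (h : ∀ᵐ t ∂μ, δ ≤ ‖γ t - z‖) :
    DifferentiableAt ℂ (fun ζ => ∫ t, f t / (γ t - ζ) ∂μ) z := by
  have hmeas : ∀ ζ : ℂ, AEStronglyMeasurable (fun t => f t / (γ t - ζ)) μ := fun ζ =>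
    hf.aestronglyMeasurable.div₀ (hγ.sub aestronglyMeasurable_const)
  have hlow : ∀ t, δ ≤ ‖γ t - z‖ → ∀ ζ ∈ Metric.ball z (δ / 2), δ / 2 ≤ ‖γ t - ζ‖ := by
    intro t ht ζ hζ
    rw [mem_ball_iff_norm] at hζ
    have := norm_sub_norm_le (γ t - z) (ζ - z)
    rw [sub_sub_sub_cancel_right] at this
    linarith
  refine (hasDerivAt_integral_of_dominated_loc_of_deriv_le (μ := μ)
    (F := fun ζ t => f t / (γ t - ζ)) (F' := fun ζ t => f t / (γ t - ζ) ^ 2)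
    (bound := fun t => ‖f t‖ * (4 / δ ^ 2)) (Metric.ball_mem_nhds z (half_pos hδ))
    (Eventually.of_forall hmeas) ?_ ?_ ?_ (hf.norm.mul_const _) ?_).2.differentiableAt
  · refine (hf.norm.mul_const (1 / δ)).mono' (hmeas z) ?_
    filter_upwards [h] with t ht
    rw [norm_div, div_eq_mul_one_div]
    gcongr
  · exact hf.aestronglyMeasurable.div₀ ((hγ.sub aestronglyMeasurable_const).pow 2)
  · filter_upwards [h] with t ht ζ hζ
    have h2 := hlow t ht ζ hζ
    rw [norm_div, norm_pow, div_eq_mul_one_div]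
    have : 1 / ‖γ t - ζ‖ ^ 2 ≤ 1 / (δ / 2) ^ 2 := by gcongr
    have e : 1 / (δ / 2) ^ 2 = 4 / δ ^ 2 := by field_simp; norm_num
    rw [e] at this
    gcongr
  · filter_upwards [h] with t ht ζ hζ
    have h2 := hlow t ht ζ hζ
    have h3 : γ t - ζ ≠ 0 := by
      rw [← norm_pos_iff]; linarith [half_pos hδ]
    have h4 : HasDerivAt (fun ζ : ℂ => γ t - ζ) (-1) ζ := by
      simpa using (hasDerivAt_id' ζ).const_sub (γ t)
    have h5 := (hasDerivAt_const ζ (f t)).fun_div h4 h3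
    simpa using h5

theorem differentiableAt_cauchyTransform {Γ : Set ℝ} {f : ℝ → ℂ} (hΓ : MeasurableSet Γ)
    (hf : IntegrableOn f Γ) {z : ℂ} {δ : ℝ} (hδ : 0 < δ) (h : ∀ w ∈ Γ, δ ≤ ‖(w : ℂ) - z‖) :
    DifferentiableAt ℂ (cauchyTransform Γ f) z :=
  differentiableAt_integral_div_sub hf Complex.continuous_ofReal.aestronglyMeasurable hδ
    ((ae_restrict_iff' hΓ).2 (Eventually.of_forall h))

theorem abs_im_le_norm_ofReal_sub (w : ℝ) (z : ℂ) : |z.im| ≤ ‖(w : ℂ) - z‖ := by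
  simpa using Complex.abs_im_le_norm ((w : ℂ) - z)

theorem exists_pos_le_norm_ofReal_sub {Γ : Set ℝ} (hΓ : IsClosed Γ) {z : ℂ}
    (hz : ∀ w ∈ Γ, (w : ℂ) ≠ z) : ∃ δ > 0, ∀ w ∈ Γ, δ ≤ ‖(w : ℂ) - z‖ := by
  have hc : IsClosed ((fun w : ℝ => (w : ℂ)) '' Γ) :=
    Complex.isometry_ofReal.isClosedEmbedding.isClosedMap Γ hΓ
  have hz' : z ∈ ((fun w : ℝ => (w : ℂ)) '' Γ)ᶜ := by
    rintro ⟨w, hw, rfl⟩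
    exact hz w hw rfl
  obtain ⟨δ, hδ, hb⟩ := Metric.isOpen_iff.1 hc.isOpen_compl z hz'
  refine ⟨δ, hδ, fun w hw => ?_⟩
  by_contra hlt
  push Not at hlt
  exact hb (mem_ball_iff_norm.2 hlt) ⟨w, hw, rfl⟩

theorem differentiableAt_cauchyTransform_of_isClosed {Γ : Set ℝ} {f : ℝ → ℂ} (hΓ : IsClosed Γ)
    (hf : IntegrableOn f Γ) {z : ℂ} (hz : ∀ w ∈ Γ, (w : ℂ) ≠ z) :
    DifferentiableAt ℂ (cauchyTransform Γ f) z := by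
  obtain ⟨δ, hδ, h⟩ := exists_pos_le_norm_ofReal_sub hΓ hz
  exact differentiableAt_cauchyTransform hΓ.measurableSet hf hδ h

theorem ofReal_ne_of_im_ne_zero {z : ℂ} (hz : z.im ≠ 0) (w : ℝ) : (w : ℂ) ≠ z := by
  rintro rfl
  exact hz (Complex.ofReal_im w)

/-- The factor `|im z| / |w - z|` is at most one, so dominated convergence applies with majorant
`‖f‖`. This is all the control at the endpoints that mere integrability gives, and it suffices to
remove singularities there. -/
theorem tendsto_im_smul_cauchyTransform {Γ : Set ℝ} {f : ℝ → ℂ} (hf : IntegrableOn f Γ) (a : ℝ) :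
    Tendsto (fun z : ℂ => (z.im : ℂ) * cauchyTransform Γ f z) (𝓝[{z | z.im ≠ 0}] (a : ℂ))
      (𝓝 0) := by
  have hl : ∀ᶠ z : ℂ in 𝓝[{z | z.im ≠ 0}] (a : ℂ), z.im ≠ 0 := self_mem_nhdsWithin
  have key : Tendsto (fun z : ℂ => ∫ w in Γ, (z.im : ℂ) * (f w / ((w : ℂ) - z)))
      (𝓝[{z | z.im ≠ 0}] (a : ℂ)) (𝓝 (∫ w in Γ, (0 : ℂ))) := by
    refine tendsto_integral_filter_of_dominated_convergence (fun w => ‖f w‖) ?_ ?_ hf.norm ?_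
    · refine Eventually.of_forall fun z => ?_
      exact (hf.aestronglyMeasurable.div₀
        (Complex.continuous_ofReal.sub continuous_const).aestronglyMeasurable).const_mul _
    · filter_upwards [hl] with z hz
      refine Eventually.of_forall fun w => ?_
      have h1 := abs_im_le_norm_ofReal_sub w z
      have h2 : 0 < ‖(w : ℂ) - z‖ := (abs_pos.2 hz).trans_le h1
      rw [norm_mul, norm_div, Complex.norm_real, Real.norm_eq_abs, ← mul_div_assoc,
        div_le_iff₀ h2, mul_comm]
      gcongr
    · have : ∀ᵐ w ∂(volume.restrict Γ), w ≠ a := by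
        simp [ae_iff]
      filter_upwards [this] with w hw
      have h1 : Tendsto (fun z : ℂ => (z.im : ℂ)) (𝓝[{z | z.im ≠ 0}] (a : ℂ)) (𝓝 ((0 : ℝ) : ℂ)) := by
        have : Continuous fun z : ℂ => (z.im : ℂ) := by fun_prop
        have h := this.tendsto (a : ℂ)
        simp only [Complex.ofReal_im] at h
        exact h.mono_left nhdsWithin_le_nhds
      have h2 : Tendsto (fun z : ℂ => f w / ((w : ℂ) - z)) (𝓝[{z | z.im ≠ 0}] (a : ℂ))
          (𝓝 (f w / ((w : ℂ) - a))) := by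
        refine Tendsto.mono_left ?_ nhdsWithin_le_nhds
        refine tendsto_const_nhds.div (tendsto_const_nhds.sub tendsto_id) ?_
        exact sub_ne_zero.2 (by exact_mod_cast hw)
      simpa using h1.mul h2
  rw [integral_zero] at key
  refine key.congr fun z => ?_
  rw [integral_const_mul, cauchyTransform]

theorem norm_cauchyTransform_le {Γ : Set ℝ} {f : ℝ → ℂ} (hΓ : MeasurableSet Γ)
    (hΓ1 : Γ ⊆ Icc (-1) 1) (hf : IntegrableOn f Γ) {z : ℂ} (hz : 1 < ‖z‖) :
    ‖cauchyTransform Γ f z‖ ≤ (∫ w in Γ, ‖f w‖) / (‖z‖ - 1) := by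
  have hz' : 0 < ‖z‖ - 1 := by linarith
  rw [cauchyTransform, ← integral_div]
  refine norm_integral_le_of_norm_le (hf.norm.div_const _) ?_
  refine (ae_restrict_iff' hΓ).2 (Eventually.of_forall fun w hw => ?_)
  have h1 : ‖(w : ℂ)‖ ≤ 1 := by
    rw [Complex.norm_real, Real.norm_eq_abs, abs_le]
    exact hΓ1 hw
  have h2 := norm_sub_norm_le z (w : ℂ)
  rw [norm_sub_rev] at h2
  rw [norm_div]
  gcongr
  linarith

theorem tendsto_cauchyTransform_cobounded {Γ : Set ℝ} {f : ℝ → ℂ} (hΓ : MeasurableSet Γ)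
    (hΓ1 : Γ ⊆ Icc (-1) 1) (hf : IntegrableOn f Γ) :
    Tendsto (cauchyTransform Γ f) (Bornology.cobounded ℂ) (𝓝 0) := by
  have h1 : Tendsto (fun z : ℂ => (∫ w in Γ, ‖f w‖) / (‖z‖ - 1)) (Bornology.cobounded ℂ)
      (𝓝 0) :=
    Tendsto.div_atTop tendsto_const_nhds
      (tendsto_atTop_add_const_right _ _ tendsto_norm_cobounded_atTop)
  refine squeeze_zero_norm' ?_ h1
  filter_upwards [tendsto_norm_cobounded_atTop.eventually_gt_atTop 1] with z hz
  exact norm_cauchyTransform_le hΓ hΓ1 hf hz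

/-! ### The boundary values of the Cauchy transform -/

/-- The difference of the Cauchy kernel at height `σ = ±1` and the truncated principal value
kernel. -/
noncomputable def jumpKernel (σ s : ℝ) : ℂ :=
  1 / ((s : ℂ) - σ * Complex.I) - (Metric.ball (0 : ℝ) 1)ᶜ.indicator (fun s : ℝ => 1 / (s : ℂ)) s

theorem measurable_jumpKernel (σ : ℝ) : Measurable (jumpKernel σ) := by
  unfold jumpKernel
  refine Measurable.sub (by fun_prop) ?_
  exact Measurable.indicator (by fun_prop) Metric.isOpen_ball.measurableSet.compl

theorem norm_sub_mul_I_sq (s σ : ℝ) : ‖(s : ℂ) - σ * Complex.I‖ ^ 2 = s ^ 2 + σ ^ 2 := by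
  rw [← Complex.normSq_eq_norm_sq, Complex.normSq_apply]
  simp
  ring

theorem ofReal_sub_mul_I_ne_zero {s σ : ℝ} (hσ : σ ≠ 0) : (s : ℂ) - σ * Complex.I ≠ 0 := by
  intro h
  have := congrArg Complex.im h
  simp at this
  exact hσ this

/-- Subtracting `1 / s` leaves `σ i / (s (s - σ i))`, so the kernel is integrable at infinity
although its two terms are not. -/
theorem norm_jumpKernel_le_of_one_le {σ s : ℝ} (hσ : σ ^ 2 = 1) (hs : 1 ≤ |s|) :
    ‖jumpKernel σ s‖ ≤ 1 / s ^ 2 := by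
  have hs0 : s ≠ 0 := by rintro rfl; norm_num at hs
  have hσ0 : σ ≠ 0 := by rintro rfl; norm_num at hσ
  have hmem : s ∈ (Metric.ball (0 : ℝ) 1)ᶜ := by
    simp [Real.norm_eq_abs, hs]
  have hne := ofReal_sub_mul_I_ne_zero (s := s) hσ0
  have hsC : (s : ℂ) ≠ 0 := by exact_mod_cast hs0
  have e : jumpKernel σ s = σ * Complex.I / (s * ((s : ℂ) - σ * Complex.I)) := by
    rw [jumpKernel, indicator_of_mem hmem]
    field_simp
    ring
  have h1 : |s| ≤ ‖(s : ℂ) - σ * Complex.I‖ := by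
    apply abs_le_of_sq_le_sq' _ (norm_nonneg _) |>.2
    rw [norm_sub_mul_I_sq, sq_abs]; nlinarith
  have hσ1 : |σ| = 1 := by
    rw [← sq_eq_sq₀ (abs_nonneg _) zero_le_one, sq_abs, hσ, one_pow]
  rw [e, norm_div, norm_mul, norm_mul, Complex.norm_real, Complex.norm_real, Complex.norm_I,
    Real.norm_eq_abs, Real.norm_eq_abs, hσ1, mul_one, ← sq_abs, sq]
  have := abs_pos.2 hs0
  gcongr

theorem norm_jumpKernel_le {σ : ℝ} (hσ : σ ^ 2 = 1) (s : ℝ) :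
    ‖jumpKernel σ s‖ ≤ 2 * (1 + s ^ 2)⁻¹ := by
  rw [← div_eq_mul_inv, le_div_iff₀ (by positivity)]
  by_cases hs : 1 ≤ |s|
  · have h1 := norm_jumpKernel_le_of_one_le hσ hs
    have h2 : 1 ≤ s ^ 2 := by rw [← sq_abs]; nlinarith
    rw [le_div_iff₀ (by positivity)] at h1
    nlinarith [norm_nonneg (jumpKernel σ s)]
  · push Not at hs
    have hmem : s ∉ (Metric.ball (0 : ℝ) 1)ᶜ := by simp [Real.norm_eq_abs, hs]
    have hσ0 : σ ≠ 0 := by rintro rfl; norm_num at hσ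
    have hpos := norm_pos_iff.2 (ofReal_sub_mul_I_ne_zero (s := s) hσ0)
    have h1 := norm_sub_mul_I_sq s σ
    have h2 : s ^ 2 ≤ 1 := by rw [← sq_abs]; nlinarith [abs_nonneg s]
    rw [jumpKernel, indicator_of_notMem hmem, sub_zero, norm_div, norm_one, one_div,
      inv_mul_le_iff₀ hpos]
    nlinarith

theorem integrable_jumpKernel {σ : ℝ} (hσ : σ ^ 2 = 1) : Integrable (jumpKernel σ) :=
  (integrable_inv_one_add_sq.const_mul 2).mono' (measurable_jumpKernel σ).aestronglyMeasurable
    (Eventually.of_forall (norm_jumpKernel_le hσ))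

/-- The truncated `1 / s` is odd, so symmetrizing in `s` leaves `2 σ i / (1 + s²)`. -/
theorem integral_jumpKernel {σ : ℝ} (hσ : σ ^ 2 = 1) :
    ∫ s, jumpKernel σ s = σ * Real.pi * Complex.I := by
  have hσ0 : σ ≠ 0 := by rintro rfl; norm_num at hσ
  have hσC : (σ : ℂ) ^ 2 = 1 := by exact_mod_cast hσ
  have hsum : ∀ s : ℝ, jumpKernel σ s + jumpKernel σ (-s)
      = 2 * σ * Complex.I * (((1 + s ^ 2)⁻¹ : ℝ) : ℂ) := by
    intro s
    have h1 := ofReal_sub_mul_I_ne_zero (s := s) hσ0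
    have h2 := ofReal_sub_mul_I_ne_zero (s := -s) hσ0
    have h3 : ((1 + s ^ 2 : ℝ) : ℂ) ≠ 0 := by
      exact_mod_cast (by positivity : (1 + s ^ 2 : ℝ) ≠ 0)
    have hI := Complex.I_sq
    have e : (Metric.ball (0 : ℝ) 1)ᶜ.indicator (fun s : ℝ => 1 / (s : ℂ)) (-s)
        = - (Metric.ball (0 : ℝ) 1)ᶜ.indicator (fun s : ℝ => 1 / (s : ℂ)) s := by
      by_cases hs : s ∈ (Metric.ball (0 : ℝ) 1)ᶜ
      · have hs' : -s ∈ (Metric.ball (0 : ℝ) 1)ᶜ := by simpa using hs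
        rw [indicator_of_mem hs, indicator_of_mem hs']
        push_cast
        rw [one_div, one_div, inv_neg]
      · have hs' : -s ∉ (Metric.ball (0 : ℝ) 1)ᶜ := by simpa using hs
        rw [indicator_of_notMem hs, indicator_of_notMem hs', neg_zero]
    have e2 : 1 / ((s : ℂ) - σ * Complex.I) + 1 / (((-s : ℝ) : ℂ) - σ * Complex.I)
        = 2 * σ * Complex.I * (((1 + s ^ 2)⁻¹ : ℝ) : ℂ) := by
      rw [Complex.ofReal_inv, ← div_eq_mul_inv, div_add_div _ _ h1 h2, div_eq_div_iff
        (mul_ne_zero h1 h2) h3]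
      push_cast
      linear_combination (-2 * σ * Complex.I) * (Complex.I ^ 2 * hσC + hI)
    rw [jumpKernel, jumpKernel, e, ← e2]
    ring
  have hi := integrable_jumpKernel hσ
  have h1 : ∫ s, (jumpKernel σ s + jumpKernel σ (-s)) = 2 * ∫ s, jumpKernel σ s := by
    rw [integral_add hi hi.comp_neg, integral_neg_eq_self, two_mul]
  simp_rw [hsum] at h1
  rw [integral_const_mul, integral_complex_ofReal, integral_univ_inv_one_add_sq] at h1
  linear_combination -h1 / 2

/-- The rescaled jump kernel is an approximate identity of mass `σ π i`. -/
theorem tendsto_integral_jumpKernel_mul {σ : ℝ} (hσ : σ ^ 2 = 1) {g : ℝ → ℂ} {x M : ℝ}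
    (hg : AEStronglyMeasurable g) (hM : ∀ w, ‖g w‖ ≤ M) (hc : ContinuousAt g x) :
    Tendsto (fun ε : ℝ => ∫ s, jumpKernel σ s * g (x + ε * s)) (𝓝[>] 0)
      (𝓝 (σ * Real.pi * Complex.I * g x)) := by
  rw [← integral_jumpKernel hσ, ← integral_mul_const]
  have hi := integrable_jumpKernel hσ
  refine tendsto_integral_filter_of_dominated_convergence (fun s => ‖jumpKernel σ s‖ * M) ?_ ?_
    (hi.norm.mul_const M) ?_
  · filter_upwards [self_mem_nhdsWithin] with ε hε
    refine hi.aestronglyMeasurable.mul (hg.comp_quasiMeasurePreserving ?_)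
    have h1 := Measure.quasiMeasurePreserving_smul (volume : Measure ℝ) (ne_of_gt hε)
    have h2 := (measurePreserving_add_left (volume : Measure ℝ) x).quasiMeasurePreserving
    exact h2.comp h1
  · refine Eventually.of_forall fun ε => Eventually.of_forall fun s => ?_
    rw [norm_mul]
    gcongr
    exact hM _
  · refine Eventually.of_forall fun s => ?_
    refine Tendsto.const_mul _ ?_
    have h1 : Tendsto (fun ε : ℝ => x + ε * s) (𝓝[>] 0) (𝓝 x) := by
      have : Continuous fun ε : ℝ => x + ε * s := by fun_prop
      have h := this.tendsto 0
      simp only [zero_mul, add_zero] at h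
      exact h.mono_left nhdsWithin_le_nhds
    exact hc.tendsto.comp h1

theorem integral_comp_add_mul (G : ℝ → ℂ) (x : ℝ) {ε : ℝ} (hε : 0 < ε) :
    ∫ s, G (x + ε * s) = (ε : ℂ)⁻¹ * ∫ w, G w := by
  have h1 := Measure.integral_comp_mul_left (fun y => G (x + y)) ε
  rw [integral_add_left_eq_self (μ := (volume : Measure ℝ)) G x, abs_of_pos (inv_pos.2 hε)] at h1
  rw [h1, Complex.real_smul, Complex.ofReal_inv]

/-- The height above the axis and the truncation radius are the same `ε`, so the difference of the
two kernels is one fixed function of `(w - x) / ε`. -/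
theorem cauchyKernel_sub_truncated {σ ε : ℝ} (hσ : σ ^ 2 = 1) (hε : 0 < ε) (c : ℂ) (x w : ℝ) :
    c / ((w : ℂ) - (x + σ * ε * Complex.I)) -
      (Metric.ball x ε)ᶜ.indicator (fun w : ℝ => c / ((w - x : ℝ) : ℂ)) w =
      (ε : ℂ)⁻¹ * (jumpKernel σ ((w - x) / ε) * c) := by
  have hσ0 : σ ≠ 0 := by rintro rfl; norm_num at hσ
  have hεC : (ε : ℂ) ≠ 0 := by exact_mod_cast hε.ne'
  have h1 := ofReal_sub_mul_I_ne_zero (s := (w - x) / ε) hσ0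
  have e1 : (w : ℂ) - (x + σ * ε * Complex.I)
      = ε * ((((w - x) / ε : ℝ) : ℂ) - σ * Complex.I) := by
    push_cast
    field_simp
    ring
  have hiff : w ∈ (Metric.ball x ε)ᶜ ↔ (w - x) / ε ∈ (Metric.ball (0 : ℝ) 1)ᶜ := by
    simp only [mem_compl_iff, mem_ball_iff_norm, sub_zero, norm_div, Real.norm_eq_abs,
      abs_of_pos hε, div_lt_one hε]
  rw [e1, jumpKernel]
  by_cases hw : w ∈ (Metric.ball x ε)ᶜ
  · have hne : w - x ≠ 0 := by
      rintro h0
      simp [sub_eq_zero.1 h0] at hw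
      linarith
    have hneC : ((w - x : ℝ) : ℂ) ≠ 0 := by exact_mod_cast hne
    rw [indicator_of_mem hw, indicator_of_mem (hiff.1 hw)]
    generalize (((w - x) / ε : ℝ) : ℂ) - σ * Complex.I = q at *
    push_cast at hneC ⊢
    field_simp
  · rw [indicator_of_notMem hw, indicator_of_notMem (fun h => hw (hiff.2 h))]
    field_simp
    ring

/-- The Sokhotski–Plemelj formula, with a truncated principal value. -/
theorem tendsto_cauchyTransform_sub_truncated {Γ : Set ℝ} {f : ℝ → ℂ} {x σ : ℝ}
    (hΓ : MeasurableSet Γ) (hf : IntegrableOn f Γ) (hx : Γ ∈ 𝓝 x) (hc : ContinuousAt f x)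
    (hσ : σ ^ 2 = 1) :
    Tendsto (fun ε : ℝ => cauchyTransform Γ f (x + σ * ε * Complex.I) -
        ∫ w in Γ \ Metric.ball x ε, f w / ((w - x : ℝ) : ℂ)) (𝓝[>] 0)
      (𝓝 (σ * Real.pi * Complex.I * f x)) := by
  have hσ0 : σ ≠ 0 := by rintro rfl; norm_num at hσ
  obtain ⟨δ, hδ, hball⟩ : ∃ δ > 0, ∀ w ∈ Metric.ball x δ, w ∈ Γ ∧ ‖f w‖ ≤ ‖f x‖ + 1 := by
    have h1 : ∀ᶠ w in 𝓝 x, ‖f w‖ < ‖f x‖ + 1 :=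
      hc.norm.eventually_lt continuousAt_const (by simp)
    obtain ⟨δ, hδ, h⟩ := Metric.eventually_nhds_iff_ball.1 (Filter.Eventually.and hx h1)
    exact ⟨δ, hδ, fun w hw => ⟨(h w hw).1, (h w hw).2.le⟩⟩
  -- Near `x` the density is bounded and the approximate identity applies; the rest is estimated
  -- separately.
  set B := Metric.ball x δ with hB
  have hBm : MeasurableSet B := Metric.isOpen_ball.measurableSet
  have hBΓ : B ⊆ Γ := fun w hw => (hball w hw).1
  set g : ℝ → ℂ := B.indicator f with hg
  have hgint : Integrable g := (integrable_indicator_iff hBm).2 (hf.mono_set hBΓ)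
  have hgb : ∀ w, ‖g w‖ ≤ ‖f x‖ + 1 := by
    intro w
    by_cases hw : w ∈ B
    · rw [hg, indicator_of_mem hw]; exact (hball w hw).2
    · rw [hg, indicator_of_notMem hw, norm_zero]; positivity
  have hxB : x ∈ B := Metric.mem_ball_self hδ
  have hgx : g x = f x := by rw [hg, indicator_of_mem hxB]
  have hgc : ContinuousAt g x := by
    refine hc.congr ?_
    filter_upwards [Metric.isOpen_ball.mem_nhds hxB] with w hw
    rw [hg, indicator_of_mem hw]
  have hnear := tendsto_integral_jumpKernel_mul hσ hgint.aestronglyMeasurable hgb hgc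
  rw [hgx] at hnear
  -- Away from `x` the kernel is at most `(ε / δ)²`, which beats the prefactor `1 / ε`.
  have hfar : Tendsto (fun ε : ℝ => ∫ w in Γ \ B, (ε : ℂ)⁻¹ * (jumpKernel σ ((w - x) / ε) * f w))
      (𝓝[>] 0) (𝓝 0) := by
    have hlim : Tendsto (fun ε : ℝ => (∫ w in Γ \ B, ‖f w‖) * (ε / δ ^ 2)) (𝓝[>] 0) (𝓝 0) := by
      have : Continuous fun ε : ℝ => (∫ w in Γ \ B, ‖f w‖) * (ε / δ ^ 2) := by fun_prop
      have h := this.tendsto 0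
      simp only [zero_div, mul_zero] at h
      exact h.mono_left nhdsWithin_le_nhds
    refine squeeze_zero_norm' ?_ hlim
    filter_upwards [Ioo_mem_nhdsGT hδ] with ε hε
    rw [← integral_mul_const]
    refine norm_integral_le_of_norm_le ((hf.mono_set sdiff_subset).norm.mul_const _) ?_
    refine (ae_restrict_iff' (hΓ.diff hBm)).2 (Eventually.of_forall fun w hw => ?_)
    have hwδ : δ ≤ |w - x| := by
      have := hw.2
      rwa [hB, mem_ball_iff_norm, not_lt, Real.norm_eq_abs] at this
    have hs : 1 ≤ |(w - x) / ε| := by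
      rw [abs_div, abs_of_pos hε.1, one_le_div hε.1]
      linarith [hε.2]
    have h1 := norm_jumpKernel_le_of_one_le hσ hs
    have hε0 := hε.1
    rw [norm_mul, norm_mul, norm_inv, Complex.norm_real, Real.norm_eq_abs, abs_of_pos hε.1]
    have h2 : 1 / ((w - x) / ε) ^ 2 ≤ ε ^ 2 / δ ^ 2 := by
      rw [div_pow, one_div_div, ← sq_abs (w - x)]
      gcongr
    calc ε⁻¹ * (‖jumpKernel σ ((w - x) / ε)‖ * ‖f w‖) ≤ ε⁻¹ * (ε ^ 2 / δ ^ 2 * ‖f w‖) := by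
          gcongr; exact h1.trans h2
      _ = ‖f w‖ * (ε / δ ^ 2) := by field_simp
  have hsum := hnear.add hfar
  rw [add_zero] at hsum
  refine hsum.congr' ?_
  filter_upwards [Ioo_mem_nhdsGT hδ] with ε hε
  have hε0 := hε.1
  have hz : ((x : ℂ) + σ * ε * Complex.I).im = σ * ε := by simp
  have hi1 : IntegrableOn (fun w : ℝ => f w / ((w : ℂ) - (x + σ * ε * Complex.I))) Γ := by
    have hpos : 0 < |σ * ε| := abs_pos.2 (mul_ne_zero hσ0 hε0.ne')
    refine (hf.norm.mul_const (1 / |σ * ε|)).mono' (hf.aestronglyMeasurable.div₀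
      (Complex.continuous_ofReal.sub continuous_const).aestronglyMeasurable) ?_
    refine Eventually.of_forall fun w => ?_
    have := abs_im_le_norm_ofReal_sub w (x + σ * ε * Complex.I)
    rw [hz] at this
    rw [norm_div, div_eq_mul_one_div]
    gcongr
  have hi2 : IntegrableOn (fun w : ℝ => f w / ((w - x : ℝ) : ℂ)) (Γ \ Metric.ball x ε) := by
    have hf' : IntegrableOn f (Γ \ Metric.ball x ε) := hf.mono_set sdiff_subset
    refine (hf'.norm.mul_const (1 / ε)).mono' (hf'.aestronglyMeasurable.div₀
      (by fun_prop)) ?_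
    refine (ae_restrict_iff' (hΓ.diff Metric.isOpen_ball.measurableSet)).2
      (Eventually.of_forall fun w hw => ?_)
    have := hw.2
    rw [mem_ball_iff_norm, not_lt] at this
    rw [norm_div, div_eq_mul_one_div, Complex.norm_real]
    gcongr
  have hi2' : IntegrableOn (fun w => (Metric.ball x ε)ᶜ.indicator
      (fun w : ℝ => f w / ((w - x : ℝ) : ℂ)) w) Γ := by
    rw [IntegrableOn, integrable_indicator_iff Metric.isOpen_ball.measurableSet.compl,
      IntegrableOn, Measure.restrict_restrict Metric.isOpen_ball.measurableSet.compl,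
      inter_comm, ← sdiff_eq]
    exact hi2
  have hker : ∀ w : ℝ, (ε : ℂ)⁻¹ * (jumpKernel σ ((w - x) / ε) * f w) =
      f w / ((w : ℂ) - (x + σ * ε * Complex.I)) -
        (Metric.ball x ε)ᶜ.indicator (fun w : ℝ => f w / ((w - x : ℝ) : ℂ)) w := by
    intro w
    rw [← cauchyKernel_sub_truncated hσ hε0 (f w) x w]
    simp only [indicator]
  have hi3 : IntegrableOn (fun w => (ε : ℂ)⁻¹ * (jumpKernel σ ((w - x) / ε) * f w)) Γ := by
    simp_rw [hker]
    exact hi1.sub hi2'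
  have e1 : ∫ s, jumpKernel σ s * g (x + ε * s) =
      ∫ w in B, (ε : ℂ)⁻¹ * (jumpKernel σ ((w - x) / ε) * f w) := by
    have h := integral_comp_add_mul (fun w => jumpKernel σ ((w - x) / ε) * g w) x hε0
    simp only [add_sub_cancel_left, mul_div_cancel_left₀ _ hε0.ne'] at h
    rw [h, integral_const_mul, ← integral_indicator hBm]
    congr 2
    funext w
    by_cases hw : w ∈ B
    · rw [hg, indicator_of_mem hw, indicator_of_mem hw]
    · rw [hg, indicator_of_notMem hw, indicator_of_notMem hw, mul_zero]
  have e2 : (∫ w in B, (ε : ℂ)⁻¹ * (jumpKernel σ ((w - x) / ε) * f w)) +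
      ∫ w in Γ \ B, (ε : ℂ)⁻¹ * (jumpKernel σ ((w - x) / ε) * f w) =
      ∫ w in Γ, (ε : ℂ)⁻¹ * (jumpKernel σ ((w - x) / ε) * f w) := by
    rw [← setIntegral_union disjoint_sdiff_right (hΓ.diff hBm) (hi3.mono_set hBΓ)
      (hi3.mono_set sdiff_subset), union_sdiff_cancel hBΓ]
  have e3 : ∫ w in Γ \ Metric.ball x ε, f w / ((w - x : ℝ) : ℂ) =
      ∫ w in Γ, (Metric.ball x ε)ᶜ.indicator (fun w : ℝ => f w / ((w - x : ℝ) : ℂ)) w := by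
    rw [setIntegral_indicator Metric.isOpen_ball.measurableSet.compl, sdiff_eq]
  rw [e1, e2, e3, cauchyTransform, ← integral_sub hi1 hi2']
  exact integral_congr_ae (Eventually.of_forall hker)

/-! ### Analytic extension of the Cauchy transform across its support -/

theorem differentiableAt_intervalIntegral_div_sub {f γ : ℝ → ℂ} {a b : ℝ}
    (hf : IntervalIntegrable f volume a b) (hγ : Continuous γ) {z : ℂ} {δ : ℝ} (hδ : 0 < δ)
    (h : ∀ t, δ ≤ ‖γ t - z‖) :
    DifferentiableAt ℂ (fun ζ => ∫ t in a..b, f t / (γ t - ζ)) z := by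
  simp_rw [intervalIntegral.intervalIntegral_eq_integral_uIoc]
  exact (differentiableAt_integral_div_sub (intervalIntegrable_iff.1 hf)
    hγ.aestronglyMeasurable hδ (Eventually.of_forall h)).const_smul _

/-- Principal values are known only at real points; the identity theorem carries their equalities
into the plane. -/
theorem eqOn_of_eq_on_real {f g : ℂ → ℂ} {U : Set ℂ} (hU : IsOpen U) (hUc : IsPreconnected U)
    (hf : DifferentiableOn ℂ f U) (hg : DifferentiableOn ℂ g U) {c d x₀ : ℝ}
    (hx₀ : x₀ ∈ Ioo c d) (hx₀U : (x₀ : ℂ) ∈ U) (h : ∀ x ∈ Ioo c d, f (x : ℂ) = g (x : ℂ)) :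
    EqOn f g U := by
  refine (hf.analyticOnNhd hU).eqOn_of_preconnected_of_frequently_eq (hg.analyticOnNhd hU) hUc
    hx₀U ?_
  have ht : Tendsto (fun x : ℝ => (x : ℂ)) (𝓝[≠] x₀) (𝓝[≠] (x₀ : ℂ)) := by
    refine tendsto_nhdsWithin_of_tendsto_nhds_of_eventually_within _
      (Complex.continuous_ofReal.continuousAt.mono_left nhdsWithin_le_nhds) ?_
    filter_upwards [self_mem_nhdsWithin] with x hx
    exact fun he => hx (Complex.ofReal_injective he)
  refine ht.frequently (Eventually.frequently ?_)
  filter_upwards [nhdsWithin_le_nhds (Ioo_mem_nhds hx₀.1 hx₀.2)] with x hx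
  exact h x hx

theorem tendsto_vertical (x σ : ℝ) :
    Tendsto (fun ε : ℝ => (x : ℂ) + σ * ε * Complex.I) (𝓝[>] 0) (𝓝 (x : ℂ)) := by
  have : Continuous fun ε : ℝ => (x : ℂ) + σ * ε * Complex.I := by fun_prop
  have h := this.tendsto 0
  simp only [Complex.ofReal_zero, mul_zero, zero_mul, add_zero] at h
  exact h.mono_left nhdsWithin_le_nhds

/-- The Cauchy transform of a function that is analytic on `[c, d]` extends from the half plane of
sign `σ` across `(c, d)`. -/
theorem exists_cauchyTransform_extension_half {Γ : Set ℝ} {f : ℝ → ℂ} (hΓ : MeasurableSet Γ)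
    (hf : IntegrableOn f Γ) {c d η : ℝ} (hη : 0 < η) (hcd : c < d) (hsub : Icc c d ⊆ Γ)
    {h : ℂ → ℂ} (hh : DifferentiableOn ℂ h (Icc c d ×ℂ Icc (-η) η))
    (hfh : ∀ w ∈ Icc c d, f w = h w) {σ : ℝ} (hσ : σ ^ 2 = 1) :
    ∃ L : ℂ → ℂ, DifferentiableOn ℂ L (Ioo c d ×ℂ Ioo (-η) η) ∧
      ∀ z ∈ Ioo c d ×ℂ Ioo (-η) η, 0 < σ * z.im → cauchyTransform Γ f z = L z := by
  have hσ' : σ = 1 ∨ σ = -1 := by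
    rcases mul_eq_zero.1 (show (σ - 1) * (σ + 1) = 0 by linarith) with h1 | h1
    · left; linarith
    · right; linarith
  have hση : uIcc 0 (-(σ * η)) ⊆ Icc (-η) η := by
    rcases hσ' with rfl | rfl <;> intro y hy <;> rw [mem_uIcc] at hy <;>
      rcases hy with hy | hy <;> constructor <;> linarith [hy.1, hy.2]
  have hb1 : ∀ x ∈ Icc c d, ∀ y ∈ uIcc 0 (-(σ * η)), (x : ℂ) + y * Complex.I ∈
      Icc c d ×ℂ Icc (-η) η := by
    intro x hx y hy
    rw [Complex.mem_reProdIm]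
    simpa using ⟨hx, hση hy⟩
  have hcont : ∀ x ∈ Icc c d, IntervalIntegrable (fun y : ℝ => h (x + y * Complex.I)) volume
      0 (-(σ * η)) := by
    intro x hx
    refine ContinuousOn.intervalIntegrable ?_
    exact hh.continuousOn.comp (by fun_prop) fun y hy => hb1 x hx y hy
  have hcont2 : IntervalIntegrable (fun x : ℝ => h (x + (-(σ * η) : ℝ) * Complex.I)) volume
      c d := by
    refine ContinuousOn.intervalIntegrable ?_
    rw [uIcc_of_le hcd.le]
    exact hh.continuousOn.comp (by fun_prop) fun x hx => hb1 x hx _ right_mem_uIcc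
  -- The segment `[c, d]` is pushed to the other three sides of a rectangle of height `-ση`, lying
  -- in the half plane opposite to `z`. Those sides, and the remaining part of `Γ`, stay away from
  -- the open box, so the new integrals are analytic on all of it.
  refine ⟨fun z => cauchyTransform (Γ \ Icc c d) f z +
    ((∫ x in c..d, h (x + (-(σ * η) : ℝ) * Complex.I) /
        (x + (-(σ * η) : ℝ) * Complex.I - z)) -
      Complex.I * (∫ y in (0 : ℝ)..(-(σ * η)), h (d + y * Complex.I) / (d + y * Complex.I - z)) +
      Complex.I * (∫ y in (0 : ℝ)..(-(σ * η)), h (c + y * Complex.I) / (c + y * Complex.I - z))),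
    ?_, ?_⟩
  · intro z hz
    rw [Complex.mem_reProdIm] at hz
    obtain ⟨⟨hz1, hz2⟩, hz3, hz4⟩ := hz
    refine DifferentiableAt.differentiableWithinAt ?_
    refine DifferentiableAt.add ?_ (DifferentiableAt.add (DifferentiableAt.sub ?_
      (DifferentiableAt.const_mul ?_ _)) (DifferentiableAt.const_mul ?_ _))
    · refine differentiableAt_cauchyTransform (hΓ.diff measurableSet_Icc)
        (hf.mono_set sdiff_subset) (δ := min (z.re - c) (d - z.re))
        (lt_min (by linarith) (by linarith)) fun w hw => ?_
      have h1 := Complex.abs_re_le_norm ((w : ℂ) - z)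
      simp only [Complex.sub_re, Complex.ofReal_re] at h1
      refine le_trans ?_ h1
      rcases lt_or_ge w c with hwc | hwc
      · exact (min_le_left _ _).trans (by rw [abs_sub_comm]; exact (le_abs_self _).trans' (by linarith))
      · have : d < w := by
          by_contra hle
          exact hw.2 ⟨hwc, not_lt.1 hle⟩
        exact (min_le_right _ _).trans ((le_abs_self _).trans' (by linarith))
    · refine differentiableAt_intervalIntegral_div_sub hcont2 (by fun_prop)
        (δ := min (η - z.im) (z.im + η)) (lt_min (by linarith) (by linarith)) fun t => ?_
      have h1 := Complex.abs_im_le_norm ((t : ℂ) + (-(σ * η) : ℝ) * Complex.I - z)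
      have e : ((t : ℂ) + (-(σ * η) : ℝ) * Complex.I - z).im = -(σ * η) - z.im := by simp
      rw [e] at h1
      refine le_trans ?_ h1
      rcases hσ' with rfl | rfl
      · exact (min_le_right _ _).trans ((neg_le_abs _).trans' (by linarith))
      · exact (min_le_left _ _).trans ((le_abs_self _).trans' (by linarith))
    · refine differentiableAt_intervalIntegral_div_sub (hcont d (right_mem_Icc.2 hcd.le))
        (by fun_prop) (δ := d - z.re) (by linarith) fun t => ?_
      have h1 := Complex.abs_re_le_norm ((d : ℂ) + t * Complex.I - z)
      simp at h1
      exact h1.trans' (le_abs_self _)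
    · refine differentiableAt_intervalIntegral_div_sub (hcont c (left_mem_Icc.2 hcd.le))
        (by fun_prop) (δ := z.re - c) (by linarith) fun t => ?_
      have h1 := Complex.abs_re_le_norm ((c : ℂ) + t * Complex.I - z)
      simp at h1
      exact h1.trans' ((neg_le_abs _).trans' (by linarith))
  · intro z hz hzσ
    rw [Complex.mem_reProdIm] at hz
    have hzim : z.im ≠ 0 := by rintro h0; simp [h0] at hzσ
    -- The point `z` lies outside this rectangle, so `h(ζ) / (ζ - z)` has no pole in it.
    have hrect := Complex.integral_boundary_rect_eq_zero_of_differentiableOn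
      (fun ζ => h ζ / (ζ - z)) (c : ℂ) ((d : ℂ) + (-(σ * η) : ℝ) * Complex.I) (by
        intro ζ hζ
        rw [Complex.mem_reProdIm] at hζ
        simp only [Complex.add_re, Complex.ofReal_re, Complex.mul_re, Complex.I_re, mul_zero,
          Complex.ofReal_im, Complex.I_im, sub_zero, add_zero, Complex.add_im, Complex.mul_im,
          mul_one, zero_add, uIcc_of_le hcd.le] at hζ
        have hne : ζ - z ≠ 0 := by
          intro h0
          rw [sub_eq_zero] at h0
          have h2 := hζ.2
          rw [h0, mem_uIcc] at h2
          rcases hσ' with rfl | rfl <;> rcases h2 with h2 | h2 <;> linarith [h2.1, h2.2]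
        refine DifferentiableWithinAt.div ?_ (by fun_prop) hne
        refine (hh ζ (Complex.mem_reProdIm.2 ⟨hζ.1, hση hζ.2⟩)).mono ?_
        intro w hw
        rw [Complex.mem_reProdIm] at hw ⊢
        simp only [Complex.add_re, Complex.ofReal_re, Complex.mul_re, Complex.I_re, mul_zero,
          Complex.ofReal_im, Complex.I_im, sub_zero, add_zero, Complex.add_im, Complex.mul_im,
          mul_one, zero_add, uIcc_of_le hcd.le] at hw
        exact ⟨hw.1, hση hw.2⟩)
    simp only [Complex.add_re, Complex.ofReal_re, Complex.mul_re, Complex.I_re, mul_zero,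
          Complex.ofReal_im, Complex.I_im, sub_zero, add_zero, Complex.add_im, Complex.mul_im,
          mul_one, zero_add, Complex.ofReal_zero, zero_mul, smul_eq_mul] at hrect
    have hi : IntegrableOn (fun w : ℝ => f w / ((w : ℂ) - z)) Γ := by
      refine (hf.norm.mul_const (1 / |z.im|)).mono' (hf.aestronglyMeasurable.div₀
        (Complex.continuous_ofReal.sub continuous_const).aestronglyMeasurable) ?_
      refine Eventually.of_forall fun w => ?_
      have := abs_im_le_norm_ofReal_sub w z
      have := abs_pos.2 hzim
      rw [norm_div, div_eq_mul_one_div]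
      gcongr
    have e1 : cauchyTransform Γ f z = cauchyTransform (Γ \ Icc c d) f z +
        ∫ x in c..d, h x / ((x : ℂ) - z) := by
      rw [cauchyTransform, cauchyTransform, intervalIntegral.integral_of_le hcd.le,
        ← integral_Icc_eq_integral_Ioc]
      have e2 : ∫ x in Icc c d, h x / ((x : ℂ) - z) = ∫ x in Icc c d, f x / ((x : ℂ) - z) :=
        setIntegral_congr_fun measurableSet_Icc fun x hx => by simp only [hfh x hx]
      rw [e2, ← setIntegral_union disjoint_sdiff_left measurableSet_Icc
        (hi.mono_set sdiff_subset) (hi.mono_set hsub), sdiff_union_of_subset hsub]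
    rw [e1]
    linear_combination hrect

/-- Near a point of its support around which the density is analytic, the Cauchy transform is
an analytic function plus or minus `π i` times the density; the analytic function is the principal
value. -/
theorem exists_cauchyTransform_extension {Γ : Set ℝ} {f : ℝ → ℂ} (hΓ : MeasurableSet Γ)
    (hf : IntegrableOn f Γ) {c d η : ℝ} (hη : 0 < η) (hcd : c < d) (hsub : Icc c d ⊆ Γ)
    {h : ℂ → ℂ} (hh : DifferentiableOn ℂ h (Icc c d ×ℂ Icc (-η) η))
    (hfh : ∀ w ∈ Icc c d, f w = h w) :
    ∃ H : ℂ → ℂ, DifferentiableOn ℂ H (Ioo c d ×ℂ Ioo (-η) η) ∧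
      (∀ z ∈ Ioo c d ×ℂ Ioo (-η) η, 0 < z.im →
        cauchyTransform Γ f z = H z + Real.pi * Complex.I * h z) ∧
      (∀ z ∈ Ioo c d ×ℂ Ioo (-η) η, z.im < 0 →
        cauchyTransform Γ f z = H z - Real.pi * Complex.I * h z) ∧
      ∀ x ∈ Ioo c d, Tendsto (fun ε : ℝ => ∫ w in Γ \ Metric.ball x ε, f w / ((w - x : ℝ) : ℂ))
        (𝓝[>] 0) (𝓝 (H x)) := by
  obtain ⟨L, hLd, hL⟩ := exists_cauchyTransform_extension_half hΓ hf hη hcd hsub hh hfh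
    (σ := 1) (by norm_num)
  obtain ⟨L', hLd', hL'⟩ := exists_cauchyTransform_extension_half hΓ hf hη hcd hsub hh hfh
    (σ := -1) (by norm_num)
  set U := Ioo c d ×ℂ Ioo (-η) η with hU
  have hUo : IsOpen U := isOpen_Ioo.reProdIm isOpen_Ioo
  have hUc : IsPreconnected U := (((convex_Ioo c d).linear_preimage Complex.reLm).inter
    ((convex_Ioo (-η) η).linear_preimage Complex.imLm)).isPreconnected
  have hhU : DifferentiableOn ℂ h U := hh.mono
    (Complex.reProdIm_subset_iff.2 (prod_mono Ioo_subset_Icc_self Ioo_subset_Icc_self))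
  have hxU : ∀ x ∈ Ioo c d, (x : ℂ) ∈ U := fun x hx =>
    Complex.mem_reProdIm.2 ⟨by simpa using hx, by simpa using hη⟩
  have hlim : ∀ σ : ℝ, σ ^ 2 = 1 → ∀ Λ : ℂ → ℂ, DifferentiableOn ℂ Λ U →
      (∀ z ∈ U, 0 < σ * z.im → cauchyTransform Γ f z = Λ z) → ∀ x ∈ Ioo c d,
      Tendsto (fun ε : ℝ => ∫ w in Γ \ Metric.ball x ε, f w / ((w - x : ℝ) : ℂ))
        (𝓝[>] 0) (𝓝 (Λ x - σ * Real.pi * Complex.I * h x)) := by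
    intro σ hσ Λ hΛ hFΛ x hx
    have hxn : U ∈ 𝓝 (x : ℂ) := hUo.mem_nhds (hxU x hx)
    have hfc : ContinuousAt f x := by
      have h1 : ContinuousAt (fun w : ℝ => h (w : ℂ)) x :=
        ContinuousAt.comp (f := fun w : ℝ => (w : ℂ)) (g := h)
          (hhU.differentiableAt hxn).continuousAt Complex.continuous_ofReal.continuousAt
      refine h1.congr ?_
      filter_upwards [Ioo_mem_nhds hx.1 hx.2] with w hw
      exact (hfh w (Ioo_subset_Icc_self hw)).symm
    have h1 := tendsto_cauchyTransform_sub_truncated hΓ hf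
      (mem_of_superset (Icc_mem_nhds hx.1 hx.2) hsub) hfc hσ
    have h2 : Tendsto (fun ε : ℝ => cauchyTransform Γ f (x + σ * ε * Complex.I)) (𝓝[>] 0)
        (𝓝 (Λ x)) := by
      have h3 := ((hΛ.differentiableAt hxn).continuousAt.tendsto).comp (tendsto_vertical x σ)
      refine h3.congr' ?_
      filter_upwards [self_mem_nhdsWithin, (tendsto_vertical x σ).eventually hxn] with ε hε hεU
      refine (hFΛ _ hεU ?_).symm
      have : ((x : ℂ) + σ * ε * Complex.I).im = σ * ε := by simp
      rw [this, ← mul_assoc, ← sq, hσ, one_mul]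
      exact hε
    have h4 := h2.sub h1
    rw [hfh x (Ioo_subset_Icc_self hx)] at h4
    refine h4.congr fun ε => ?_
    ring
  have hA := hlim 1 (by norm_num) L hLd hL
  have hB := hlim (-1) (by norm_num) L' hLd' hL'
  have hx₀ : (c + d) / 2 ∈ Ioo c d := ⟨by linarith, by linarith⟩
  -- Both sides equal the principal value on `(c, d)`: the extensions from above and from below,
  -- each corrected by its jump, are one analytic function.
  have heq : EqOn (fun z => L z - Real.pi * Complex.I * h z)
      (fun z => L' z + Real.pi * Complex.I * h z) U := by
    refine eqOn_of_eq_on_real hUo hUc (hLd.sub (hhU.const_mul _)) (hLd'.add (hhU.const_mul _))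
      hx₀ (hxU _ hx₀) fun x hx => ?_
    have := tendsto_nhds_unique (hA x hx) (hB x hx)
    push_cast at this
    linear_combination this
  refine ⟨fun z => L z - Real.pi * Complex.I * h z, hLd.sub (hhU.const_mul _), ?_, ?_, ?_⟩
  · intro z hz hz0
    rw [hL z hz (by linarith)]
    ring
  · intro z hz hz0
    have := heq hz
    simp only at this
    rw [hL' z hz (by linarith)]
    linear_combination -this
  · intro x hx
    simpa using hA x hx

/-! ### Gluing, removable singularities and Liouville's theorem off the real line -/

/-- The multiplier `(w - x₀)² - ρ²` vanishes at the two real points of the circle and there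
compensates a growth of order `1 / |im w|`. -/
theorem norm_sub_sq_sub_sq_of_mem_sphere {x₀ ρ : ℝ} {w : ℂ} (hw : ‖w - x₀‖ = ρ) :
    ‖(w - x₀) ^ 2 - (ρ : ℂ) ^ 2‖ = 2 * ρ * |w.im| := by
  have h1 : (w.re - x₀) ^ 2 + w.im ^ 2 = ρ ^ 2 := by
    rw [← hw, ← Complex.normSq_eq_norm_sq, Complex.normSq_apply]
    simp
    ring
  have e : (w - x₀) ^ 2 - (ρ : ℂ) ^ 2 = 2 * Complex.I * w.im * (w - x₀) := by
    rw [← Complex.ofReal_pow, ← h1]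
    apply Complex.ext <;> simp [sq] <;> ring
  rw [e, norm_mul, norm_mul, norm_mul, hw, Complex.norm_I, Complex.norm_real, Real.norm_eq_abs]
  simp
  ring

/-- In a sector away from the axis the hypothesis is already the claim. Close to the axis the
maximum principle, applied to `g` times the multiplier above on a disc avoiding `c`, transfers the
bound from the circle to `z`. -/
theorem norm_sub_mul_le_of_abs_im_mul_le {g : ℂ → ℂ} {c r ε : ℝ} (hε : 0 ≤ ε)
    (hg : DifferentiableOn ℂ g (Metric.ball (c : ℂ) r \ {(c : ℂ)}))
    (hb : ∀ z ∈ Metric.ball (c : ℂ) r, z.im ≠ 0 → |z.im| * ‖g z‖ ≤ ε) {z : ℂ} (hz : z ≠ c)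
    (hzr : ‖z - c‖ < r / 2) : ‖g z‖ * ‖z - c‖ ≤ 4 * ε := by
  set t := ‖z - c‖ with ht
  have ht0 : 0 < t := norm_pos_iff.2 (sub_ne_zero.2 hz)
  have htsq : (z.re - c) ^ 2 + z.im ^ 2 = t ^ 2 := by
    rw [ht, ← Complex.normSq_eq_norm_sq, Complex.normSq_apply]
    simp
    ring
  rcases le_or_gt (t / 4) |z.im| with him | him
  · have h1 : z.im ≠ 0 := abs_pos.1 (by linarith)
    have h2 := hb z (mem_ball_iff_norm.2 (by linarith)) h1
    have h3 : t / 4 * ‖g z‖ ≤ |z.im| * ‖g z‖ := by gcongr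
    linarith
  -- Since `|im z| < t / 4`, the real part of `z` is further than `t / 2` from `c`, so the closed
  -- disc of radius `ρ` about it misses `c`. At `z` the multiplier has absolute value `(im z)² + ρ²
  -- ≥ ρ²`.
  · set ρ := t / 2 with hρ
    have hρ0 : 0 < ρ := by positivity
    have him2 : z.im ^ 2 < (t / 4) ^ 2 := by rw [← sq_abs z.im]; gcongr
    have hre : ρ < |z.re - c| := by
      refine lt_of_pow_lt_pow_left₀ 2 (abs_nonneg _) ?_
      rw [sq_abs]
      nlinarith
    have hre2 : |z.re - c| ≤ t := by
      refine abs_le_of_sq_le_sq ?_ ht0.le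
      nlinarith [sq_nonneg z.im]
    have hdist : ∀ w : ℂ, ‖w - z.re‖ ≤ ρ → w ∈ Metric.ball (c : ℂ) r \ {(c : ℂ)} := by
      intro w hw
      have e : ‖(z.re : ℂ) - c‖ = |z.re - c| := by
        rw [← Complex.ofReal_sub, Complex.norm_real, Real.norm_eq_abs]
      constructor
      · rw [mem_ball_iff_norm]
        have := norm_add_le (w - z.re) ((z.re : ℂ) - c)
        rw [sub_add_sub_cancel, e] at this
        linarith
      · rintro rfl
        rw [norm_sub_rev, e] at hw
        linarith
    have hmax := Complex.norm_le_of_forall_mem_frontier_norm_le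
      (f := fun w => g w * ((w - z.re) ^ 2 - (ρ : ℂ) ^ 2)) (U := Metric.ball (z.re : ℂ) ρ)
      Metric.isBounded_ball (C := 2 * ρ * ε) (by
        refine DifferentiableOn.diffContOnCl ?_
        rw [closure_ball _ hρ0.ne']
        refine DifferentiableOn.mul (hg.mono fun w hw => hdist w (mem_closedBall_iff_norm.1 hw)) ?_
        fun_prop) (by
        intro w hw
        rw [frontier_ball _ hρ0.ne', mem_sphere_iff_norm] at hw
        rw [norm_mul, norm_sub_sq_sub_sq_of_mem_sphere hw]
        by_cases hw0 : w.im = 0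
        · rw [hw0, abs_zero, mul_zero, mul_zero]; positivity
        · have := hb w (hdist w hw.le).1 hw0
          nlinarith) (z := z) (by
        rw [closure_ball _ hρ0.ne', mem_closedBall_iff_norm]
        have : z - z.re = z.im * Complex.I := by
          apply Complex.ext <;> simp
        rw [this, norm_mul, Complex.norm_I, mul_one, Complex.norm_real, Real.norm_eq_abs]
        linarith)
    have e : (z - z.re) ^ 2 - (ρ : ℂ) ^ 2 = ((-(z.im ^ 2 + ρ ^ 2) : ℝ) : ℂ) := by
      have : z - z.re = z.im * Complex.I := by
        apply Complex.ext <;> simp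
      rw [this, mul_pow, Complex.I_sq]
      push_cast
      ring
    simp only [e, norm_mul, Complex.norm_real, Real.norm_eq_abs, abs_neg] at hmax
    rw [abs_of_nonneg (by positivity)] at hmax
    have h5 : ‖g z‖ * ρ ^ 2 ≤ 2 * ρ * ε := by
      nlinarith [mul_nonneg (norm_nonneg (g z)) (sq_nonneg z.im)]
    have h6 : ‖g z‖ * ρ ≤ 2 * ε := by
      refine le_of_mul_le_mul_right ?_ hρ0
      linarith
    rw [hρ] at h6
    linarith

/-- A singularity on the real line is removable as soon as `(im z) g(z)` tends to zero. -/
theorem exists_differentiableAt_of_im_mul_tendsto_zero {g : ℂ → ℂ} {c : ℝ}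
    (hg : ∀ᶠ z in 𝓝[≠] (c : ℂ), DifferentiableAt ℂ g z)
    (hb : Tendsto (fun z : ℂ => (z.im : ℂ) * g z) (𝓝[{z | z.im ≠ 0}] (c : ℂ)) (𝓝 0)) :
    ∃ H : ℂ → ℂ, AnalyticAt ℂ H c ∧ ∀ z : ℂ, z ≠ c → H z = g z := by
  -- Riemann's removable singularity theorem in its little-o form: the growth of `g` is strictly
  -- below that of a simple pole.
  have ho : (fun z => g z - g c) =o[𝓝[≠] (c : ℂ)] fun z => (z - c)⁻¹ := by
    have h1 : g =o[𝓝[≠] (c : ℂ)] fun z => (z - c)⁻¹ := by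
      rw [Asymptotics.isLittleO_iff]
      intro ε hε
      have h2 : ∀ᶠ z in 𝓝[{z | z.im ≠ 0}] (c : ℂ), ‖(z.im : ℂ) * g z‖ < ε / 4 := by
        have := hb.norm
        rw [norm_zero] at this
        exact this.eventually_lt_const (by positivity)
      rw [eventually_nhdsWithin_iff] at h2 hg
      obtain ⟨r, hr, hball⟩ := Metric.eventually_nhds_iff_ball.1 (h2.and hg)
      rw [eventually_nhdsWithin_iff]
      filter_upwards [Metric.ball_mem_nhds (c : ℂ) (half_pos hr)] with z hz hzc
      have h3 := norm_sub_mul_le_of_abs_im_mul_le (g := g) (c := c) (r := r) (ε := ε / 4)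
        (by positivity)
        (fun w hw => ((hball w hw.1).2 hw.2).differentiableWithinAt)
        (fun w hw hw0 => by
          have := (hball w hw).1 hw0
          rw [norm_mul, Complex.norm_real, Real.norm_eq_abs] at this
          exact this.le) hzc (mem_ball_iff_norm.1 hz)
      have h4 : 0 < ‖z - c‖ := norm_pos_iff.2 (sub_ne_zero.2 hzc)
      rw [norm_inv, ← div_eq_mul_inv, le_div_iff₀ h4]
      linarith
    have h2 : (fun _ : ℂ => g c) =o[𝓝[≠] (c : ℂ)] fun z => (z - c)⁻¹ := by
      refine Asymptotics.isLittleO_const_left.2 (Or.inr ?_)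
      have h3 : Tendsto (fun z : ℂ => z - c) (𝓝[≠] (c : ℂ)) (𝓝[≠] 0) := by
        refine tendsto_nhdsWithin_of_tendsto_nhds_of_eventually_within _ ?_ ?_
        · have : Continuous fun z : ℂ => z - c := by fun_prop
          have h := this.tendsto (c : ℂ)
          rw [sub_self] at h
          exact h.mono_left nhdsWithin_le_nhds
        · filter_upwards [self_mem_nhdsWithin] with z hz
          exact sub_ne_zero.2 hz
      exact tendsto_norm_cobounded_atTop.comp (tendsto_inv₀_nhdsNE_zero.comp h3)
    exact h1.sub h2
  rw [eventually_nhdsWithin_iff] at hg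
  obtain ⟨r, hr, hball⟩ := Metric.eventually_nhds_iff_ball.1 hg
  have hs : Metric.ball (c : ℂ) r ∈ 𝓝 (c : ℂ) := Metric.ball_mem_nhds _ hr
  have hd := Complex.differentiableOn_update_limUnder_of_isLittleO hs
    (fun z hz => ((hball z hz.1) hz.2).differentiableWithinAt) ho
  exact ⟨_, hd.analyticAt hs, fun z hz => Function.update_of_ne hz _ _⟩

theorem neBot_nhdsWithin_im_ne_zero (z : ℂ) : (𝓝[{w : ℂ | w.im ≠ 0}] z).NeBot := by
  have hd : Dense {w : ℂ | w.im ≠ 0} :=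
    (dense_compl_singleton (0 : ℝ)).preimage Complex.isOpenMap_im
  exact mem_closure_iff_nhdsWithin_neBot.1 (hd z)

/-- A function that off the real line agrees near each point with an analytic function agrees off
the real line with an entire function. -/
theorem exists_entire_of_forall_exists_analyticAt {D : ℂ → ℂ} {S : Set ℂ} (hSf : S.Finite)
    (hSr : ∀ z ∈ S, z.im = 0)
    (hD : ∀ z ∉ S, ∃ H : ℂ → ℂ, AnalyticAt ℂ H z ∧ ∀ᶠ w in 𝓝 z, w.im ≠ 0 → D w = H w)
    (hS : ∀ c : ℝ, (c : ℂ) ∈ S →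
      Tendsto (fun z : ℂ => (z.im : ℂ) * D z) (𝓝[{z | z.im ≠ 0}] (c : ℂ)) (𝓝 0)) :
    ∃ E : ℂ → ℂ, Differentiable ℂ E ∧ ∀ z, z.im ≠ 0 → E z = D z := by
  -- The values of `D` on the axis carry no information, so `E` is defined at every point as the
  -- limit of `D` through nonreal points.
  set E : ℂ → ℂ := fun z => limUnder (𝓝[{w : ℂ | w.im ≠ 0}] z) D with hE
  have hloc : ∀ z H, AnalyticAt ℂ H z → (∀ᶠ w in 𝓝 z, w.im ≠ 0 → D w = H w) →
      E =ᶠ[𝓝 z] H := by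
    intro z H hH hDH
    filter_upwards [hH.eventually_analyticAt, hDH.eventually_nhds] with w hw hDw
    have hne := neBot_nhdsWithin_im_ne_zero w
    refine Tendsto.limUnder_eq ?_
    refine (hw.continuousAt.tendsto.mono_left nhdsWithin_le_nhds).congr' ?_
    filter_upwards [eventually_nhdsWithin_iff.2 hDw] with v hv
    exact hv.symm
  have hEoff : ∀ z : ℂ, z.im ≠ 0 → E z = D z := by
    intro z hz
    obtain ⟨H, hH, hDH⟩ := hD z (fun hzS => hz (hSr z hzS))
    rw [(hloc z H hH hDH).self_of_nhds, hDH.self_of_nhds hz]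
  have hall : ∀ z, ∃ H : ℂ → ℂ, AnalyticAt ℂ H z ∧ ∀ᶠ w in 𝓝 z, w.im ≠ 0 → D w = H w := by
    intro z
    by_cases hzS : z ∈ S
    · have hz : z = (z.re : ℂ) := by
        apply Complex.ext
        · simp
        · simp [hSr z hzS]
      have h1 : ∀ᶠ w in 𝓝[≠] (z.re : ℂ), DifferentiableAt ℂ E w := by
        have h2 : (S \ {z})ᶜ ∈ 𝓝 z := (hSf.sdiff).isClosed.isOpen_compl.mem_nhds (by simp)
        rw [← hz, eventually_nhdsWithin_iff]
        filter_upwards [h2] with w hw hwz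
        have hwS : w ∉ S := fun h => hw ⟨h, hwz⟩
        obtain ⟨H, hH, hDH⟩ := hD w hwS
        exact hH.differentiableAt.congr_of_eventuallyEq (hloc w H hH hDH)
      have h3 : Tendsto (fun w : ℂ => (w.im : ℂ) * E w) (𝓝[{w | w.im ≠ 0}] (z.re : ℂ)) (𝓝 0) := by
        refine (hS z.re (hz ▸ hzS)).congr' ?_
        filter_upwards [self_mem_nhdsWithin] with w hw
        rw [hEoff w hw]
      obtain ⟨H, hH, hEH⟩ := exists_differentiableAt_of_im_mul_tendsto_zero h1 h3
      rw [← hz] at hH hEH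
      refine ⟨H, hH, Eventually.of_forall fun w hw => ?_⟩
      rw [hEH w (by rintro rfl; exact hw (hSr _ hzS)), hEoff w hw]
    · exact hD z hzS
  refine ⟨E, fun z => ?_, hEoff⟩
  obtain ⟨H, hH, hDH⟩ := hall z
  exact hH.differentiableAt.congr_of_eventuallyEq (hloc z H hH hDH)

/-- Liouville's theorem for an entire function that is bounded near infinity off the real line. -/
theorem exists_eq_const_of_eventually_bounded {E : ℂ → ℂ} (hE : Differentiable ℂ E) {C : ℝ}
    (hb : ∀ᶠ z in Bornology.cobounded ℂ, z.im ≠ 0 → ‖E z‖ ≤ C) : ∃ c, ∀ z, E z = c := by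
  refine hE.exists_const_forall_eq_of_bounded ?_
  obtain ⟨r, -, hr⟩ := hasBasis_cobounded_norm.eventually_iff.1 hb
  have hout : ∀ z : ℂ, r < ‖z‖ → ‖E z‖ ≤ C := by
    intro z hz
    have hne := neBot_nhdsWithin_im_ne_zero z
    have h1 : Tendsto (fun w => ‖E w‖) (𝓝[{w : ℂ | w.im ≠ 0}] z) (𝓝 ‖E z‖) :=
      (hE z).continuousAt.norm.tendsto.mono_left nhdsWithin_le_nhds
    refine le_of_tendsto h1 ?_
    have h2 : ∀ᶠ w : ℂ in 𝓝 z, r < ‖w‖ := continuous_norm.continuousAt.eventually_const_lt hz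
    rw [eventually_nhdsWithin_iff]
    filter_upwards [h2] with w hw hw0
    exact hr hw.le hw0
  have h3 : range E ⊆ E '' Metric.closedBall 0 r ∪ Metric.closedBall 0 C := by
    rintro _ ⟨z, rfl⟩
    rcases le_or_gt ‖z‖ r with h | h
    · exact Or.inl ⟨z, by simpa using h, rfl⟩
    · exact Or.inr (by simpa using hout z h)
  exact (((isCompact_closedBall 0 r).image hE.continuous).isBounded.union
    Metric.isBounded_closedBall).subset h3

/-! ### Square roots -/

/-- The principal square root. -/
noncomputable def psqrt (z : ℂ) : ℂ := z ^ (1 / 2 : ℂ)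

theorem psqrt_sq (z : ℂ) : psqrt z ^ 2 = z := by
  rw [psqrt, ← Complex.cpow_nat_mul]
  norm_num

theorem psqrt_eq_zero_iff {z : ℂ} : psqrt z = 0 ↔ z = 0 := by
  refine ⟨fun h => ?_, fun h => by simp [psqrt, h]⟩
  rw [← psqrt_sq z, h]
  norm_num

theorem psqrt_of_ne_zero {z : ℂ} (hz : z ≠ 0) : psqrt z = Complex.exp (Complex.log z / 2) := by
  rw [psqrt, Complex.cpow_def_of_ne_zero hz]
  congr 1
  ring

theorem differentiableAt_psqrt {z : ℂ} (hz : z ∈ Complex.slitPlane) :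
    DifferentiableAt ℂ psqrt z :=
  (hasDerivAt_id z).cpow_const hz |>.differentiableAt

theorem psqrt_ofReal {x : ℝ} (hx : 0 ≤ x) : psqrt x = (Real.sqrt x : ℂ) := by
  rw [psqrt, Real.sqrt_eq_rpow, Complex.ofReal_cpow hx]
  norm_num

/-- On the upper half plane and the negative axis, passing to `-z` lowers the principal argument by
`π`. This continues `psqrt` across the negative axis from above. -/
theorem psqrt_eq_I_mul {z : ℂ} (hz : 0 < z.im ∨ z.im = 0 ∧ z.re < 0) :
    psqrt z = Complex.I * psqrt (-z) := by
  have hz0 : z ≠ 0 := by rintro rfl; simp at hz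
  have h1 := Complex.arg_neg_eq_arg_sub_pi_iff.2 hz
  have h2 : Complex.log (-z) = Complex.log z - Real.pi * Complex.I := by
    rw [Complex.log, Complex.log, h1, norm_neg]
    push_cast
    ring
  rw [psqrt_of_ne_zero hz0, psqrt_of_ne_zero (neg_ne_zero.2 hz0), h2, sub_div, Complex.exp_sub,
    show (Real.pi : ℂ) * Complex.I / 2 = Real.pi / 2 * Complex.I by ring,
    Complex.exp_pi_div_two_mul_I]
  field_simp [Complex.I_ne_zero]

theorem psqrt_eq_neg_I_mul {z : ℂ} (hz : z.im < 0) : psqrt z = -Complex.I * psqrt (-z) := by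
  have h := psqrt_eq_I_mul (z := -z) (Or.inl (by simpa using hz))
  rw [neg_neg] at h
  rw [h, ← mul_assoc, neg_mul, Complex.I_mul_I]
  ring

theorem psqrt_ofReal_of_neg {x : ℝ} (hx : x < 0) : psqrt x = Complex.I * (Real.sqrt (-x) : ℂ) := by
  rw [psqrt_eq_I_mul (Or.inr ⟨by simp, by simpa using hx⟩), ← Complex.ofReal_neg,
    psqrt_ofReal (by linarith)]

/-- The principal argument is `π` on the negative axis, so the value of `psqrt` there is already the
limit from the upper half plane. This is why the radicals below take upper boundary values on their
cuts. -/
theorem tendsto_psqrt_nhdsWithin_upper {x : ℝ} (hx : x ≠ 0) :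
    Tendsto psqrt (𝓝[{z : ℂ | 0 < z.im}] (x : ℂ)) (𝓝 (psqrt x)) := by
  rcases lt_or_gt_of_ne hx with h | h
  · have h1 : Tendsto (fun z : ℂ => Complex.I * psqrt (-z)) (𝓝[{z : ℂ | 0 < z.im}] (x : ℂ))
        (𝓝 (Complex.I * psqrt (-x))) := by
      refine Tendsto.mono_left ?_ nhdsWithin_le_nhds
      have h2 : DifferentiableAt ℂ psqrt (-(x : ℂ)) :=
        differentiableAt_psqrt (by left; simpa using h)
      have h3 : ContinuousAt (fun z : ℂ => psqrt (-z)) (x : ℂ) :=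
        ContinuousAt.comp (f := fun z : ℂ => -z) (g := psqrt) h2.continuousAt
          continuous_neg.continuousAt
      exact h3.tendsto.const_mul _
    rw [psqrt_eq_I_mul (z := (x : ℂ)) (Or.inr ⟨by simp, by simpa using h⟩)]
    refine h1.congr' ?_
    filter_upwards [self_mem_nhdsWithin] with z hz
    exact (psqrt_eq_I_mul (Or.inl hz)).symm
  · exact (differentiableAt_psqrt (by left; simpa using h)).continuousAt.tendsto.mono_left
      nhdsWithin_le_nhds

/-- For `a ≤ b` the difference `arg (z - b) - arg (z - a)` stays in `(-π, π]`, so the logarithm of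
the quotient splits. Factored this way, products of radicals can be regrouped into other systems of
cuts. -/
theorem cutRoot_eq_psqrt_mul {a b : ℝ} (hab : a ≤ b) (z : ℂ) :
    cutRoot a b z = psqrt (z - a) * psqrt (z - b) := by
  by_cases ha : z - a = 0
  · simp [cutRoot, ha, psqrt]
  by_cases hb : z - b = 0
  · simp [cutRoot, hb, psqrt]
  have harg : Complex.arg (z - b) - Complex.arg (z - a) ∈ Ioc (-Real.pi) Real.pi := by
    have hpi := Real.pi_pos
    rcases lt_trichotomy z.im 0 with h | h | h
    · have h1 : Complex.arg (z - a) < 0 := Complex.arg_neg_iff.2 (by simpa using h)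
      have h2 : Complex.arg (z - b) < 0 := Complex.arg_neg_iff.2 (by simpa using h)
      have h3 := Complex.neg_pi_lt_arg (z - a)
      have h4 := Complex.neg_pi_lt_arg (z - b)
      constructor <;> linarith
    · have hz : z = (z.re : ℂ) := by apply Complex.ext <;> simp [h]
      rw [hz] at ha hb ⊢
      generalize z.re = x at *
      rw [← Complex.ofReal_sub] at ha hb ⊢
      rw [← Complex.ofReal_sub]
      have ha' : x - a ≠ 0 := by exact_mod_cast ha
      have hb' : x - b ≠ 0 := by exact_mod_cast hb
      rcases lt_or_gt_of_ne hb' with h2 | h2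
      · rw [Complex.arg_ofReal_of_neg h2]
        rcases lt_or_gt_of_ne ha' with h1 | h1
        · rw [Complex.arg_ofReal_of_neg h1]; constructor <;> linarith
        · rw [Complex.arg_ofReal_of_nonneg h1.le]; constructor <;> linarith
      · rw [Complex.arg_ofReal_of_nonneg h2.le, Complex.arg_ofReal_of_nonneg (by linarith)]
        constructor <;> linarith
    · have h1 : 0 ≤ Complex.arg (z - a) := Complex.arg_nonneg_iff.2 (by simpa using h.le)
      have h2 : 0 ≤ Complex.arg (z - b) := Complex.arg_nonneg_iff.2 (by simpa using h.le)
      have h3 : Complex.arg (z - a) < Real.pi := by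
        refine Complex.arg_lt_pi_iff.2 (Or.inr ?_)
        simpa using h.ne'
      have h4 := Complex.arg_le_pi (z - b)
      constructor <;> linarith
  have hlog : Complex.log ((z - b) / (z - a)) = Complex.log (z - b) - Complex.log (z - a) := by
    have h1 : (z - b) / (z - a) = Complex.exp (Complex.log (z - b) - Complex.log (z - a)) := by
      rw [Complex.exp_sub, Complex.exp_log hb, Complex.exp_log ha]
    rw [h1, Complex.log_exp]
    · simpa [Complex.log_im] using harg.1
    · simpa [Complex.log_im] using harg.2
  have h1 : cutRoot a b z = (z - a) * psqrt ((z - b) / (z - a)) := rfl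
  rw [h1, psqrt_of_ne_zero (div_ne_zero hb ha), hlog, sub_div, Complex.exp_sub,
    ← psqrt_of_ne_zero ha, ← psqrt_of_ne_zero hb]
  have h2 : psqrt (z - a) ≠ 0 := fun h => ha (psqrt_eq_zero_iff.1 h)
  rw [mul_div_assoc', div_eq_iff h2]
  nth_rewrite 1 [← psqrt_sq (z - a)]
  ring

theorem differentiableAt_cutRoot {a b : ℝ} (hab : a ≤ b) {z : ℂ}
    (hz : ∀ x ∈ Icc a b, (x : ℂ) ≠ z) : DifferentiableAt ℂ (cutRoot a b) z := by
  have hza : z - a ≠ 0 := sub_ne_zero.2 (hz a (left_mem_Icc.2 hab)).symm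
  have hslit : (z - b) / (z - a) ∈ Complex.slitPlane := by
    rw [Complex.mem_slitPlane_iff_not_le_zero]
    intro hle
    obtain ⟨t, ht, hte⟩ : ∃ t : ℝ, 0 ≤ t ∧ (z - b) / (z - a) = -(t : ℂ) := by
      rw [Complex.le_def] at hle
      refine ⟨-((z - b) / (z - a)).re, by simpa using hle.1, ?_⟩
      apply Complex.ext
      · simp
      · simpa using hle.2
    rw [div_eq_iff hza] at hte
    have h1 : (1 + (t : ℂ)) ≠ 0 := by
      exact_mod_cast (by positivity : (1 + t : ℝ) ≠ 0)
    -- The quotient `(z - b) / (z - a)` equals `-t` with `t ≥ 0` only at this convex combination of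
    -- `a` and `b`, which is on the cut.
    refine hz ((b + t * a) / (1 + t)) ⟨?_, ?_⟩ ?_
    · rw [le_div_iff₀ (by positivity)]; nlinarith
    · rw [div_le_iff₀ (by positivity)]; nlinarith
    · push_cast
      rw [div_eq_iff h1]
      linear_combination -hte
  have h1 : DifferentiableAt ℂ (fun z : ℂ => (z - b) / (z - a)) z := by
    refine DifferentiableAt.div ?_ ?_ hza <;> fun_prop
  have h2 : DifferentiableAt ℂ (fun z : ℂ => psqrt ((z - b) / (z - a))) z :=
    DifferentiableAt.comp (f := fun z : ℂ => (z - b) / (z - a)) (g := psqrt) z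
      (differentiableAt_psqrt hslit) h1
  exact (differentiableAt_id.sub_const (a : ℂ)).mul h2

/-- The branch of `√(1 - z²)` that is analytic off `(-∞, -1] ∪ [1, ∞)`. -/
noncomputable def circleRoot (z : ℂ) : ℂ := psqrt (1 - z) * psqrt (1 + z)

theorem circleRoot_ofReal {x : ℝ} (hx : x ∈ Icc (-1 : ℝ) 1) :
    circleRoot x = (Real.sqrt (1 - x ^ 2) : ℂ) := by
  have h1 : (0 : ℝ) ≤ 1 - x := by linarith [hx.2]
  have h2 : (0 : ℝ) ≤ 1 + x := by linarith [hx.1]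
  rw [circleRoot, show (1 : ℂ) - x = ((1 - x : ℝ) : ℂ) by push_cast; rfl,
    show (1 : ℂ) + x = ((1 + x : ℝ) : ℂ) by push_cast; rfl, psqrt_ofReal h1, psqrt_ofReal h2,
    ← Complex.ofReal_mul, ← Real.sqrt_mul h1]
  congr 2
  ring

theorem differentiableAt_circleRoot {z : ℂ} (hz : z.re ∈ Ioo (-1 : ℝ) 1) :
    DifferentiableAt ℂ circleRoot z := by
  have h1 : DifferentiableAt ℂ (fun z : ℂ => psqrt (1 - z)) z :=
    DifferentiableAt.comp (f := fun z : ℂ => 1 - z) (g := psqrt) z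
      (differentiableAt_psqrt (by left; simpa using hz.2)) (by fun_prop)
  have h2 : DifferentiableAt ℂ (fun z : ℂ => psqrt (1 + z)) z :=
    DifferentiableAt.comp (f := fun z : ℂ => 1 + z) (g := psqrt) z
      (differentiableAt_psqrt (by left; have := hz.1; simp; linarith)) (by fun_prop)
  exact h1.mul h2

theorem cutRoot_unit_of_im_pos {z : ℂ} (hz : 0 < z.im) :
    cutRoot (-1) 1 z = Complex.I * circleRoot z := by
  rw [cutRoot_eq_psqrt_mul (by norm_num), circleRoot, psqrt_eq_I_mul (z := z - (1 : ℝ))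
    (Or.inl (by simpa using hz))]
  push_cast
  rw [neg_sub, sub_neg_eq_add, add_comm z]
  ring

theorem cutRoot_unit_of_im_neg {z : ℂ} (hz : z.im < 0) :
    cutRoot (-1) 1 z = -Complex.I * circleRoot z := by
  rw [cutRoot_eq_psqrt_mul (by norm_num), circleRoot, psqrt_eq_neg_I_mul (z := z - (1 : ℝ))
    (by simpa using hz)]
  push_cast
  rw [neg_sub, sub_neg_eq_add, add_comm z]
  ring

theorem cutRoot_unit_sq (z : ℂ) : cutRoot (-1) 1 z ^ 2 = z ^ 2 - 1 := by
  rw [cutRoot_sq]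
  push_cast
  ring

theorem sq_sub_one_ne_zero_of_im_ne_zero {z : ℂ} (hz : z.im ≠ 0) : z ^ 2 - 1 ≠ 0 := by
  have h1 := ofReal_ne_of_im_ne_zero hz 1
  have h2 := ofReal_ne_of_im_ne_zero hz (-1)
  push_cast at h1 h2
  rw [show z ^ 2 - 1 = (z - 1) * (z - -1) by ring]
  exact mul_ne_zero (sub_ne_zero.2 h1.symm) (sub_ne_zero.2 h2.symm)

/-! ### The radicals of the four branch points -/

section Surface

variable {a₁ a₂ a₃ a₄ : ℝ}

/-- The branch of the square root of `(z² - 1) ∏ (z - aⱼ)` that is analytic off the spectral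
support. -/
noncomputable def supportRoot (a₁ a₂ a₃ a₄ : ℝ) (z : ℂ) : ℂ :=
  cutRoot (-1) a₁ z * cutRoot a₂ a₃ z * cutRoot a₄ 1 z

theorem surfaceRoot_eq (h₁ : a₁ < a₂) (h₃ : a₃ < a₄) (z : ℂ) :
    surfaceRoot a₁ a₂ a₃ a₄ z =
      psqrt (z - a₁) * psqrt (z - a₂) * (psqrt (z - a₃) * psqrt (z - a₄)) := by
  rw [surfaceRoot, cutRoot_eq_psqrt_mul h₁.le, cutRoot_eq_psqrt_mul h₃.le]

/-- Both sides are the same six principal square roots. On the bands the sign changes of `R` and of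
`√(z² - 1)` cancel, so the product is analytic across them. -/
theorem surfaceRoot_mul_cutRoot (h₀ : -1 ≤ a₁) (h₁ : a₁ < a₂) (h₂ : a₂ < a₃) (h₃ : a₃ < a₄)
    (h₄ : a₄ ≤ 1) (z : ℂ) :
    surfaceRoot a₁ a₂ a₃ a₄ z * cutRoot (-1) 1 z = supportRoot a₁ a₂ a₃ a₄ z := by
  rw [surfaceRoot_eq h₁ h₃, supportRoot, cutRoot_eq_psqrt_mul h₀, cutRoot_eq_psqrt_mul h₂.le,
    cutRoot_eq_psqrt_mul h₄, cutRoot_eq_psqrt_mul (by norm_num)]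
  ring

theorem differentiableAt_supportRoot (h₀ : -1 ≤ a₁) (h₂ : a₂ < a₃) (h₄ : a₄ ≤ 1) {z : ℂ}
    (hz : ∀ x ∈ spectralSupport a₁ a₂ a₃ a₄, (x : ℂ) ≠ z) :
    DifferentiableAt ℂ (supportRoot a₁ a₂ a₃ a₄) z :=
  ((differentiableAt_cutRoot h₀ fun x hx => hz x (Or.inl (Or.inl hx))).mul
    (differentiableAt_cutRoot h₂.le fun x hx => hz x (Or.inl (Or.inr hx)))).mul
    (differentiableAt_cutRoot h₄ fun x hx => hz x (Or.inr hx))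

theorem differentiableAt_surfaceRoot (h₁ : a₁ < a₂) (h₃ : a₃ < a₄) {z : ℂ}
    (hz : z ∉ bandSet a₁ a₂ a₃ a₄) : DifferentiableAt ℂ (surfaceRoot a₁ a₂ a₃ a₄) z :=
  (differentiableAt_cutRoot h₁.le fun x hx he => hz ⟨x, Or.inl hx, he⟩).mul
    (differentiableAt_cutRoot h₃.le fun x hx he => hz ⟨x, Or.inr hx, he⟩)

theorem surfaceRoot_ne_zero {z : ℂ} (hz : z ∉ branchPoints a₁ a₂ a₃ a₄) :
    surfaceRoot a₁ a₂ a₃ a₄ z ≠ 0 := by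
  intro h
  have h1 := surfaceRoot_sq a₁ a₂ a₃ a₄ z
  rw [h, zero_pow two_ne_zero, eq_comm] at h1
  apply hz
  simp only [mul_eq_zero, sub_eq_zero] at h1
  simp only [branchPoints, mem_insert_iff, mem_singleton_iff]
  tauto

theorem im_eq_zero_of_mem_branchPoints {z : ℂ} (hz : z ∈ branchPoints a₁ a₂ a₃ a₄) :
    z.im = 0 := by
  simp only [branchPoints, mem_insert_iff, mem_singleton_iff] at hz
  rcases hz with rfl | rfl | rfl | rfl <;> simp

theorem finite_branchPoints : (branchPoints a₁ a₂ a₃ a₄).Finite := by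
  unfold branchPoints
  exact toFinite _

theorem branchPoints_subset_bandSet (h₁ : a₁ < a₂) (h₃ : a₃ < a₄) :
    branchPoints a₁ a₂ a₃ a₄ ⊆ bandSet a₁ a₂ a₃ a₄ := by
  intro z hz
  simp only [branchPoints, mem_insert_iff, mem_singleton_iff] at hz
  rcases hz with rfl | rfl | rfl | rfl
  · exact ⟨a₁, Or.inl ⟨le_rfl, h₁.le⟩, rfl⟩
  · exact ⟨a₂, Or.inl ⟨h₁.le, le_rfl⟩, rfl⟩
  · exact ⟨a₃, Or.inr ⟨le_rfl, h₃.le⟩, rfl⟩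
  · exact ⟨a₄, Or.inr ⟨h₃.le, le_rfl⟩, rfl⟩

theorem ofReal_mem_branchPoints {x : ℝ} :
    (x : ℂ) ∈ branchPoints a₁ a₂ a₃ a₄ ↔ x = a₁ ∨ x = a₂ ∨ x = a₃ ∨ x = a₄ := by
  simp only [branchPoints, mem_insert_iff, mem_singleton_iff, Complex.ofReal_inj]

theorem isClosed_bandSet : IsClosed (bandSet a₁ a₂ a₃ a₄) :=
  Complex.isometry_ofReal.isClosedEmbedding.isClosedMap _ (isClosed_Icc.union isClosed_Icc)

theorem not_mem_bandSet_of_im_ne_zero {z : ℂ} (hz : z.im ≠ 0) : z ∉ bandSet a₁ a₂ a₃ a₄ := by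
  rintro ⟨x, -, rfl⟩
  exact hz (Complex.ofReal_im x)

theorem tendsto_surfaceRoot_upper (h₁ : a₁ < a₂) (h₃ : a₃ < a₄) {x : ℝ}
    (hx : (x : ℂ) ∉ branchPoints a₁ a₂ a₃ a₄) :
    Tendsto (surfaceRoot a₁ a₂ a₃ a₄) (𝓝[{z : ℂ | 0 < z.im}] (x : ℂ))
      (𝓝 (surfaceRoot a₁ a₂ a₃ a₄ x)) := by
  rw [ofReal_mem_branchPoints] at hx
  push Not at hx
  have key : ∀ a : ℝ, x ≠ a → Tendsto (fun z : ℂ => psqrt (z - a))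
      (𝓝[{z : ℂ | 0 < z.im}] (x : ℂ)) (𝓝 (psqrt ((x : ℂ) - a))) := by
    intro a ha
    have h1 := tendsto_psqrt_nhdsWithin_upper (sub_ne_zero.2 ha)
    rw [Complex.ofReal_sub] at h1
    refine h1.comp (tendsto_nhdsWithin_of_tendsto_nhds_of_eventually_within _ ?_ ?_)
    · have : Continuous fun z : ℂ => z - a := by fun_prop
      exact (this.tendsto (x : ℂ)).mono_left nhdsWithin_le_nhds
    · filter_upwards [self_mem_nhdsWithin] with z hz
      simpa using hz
  rw [funext (surfaceRoot_eq h₁ h₃)]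
  exact ((key a₁ hx.1).mul (key a₂ hx.2.1)).mul ((key a₃ hx.2.2.1).mul (key a₄ hx.2.2.2))

/-- The branch points are distinct, so each is a simple zero of `R²`. -/
theorem exists_surfaceRoot_sq_eq (h₁ : a₁ < a₂) (h₂ : a₂ < a₃) (h₃ : a₃ < a₄) {c : ℝ}
    (hc : (c : ℂ) ∈ branchPoints a₁ a₂ a₃ a₄) :
    ∃ q : ℂ → ℂ, Continuous q ∧ q c ≠ 0 ∧
      ∀ z, surfaceRoot a₁ a₂ a₃ a₄ z ^ 2 = (z - c) * q z := by
  have hne : ∀ {x y : ℝ}, x < y → ((x : ℂ) - y ≠ 0 ∧ (y : ℂ) - x ≠ 0) := by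
    intro x y hxy
    constructor <;> rw [sub_ne_zero] <;> exact_mod_cast (by linarith [hxy.ne] : _ ≠ _)
  rw [ofReal_mem_branchPoints] at hc
  simp_rw [surfaceRoot_sq]
  have h12 := hne h₁
  have h13 := hne (h₁.trans h₂)
  have h14 := hne ((h₁.trans h₂).trans h₃)
  have h23 := hne h₂
  have h24 := hne (h₂.trans h₃)
  have h34 := hne h₃
  rcases hc with rfl | rfl | rfl | rfl
  · exact ⟨fun z => (z - a₂) * (z - a₃) * (z - a₄), by fun_prop,
      mul_ne_zero (mul_ne_zero h12.1 h13.1) h14.1, fun z => by ring⟩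
  · exact ⟨fun z => (z - a₁) * (z - a₃) * (z - a₄), by fun_prop,
      mul_ne_zero (mul_ne_zero h12.2 h23.1) h24.1, fun z => by ring⟩
  · exact ⟨fun z => (z - a₁) * (z - a₂) * (z - a₄), by fun_prop,
      mul_ne_zero (mul_ne_zero h13.2 h23.2) h34.1, fun z => by ring⟩
  · exact ⟨fun z => (z - a₁) * (z - a₂) * (z - a₃), by fun_prop,
      mul_ne_zero (mul_ne_zero h14.2 h24.2) h34.2, fun z => by ring⟩

theorem isClosed_spectralSupport : IsClosed (spectralSupport a₁ a₂ a₃ a₄) :=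
  (isClosed_Icc.union isClosed_Icc).union isClosed_Icc

theorem spectralSupport_subset (h₀ : -1 ≤ a₁) (h₁ : a₁ < a₂) (h₂ : a₂ < a₃) (h₃ : a₃ < a₄)
    (h₄ : a₄ ≤ 1) : spectralSupport a₁ a₂ a₃ a₄ ⊆ Icc (-1) 1 := by
  rintro x ((hx | hx) | hx) <;> constructor <;> linarith [hx.1, hx.2]

end Surface

/-! ### Integrability of the reciprocal radical -/

theorem intervalIntegrable_inv_sqrt (c d : ℝ) :
    IntervalIntegrable (fun x : ℝ => (Real.sqrt x)⁻¹) volume c d := by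
  refine (intervalIntegral.intervalIntegrable_rpow' (a := c) (b := d)
    (show (-1 : ℝ) < -(1 / 2) by norm_num)).congr_ae (Eventually.of_forall fun x => ?_)
  rcases le_or_gt 0 x with hx | hx
  · simp only [Real.rpow_neg hx, Real.sqrt_eq_rpow]
  -- For negative `x` the real power carries the factor `cos (-π / 2) = 0`, which agrees with the
  -- inverse of `√x = 0`.
  · have : -(1 / 2) * Real.pi = -(Real.pi / 2) := by ring
    simp only [Real.rpow_def_of_neg hx, Real.sqrt_eq_zero_of_nonpos hx.le, this, Real.cos_neg,
      Real.cos_pi_div_two, mul_zero, inv_zero]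

/-- The inverse square roots of `x - a` and of `a - x` each vanish on the wrong side of `a`, so
their sum is the two-sided function. -/
theorem intervalIntegrable_inv_sqrt_abs_sub (a c d : ℝ) :
    IntervalIntegrable (fun x : ℝ => (Real.sqrt |x - a|)⁻¹) volume c d := by
  have h1 := (intervalIntegrable_inv_sqrt (c - a) (d - a)).comp_sub_right a
  have h2 := (intervalIntegrable_inv_sqrt (a - c) (a - d)).comp_sub_left a
  simp only [sub_add_cancel, sub_sub_cancel] at h1 h2
  refine (h1.add h2).congr_ae (Eventually.of_forall fun x => ?_)
  beta_reduce
  rcases le_total 0 (x - a) with hx | hx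
  · rw [abs_of_nonneg hx, Real.sqrt_eq_zero_of_nonpos (show a - x ≤ 0 by linarith), inv_zero,
      add_zero]
  · rw [abs_of_nonpos hx, Real.sqrt_eq_zero_of_nonpos hx, inv_zero, zero_add, neg_sub]

/-- Every `x` is at distance at least `|a - b| / 2` from one of the two points, so only one factor
can be large. -/
theorem inv_sqrt_mul_inv_sqrt_le {a b : ℝ} (hab : a ≠ b) (x : ℝ) :
    (Real.sqrt |x - a|)⁻¹ * (Real.sqrt |x - b|)⁻¹ ≤
      (Real.sqrt (|a - b| / 2))⁻¹ * ((Real.sqrt |x - a|)⁻¹ + (Real.sqrt |x - b|)⁻¹) := by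
  have hpos : 0 < |a - b| / 2 := half_pos (abs_pos.2 (sub_ne_zero.2 hab))
  have hs := Real.sqrt_pos.2 hpos
  have h1 : |a - b| ≤ |x - a| + |x - b| := by
    have := abs_sub_le a x b
    rwa [abs_sub_comm a x] at this
  have hA := inv_nonneg.2 (Real.sqrt_nonneg |x - a|)
  have hB := inv_nonneg.2 (Real.sqrt_nonneg |x - b|)
  have hC := inv_nonneg.2 hs.le
  rcases le_or_gt (|a - b| / 2) |x - a| with h | h
  · have h2 : (Real.sqrt |x - a|)⁻¹ ≤ (Real.sqrt (|a - b| / 2))⁻¹ := by gcongr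
    nlinarith [mul_nonneg hC hA, mul_le_mul_of_nonneg_right h2 hB]
  · have h2 : (Real.sqrt |x - b|)⁻¹ ≤ (Real.sqrt (|a - b| / 2))⁻¹ := by
      gcongr
      linarith
    nlinarith [mul_nonneg hC hB, mul_le_mul_of_nonneg_right h2 hA]

theorem intervalIntegrable_inv_sqrt_mul {a b : ℝ} (hab : a ≠ b) (c d : ℝ) :
    IntervalIntegrable (fun x : ℝ => (Real.sqrt |x - a|)⁻¹ * (Real.sqrt |x - b|)⁻¹) volume c d := by
  refine IntervalIntegrable.mono_fun' (((intervalIntegrable_inv_sqrt_abs_sub a c d).add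
    (intervalIntegrable_inv_sqrt_abs_sub b c d)).const_mul (Real.sqrt (|a - b| / 2))⁻¹)
    (by fun_prop) ?_
  refine Eventually.of_forall fun x => ?_
  beta_reduce
  rw [Real.norm_of_nonneg (by positivity)]
  exact inv_sqrt_mul_inv_sqrt_le hab x

/-! ### The weight `1 / |R|` and integrability of the densities -/

section Weight

variable {a₁ a₂ a₃ a₄ : ℝ}

/-- The weight `1 / |R(x)|` on the real line. -/
noncomputable def weight (a₁ a₂ a₃ a₄ : ℝ) (x : ℝ) : ℝ :=
  (Real.sqrt |x - a₁|)⁻¹ * (Real.sqrt |x - a₂|)⁻¹ *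
    ((Real.sqrt |x - a₃|)⁻¹ * (Real.sqrt |x - a₄|)⁻¹)

theorem weight_nonneg (x : ℝ) : 0 ≤ weight a₁ a₂ a₃ a₄ x := by
  unfold weight
  positivity

theorem intervalIntegrable_weight (h₁ : a₁ < a₂) (h₂ : a₂ < a₃) (h₃ : a₃ < a₄) (c d : ℝ) :
    IntervalIntegrable (weight a₁ a₂ a₃ a₄) volume c d := by
  set s : ℝ → ℝ → ℝ := fun a x => (Real.sqrt |x - a|)⁻¹ with hs
  have hi : ∀ a b : ℝ, a ≠ b → IntervalIntegrable (fun x => s a x * s b x) volume c d :=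
    fun a b hab => intervalIntegrable_inv_sqrt_mul hab c d
  have hint := ((((hi a₁ a₃ (by linarith)).add (hi a₁ a₄ (by linarith))).add
    (hi a₂ a₃ (by linarith))).add (hi a₂ a₄ (by linarith))).const_mul
    ((Real.sqrt (|a₁ - a₂| / 2))⁻¹ * (Real.sqrt (|a₃ - a₄| / 2))⁻¹)
  refine hint.mono_fun' (by unfold weight; fun_prop) (Eventually.of_forall fun x => ?_)
  beta_reduce
  rw [Real.norm_of_nonneg (weight_nonneg x)]
  have h12 := inv_sqrt_mul_inv_sqrt_le h₁.ne x
  have h34 := inv_sqrt_mul_inv_sqrt_le h₃.ne x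
  calc weight a₁ a₂ a₃ a₄ x ≤ _ := mul_le_mul h12 h34 (by positivity) (by positivity)
    _ = _ := by simp only [hs]; ring

theorem norm_psqrt (z : ℂ) : ‖psqrt z‖ = Real.sqrt ‖z‖ := by
  rw [eq_comm, Real.sqrt_eq_iff_mul_self_eq (norm_nonneg _) (norm_nonneg _), ← norm_mul, ← sq,
    psqrt_sq]

theorem norm_inv_surfaceRoot (h₁ : a₁ < a₂) (h₃ : a₃ < a₄) (x : ℝ) :
    ‖(surfaceRoot a₁ a₂ a₃ a₄ x)⁻¹‖ = weight a₁ a₂ a₃ a₄ x := by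
  have h : ∀ a : ℝ, ‖(x : ℂ) - a‖ = |x - a| := fun a => by
    rw [← Complex.ofReal_sub, Complex.norm_real, Real.norm_eq_abs]
  rw [surfaceRoot_eq h₁ h₃, norm_inv, norm_mul, norm_mul, norm_mul, norm_psqrt, norm_psqrt,
    norm_psqrt, norm_psqrt, h, h, h, h, mul_inv, mul_inv, mul_inv, weight]

theorem measurable_surfaceRoot : Measurable (surfaceRoot a₁ a₂ a₃ a₄) := by
  unfold surfaceRoot cutRoot
  fun_prop

theorem integrableOn_div_surfaceRoot (h₁ : a₁ < a₂) (h₂ : a₂ < a₃) (h₃ : a₃ < a₄) {p : ℂ → ℂ}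
    (hp : Continuous p) :
    IntegrableOn (fun x : ℝ => p x / surfaceRoot a₁ a₂ a₃ a₄ x) (Icc (-1) 1) := by
  have hR : IntegrableOn (fun x : ℝ => (surfaceRoot a₁ a₂ a₃ a₄ x)⁻¹) (Icc (-1) 1) := by
    have h1 : IntegrableOn (weight a₁ a₂ a₃ a₄) (Icc (-1) 1) :=
      (integrableOn_Icc_iff_integrableOn_Ioc (by simp)).2
        ((intervalIntegrable_iff_integrableOn_Ioc_of_le (by norm_num)).1
          (intervalIntegrable_weight h₁ h₂ h₃ (-1) 1))
    refine h1.mono' ?_ (Eventually.of_forall fun x => (norm_inv_surfaceRoot h₁ h₃ x).le)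
    exact (measurable_surfaceRoot.comp Complex.measurable_ofReal).inv.aestronglyMeasurable
  simp_rw [div_eq_mul_inv]
  exact hR.continuousOn_mul (hp.comp Complex.continuous_ofReal).continuousOn isCompact_Icc

end Weight

/-! ### Elliptic integrals -/

section Elliptic

variable {a₁ a₂ a₃ a₄ : ℝ}

theorem ellipticParameter_nonneg (h₁ : a₁ < a₂) (h₂ : a₂ < a₃) (h₃ : a₃ < a₄) :
    0 ≤ ellipticParameter a₁ a₂ a₃ a₄ := by
  unfold ellipticParameter
  refine div_nonneg (mul_nonneg ?_ ?_) (mul_nonneg ?_ ?_) <;> linarith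

theorem ellipticParameter_lt_one (h₁ : a₁ < a₂) (h₂ : a₂ < a₃) (h₃ : a₃ < a₄) :
    ellipticParameter a₁ a₂ a₃ a₄ < 1 := by
  unfold ellipticParameter
  rw [div_lt_one (mul_pos (by linarith) (by linarith))]
  nlinarith [mul_pos (show 0 < a₄ - a₁ by linarith) (sub_pos.2 h₂)]

theorem one_sub_mul_sin_sq_pos {m : ℝ} (hm0 : 0 ≤ m) (hm : m < 1) (θ : ℝ) :
    0 < 1 - m * Real.sin θ ^ 2 := by
  nlinarith [Real.sin_sq_le_one θ, sq_nonneg (Real.sin θ)]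

theorem ellipticK_pos {m : ℝ} (hm0 : 0 ≤ m) (hm : m < 1) : 0 < ellipticK m := by
  refine intervalIntegral.intervalIntegral_pos_of_pos_on ?_ (fun θ _ => ?_) (by positivity)
  · refine Continuous.intervalIntegrable ?_ _ _
    refine continuous_const.div (by fun_prop) fun θ => ?_
    exact (Real.sqrt_pos.2 (one_sub_mul_sin_sq_pos hm0 hm θ)).ne'
  · have := Real.sqrt_pos.2 (one_sub_mul_sin_sq_pos hm0 hm θ)
    positivity

/-- The denominator of the substitution reducing the integrals over `[a₁, a₂]` to Legendre form. -/
noncomputable def legendreDen (a₁ a₂ a₄ θ : ℝ) : ℝ :=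
  (a₄ - a₂) + (a₂ - a₁) * Real.sin θ ^ 2

/-- The substitution reducing the integrals over `[a₁, a₂]` to Legendre form. -/
noncomputable def legendreSubst (a₁ a₂ a₄ θ : ℝ) : ℝ :=
  ((a₂ - a₁) * a₄ * Real.sin θ ^ 2 + (a₄ - a₂) * a₁) / legendreDen a₁ a₂ a₄ θ

theorem legendreDen_pos (h₁ : a₁ < a₂) (h₂ : a₂ < a₄) (θ : ℝ) : 0 < legendreDen a₁ a₂ a₄ θ := by
  unfold legendreDen
  have := mul_nonneg (sub_pos.2 h₁).le (sq_nonneg (Real.sin θ))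
  linarith

/-- The substitution is a Möbius function of `s = sin² θ` taking `0, 1, 1/m, ∞` to `a₁, a₂, a₃, a₄`
(when `m ≠ 0`). Hence each difference with an `aⱼ` is a constant times `s`, `1 - s`, `1 - m s` or
`1`, over the common denominator. -/
theorem legendreSubst_sub (h₁ : a₁ < a₂) (h₂ : a₂ < a₄) (θ : ℝ) :
    legendreSubst a₁ a₂ a₄ θ - a₁ =
      (a₂ - a₁) * (a₄ - a₁) * Real.sin θ ^ 2 / legendreDen a₁ a₂ a₄ θ := by
  have := (legendreDen_pos h₁ h₂ θ).ne'
  rw [legendreSubst, eq_div_iff this, sub_mul, div_mul_cancel₀ _ this, legendreDen]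
  ring

theorem sub_legendreSubst_two (h₁ : a₁ < a₂) (h₂ : a₂ < a₄) (θ : ℝ) :
    a₂ - legendreSubst a₁ a₂ a₄ θ =
      (a₄ - a₂) * (a₂ - a₁) * Real.cos θ ^ 2 / legendreDen a₁ a₂ a₄ θ := by
  have := (legendreDen_pos h₁ h₂ θ).ne'
  rw [legendreSubst, eq_div_iff this, sub_mul, div_mul_cancel₀ _ this, legendreDen, Real.cos_sq']
  ring

theorem sub_legendreSubst_three (h₁ : a₁ < a₂) (h₂ : a₂ < a₃) (h₃ : a₃ < a₄) (θ : ℝ) :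
    a₃ - legendreSubst a₁ a₂ a₄ θ = (a₄ - a₂) * (a₃ - a₁) *
      (1 - ellipticParameter a₁ a₂ a₃ a₄ * Real.sin θ ^ 2) / legendreDen a₁ a₂ a₄ θ := by
  have := (legendreDen_pos h₁ (h₂.trans h₃) θ).ne'
  have e : (a₄ - a₂) * (a₃ - a₁) * ellipticParameter a₁ a₂ a₃ a₄ = (a₄ - a₃) * (a₂ - a₁) :=
    mul_div_cancel₀ _ (mul_pos (by linarith) (by linarith)).ne'
  rw [legendreSubst, eq_div_iff this, sub_mul, div_mul_cancel₀ _ this, legendreDen]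
  linear_combination Real.sin θ ^ 2 * e

theorem sub_legendreSubst_four (h₁ : a₁ < a₂) (h₂ : a₂ < a₄) (θ : ℝ) :
    a₄ - legendreSubst a₁ a₂ a₄ θ = (a₄ - a₂) * (a₄ - a₁) / legendreDen a₁ a₂ a₄ θ := by
  have := (legendreDen_pos h₁ h₂ θ).ne'
  rw [legendreSubst, eq_div_iff this, sub_mul, div_mul_cancel₀ _ this, legendreDen]
  ring

theorem hasDerivAt_legendreSubst (h₁ : a₁ < a₂) (h₂ : a₂ < a₄) (θ : ℝ) :
    HasDerivAt (legendreSubst a₁ a₂ a₄)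
      (2 * (a₂ - a₁) * (a₄ - a₁) * (a₄ - a₂) * Real.sin θ * Real.cos θ /
        legendreDen a₁ a₂ a₄ θ ^ 2) θ := by
  have hne := (legendreDen_pos h₁ h₂ θ).ne'
  have hs : HasDerivAt (fun θ => Real.sin θ ^ 2) (2 * Real.sin θ * Real.cos θ) θ := by
    simpa using (Real.hasDerivAt_sin θ).fun_pow 2
  have hd : HasDerivAt (legendreDen a₁ a₂ a₄) ((a₂ - a₁) * (2 * Real.sin θ * Real.cos θ)) θ :=
    (hs.const_mul (a₂ - a₁)).const_add (a₄ - a₂)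
  have hn := (hs.const_mul ((a₂ - a₁) * a₄)).add_const ((a₄ - a₂) * a₁)
  have h := hn.div hd hne
  refine h.congr_deriv ?_
  congr 1
  rw [legendreDen]
  ring

theorem inv_sqrt_eq_of_sq {x y : ℝ} (hx : 0 ≤ x) (h : x ^ 2 * y = 1) : (Real.sqrt y)⁻¹ = x := by
  have hx0 : x ≠ 0 := by rintro rfl; simp at h
  have : y = (x⁻¹) ^ 2 := by
    field_simp
    linarith
  rw [this, Real.sqrt_sq (inv_nonneg.2 hx), inv_inv]

theorem weight_eq_inv_sqrt (x : ℝ) : weight a₁ a₂ a₃ a₄ x =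
    (Real.sqrt |(x - a₁) * (x - a₂) * ((x - a₃) * (x - a₄))|)⁻¹ := by
  rw [weight, abs_mul, abs_mul, abs_mul, Real.sqrt_mul (by positivity),
    Real.sqrt_mul (by positivity), Real.sqrt_mul (by positivity), mul_inv, mul_inv, mul_inv]

theorem abs_prod_eq_of_mem_Icc (h₂ : a₂ < a₃) (h₃ : a₃ < a₄) {x : ℝ} (hx : x ∈ Icc a₁ a₂) :
    |(x - a₁) * (x - a₂) * ((x - a₃) * (x - a₄))| =
      (x - a₁) * (a₂ - x) * ((a₃ - x) * (a₄ - x)) := by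
  rw [abs_mul, abs_mul, abs_mul, abs_of_nonneg (sub_nonneg.2 hx.1),
    abs_of_nonpos (sub_nonpos.2 hx.2), abs_of_nonpos (by linarith [hx.2]),
    abs_of_nonpos (by linarith [hx.2])]
  ring

theorem legendreSubst_mem_Icc (h₁ : a₁ < a₂) (h₂ : a₂ < a₄) (θ : ℝ) :
    legendreSubst a₁ a₂ a₄ θ ∈ Icc a₁ a₂ := by
  have hD := legendreDen_pos h₁ h₂ θ
  have e1 := legendreSubst_sub h₁ h₂ θ
  have e2 := sub_legendreSubst_two h₁ h₂ θ
  have p1 : 0 < a₂ - a₁ := by linarith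
  have p2 : 0 < a₄ - a₁ := by linarith
  have p3 : 0 < a₄ - a₂ := by linarith
  constructor
  · rw [← sub_nonneg, e1]; positivity
  · rw [← sub_nonneg, e2]; positivity

/-- The four factors carry `D⁴` in the denominator, so `1 / |R|` contributes `D²`, which cancels the
`D²` of the derivative. The factors `sin θ` and `cos θ` cancel as well. -/
theorem weight_legendreSubst_mul (h₁ : a₁ < a₂) (h₂ : a₂ < a₃) (h₃ : a₃ < a₄) {θ : ℝ}
    (hθ : θ ∈ Ioo 0 (Real.pi / 2)) :
    weight a₁ a₂ a₃ a₄ (legendreSubst a₁ a₂ a₄ θ) *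
      (2 * (a₂ - a₁) * (a₄ - a₁) * (a₄ - a₂) * Real.sin θ * Real.cos θ /
        legendreDen a₁ a₂ a₄ θ ^ 2) =
      2 / Real.sqrt ((a₄ - a₂) * (a₃ - a₁)) *
        (1 / Real.sqrt (1 - ellipticParameter a₁ a₂ a₃ a₄ * Real.sin θ ^ 2)) := by
  have h₂₄ := h₂.trans h₃
  have hD := legendreDen_pos h₁ h₂₄ θ
  have hm := one_sub_mul_sin_sq_pos (ellipticParameter_nonneg h₁ h₂ h₃)
    (ellipticParameter_lt_one h₁ h₂ h₃) θ
  have hs : 0 < Real.sin θ := Real.sin_pos_of_pos_of_lt_pi hθ.1 (by linarith [hθ.2, Real.pi_pos])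
  have hc : 0 < Real.cos θ := Real.cos_pos_of_mem_Ioo ⟨by linarith [hθ.1, Real.pi_pos], hθ.2⟩
  have p1 : 0 < a₂ - a₁ := by linarith
  have p2 : 0 < a₄ - a₁ := by linarith
  have p3 : 0 < a₄ - a₂ := by linarith
  have p4 : 0 < a₃ - a₁ := by linarith
  have hg := mul_pos p3 p4
  rw [weight_eq_inv_sqrt, abs_prod_eq_of_mem_Icc h₂ h₃ (legendreSubst_mem_Icc h₁ h₂₄ θ),
    legendreSubst_sub h₁ h₂₄, sub_legendreSubst_two h₁ h₂₄, sub_legendreSubst_three h₁ h₂ h₃,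
    sub_legendreSubst_four h₁ h₂₄]
  set D := legendreDen a₁ a₂ a₄ θ
  set μ := 1 - ellipticParameter a₁ a₂ a₃ a₄ * Real.sin θ ^ 2
  set X := D ^ 2 / ((a₂ - a₁) * (a₄ - a₁) * (a₄ - a₂) * Real.sin θ * Real.cos θ *
    (Real.sqrt ((a₄ - a₂) * (a₃ - a₁)) * Real.sqrt μ)) with hX
  have hgs := Real.sqrt_pos.2 hg
  have hms := Real.sqrt_pos.2 hm
  have key : (Real.sqrt ((a₂ - a₁) * (a₄ - a₁) * Real.sin θ ^ 2 / D *
      ((a₄ - a₂) * (a₂ - a₁) * Real.cos θ ^ 2 / D) *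
      ((a₄ - a₂) * (a₃ - a₁) * μ / D * ((a₄ - a₂) * (a₄ - a₁) / D))))⁻¹ = X := by
    refine inv_sqrt_eq_of_sq (by positivity) ?_
    rw [hX, div_pow, mul_pow, mul_pow (Real.sqrt _), Real.sq_sqrt hg.le, Real.sq_sqrt hm.le]
    field_simp
  rw [key, hX]
  field_simp

/-- Reduction of the integrals over the band `[a₁, a₂]` to Legendre form. -/
theorem integral_mul_weight_eq (h₁ : a₁ < a₂) (h₂ : a₂ < a₃) (h₃ : a₃ < a₄) {G : ℝ → ℝ}
    (hG : ContinuousOn G (Icc a₁ a₂)) :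
    ∫ x in a₁..a₂, G x * weight a₁ a₂ a₃ a₄ x =
      2 / Real.sqrt ((a₄ - a₂) * (a₃ - a₁)) * ∫ θ in (0 : ℝ)..(Real.pi / 2),
        G (legendreSubst a₁ a₂ a₄ θ) *
          (1 / Real.sqrt (1 - ellipticParameter a₁ a₂ a₃ a₄ * Real.sin θ ^ 2)) := by
  have h₂₄ := h₂.trans h₃
  have hpi : (0 : ℝ) < Real.pi / 2 := by positivity
  set φ := legendreSubst a₁ a₂ a₄ with hφ
  set φ' : ℝ → ℝ := fun θ => 2 * (a₂ - a₁) * (a₄ - a₁) * (a₄ - a₂) * Real.sin θ * Real.cos θ /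
        legendreDen a₁ a₂ a₄ θ ^ 2 with hφ'
  have hder : ∀ θ, HasDerivAt φ (φ' θ) θ := hasDerivAt_legendreSubst h₁ h₂₄
  have hφc : Continuous φ := continuous_iff_continuousAt.2 fun θ => (hder θ).continuousAt
  have hmem : ∀ θ, φ θ ∈ Icc a₁ a₂ := legendreSubst_mem_Icc h₁ h₂₄
  have hφ0 : φ 0 = a₁ := by
    have := legendreSubst_sub h₁ h₂₄ 0
    rw [Real.sin_zero] at this
    norm_num at this
    linarith
  have hφ1 : φ (Real.pi / 2) = a₂ := by
    have := sub_legendreSubst_two h₁ h₂₄ (Real.pi / 2)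
    rw [Real.cos_pi_div_two] at this
    norm_num at this
    linarith
  have hopen : ∀ θ ∈ Ioo 0 (Real.pi / 2), φ θ ∈ Ioo a₁ a₂ := by
    intro θ hθ
    have hD := legendreDen_pos h₁ h₂₄ θ
    have hs : 0 < Real.sin θ := Real.sin_pos_of_pos_of_lt_pi hθ.1 (by linarith [hθ.2, Real.pi_pos])
    have hc : 0 < Real.cos θ := Real.cos_pos_of_mem_Ioo ⟨by linarith [hθ.1, Real.pi_pos], hθ.2⟩
    have p1 : 0 < a₂ - a₁ := by linarith
    have p2 : 0 < a₄ - a₁ := by linarith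
    have p3 : 0 < a₄ - a₂ := by linarith
    constructor
    · rw [← sub_pos, hφ, legendreSubst_sub h₁ h₂₄]; positivity
    · rw [← sub_pos, hφ, sub_legendreSubst_two h₁ h₂₄]; positivity
  have hwG : IntegrableOn (fun x => G x * weight a₁ a₂ a₃ a₄ x) (Icc a₁ a₂) := by
    refine IntegrableOn.continuousOn_mul hG ?_ isCompact_Icc
    exact (integrableOn_Icc_iff_integrableOn_Ioc (by simp)).2
      ((intervalIntegrable_iff_integrableOn_Ioc_of_le h₁.le).1
        (intervalIntegrable_weight h₁ h₂ h₃ a₁ a₂))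
  set T : ℝ → ℝ := fun θ => 2 / Real.sqrt ((a₄ - a₂) * (a₃ - a₁)) * (G (φ θ) *
    (1 / Real.sqrt (1 - ellipticParameter a₁ a₂ a₃ a₄ * Real.sin θ ^ 2))) with hT
  have hTc : Continuous T := by
    have hGφ : Continuous fun θ => G (φ θ) := hG.comp_continuous hφc hmem
    refine continuous_const.mul (hGφ.mul (continuous_const.div (by fun_prop) fun θ => ?_))
    exact (Real.sqrt_pos.2 (one_sub_mul_sin_sq_pos (ellipticParameter_nonneg h₁ h₂ h₃)
      (ellipticParameter_lt_one h₁ h₂ h₃) θ)).ne'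
  have heq : ∀ θ ∈ Ioo 0 (Real.pi / 2),
      ((fun x => G x * weight a₁ a₂ a₃ a₄ x) ∘ φ) θ * φ' θ = T θ := by
    intro θ hθ
    have := weight_legendreSubst_mul h₁ h₂ h₃ hθ
    simp only [Function.comp_apply, hT]
    rw [mul_assoc, this]
    ring
  -- The end `θ = π / 2` is excluded: there the weight is evaluated at `a₂`, where it has the
  -- default value `0`.
  have hae : ∀ᵐ θ ∂(volume : Measure ℝ), θ ∈ uIoc 0 (Real.pi / 2) →
      ((fun x => G x * weight a₁ a₂ a₃ a₄ x) ∘ φ) θ * φ' θ = T θ := by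
    have hne : ∀ᵐ θ ∂(volume : Measure ℝ), θ ≠ Real.pi / 2 := by simp [ae_iff]
    filter_upwards [hne] with θ hθ hmem'
    rw [uIoc_of_le hpi.le] at hmem'
    exact heq θ ⟨hmem'.1, lt_of_le_of_ne hmem'.2 hθ⟩
  have h := intervalIntegral.integral_comp_mul_deriv''' (a := 0) (b := Real.pi / 2) (f := φ)
    (f' := φ') (g := fun x => G x * weight a₁ a₂ a₃ a₄ x) hφc.continuousOn
    (fun θ _ => (hder θ).hasDerivWithinAt) (by
      rw [min_eq_left hpi.le, max_eq_right hpi.le]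
      have himg : φ '' Ioo 0 (Real.pi / 2) ⊆ Ioo a₁ a₂ := by
        rintro _ ⟨θ, hθ, rfl⟩
        exact hopen θ hθ
      refine ContinuousOn.mul (hG.mono (himg.trans Ioo_subset_Icc_self)) ?_
      refine ContinuousOn.mono ?_ himg
      have hs : ∀ a : ℝ, a ∉ Ioo a₁ a₂ →
          ContinuousOn (fun x => (Real.sqrt |x - a|)⁻¹) (Ioo a₁ a₂) := by
        intro a ha
        refine ContinuousOn.inv₀ (by fun_prop) fun x hx => ?_
        refine (Real.sqrt_pos.2 (abs_pos.2 (sub_ne_zero.2 ?_))).ne'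
        rintro rfl
        exact ha hx
      exact ((hs a₁ (by simp)).mul (hs a₂ (by simp))).mul
        ((hs a₃ fun h => by linarith [h.2]).mul (hs a₄ fun h => by linarith [h.2])))
    (hwG.mono_set (by rintro _ ⟨θ, -, rfl⟩; exact hmem θ)) (by
      rw [uIcc_of_le hpi.le, integrableOn_Icc_iff_integrableOn_Ioc enorm_ne_top]
      refine IntegrableOn.congr_fun_ae (hTc.integrableOn_Ioc) ?_
      rw [Filter.EventuallyEq, ae_restrict_iff' measurableSet_Ioc]
      filter_upwards [hae] with θ hθ hm
      rw [uIoc_of_le hpi.le] at hθ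
      exact (hθ hm).symm)
  rw [hφ0, hφ1] at h
  rw [← h, ← intervalIntegral.integral_const_mul]
  exact intervalIntegral.integral_congr_ae hae

theorem integral_weight (h₁ : a₁ < a₂) (h₂ : a₂ < a₃) (h₃ : a₃ < a₄) :
    ∫ x in a₁..a₂, weight a₁ a₂ a₃ a₄ x = 2 / Real.sqrt ((a₄ - a₂) * (a₃ - a₁)) *
      ellipticK (ellipticParameter a₁ a₂ a₃ a₄) := by
  have h := integral_mul_weight_eq h₁ h₂ h₃ (G := fun _ => 1) continuousOn_const
  rw [ellipticK]
  simpa only [one_mul] using h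

/-- Under the substitution this ratio becomes a constant times `1 - m sin² θ`, which turns the
integrand of `K` into that of `E`. -/
theorem integral_div_mul_weight (h₁ : a₁ < a₂) (h₂ : a₂ < a₃) (h₃ : a₃ < a₄) :
    ∫ x in a₁..a₂, (a₃ - x) / (a₄ - x) * weight a₁ a₂ a₃ a₄ x =
      2 / Real.sqrt ((a₄ - a₂) * (a₃ - a₁)) *
        ((a₃ - a₁) / (a₄ - a₁) * ellipticE (ellipticParameter a₁ a₂ a₃ a₄)) := by
  rw [integral_mul_weight_eq h₁ h₂ h₃ (G := fun x => (a₃ - x) / (a₄ - x))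
    (ContinuousOn.div (by fun_prop) (by fun_prop) fun x hx => by linarith [hx.2]), ellipticE,
    ← intervalIntegral.integral_const_mul ((a₃ - a₁) / (a₄ - a₁))]
  congr 2
  funext θ
  have hD := legendreDen_pos h₁ (h₂.trans h₃) θ
  have hm := one_sub_mul_sin_sq_pos (ellipticParameter_nonneg h₁ h₂ h₃)
    (ellipticParameter_lt_one h₁ h₂ h₃) θ
  rw [sub_legendreSubst_three h₁ h₂ h₃, sub_legendreSubst_four h₁ (h₂.trans h₃)]
  have p2 : 0 < a₄ - a₁ := by linarith
  have p3 : 0 < a₄ - a₂ := by linarith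
  have hms := Real.sqrt_pos.2 hm
  field_simp
  rw [Real.sq_sqrt hm.le]

end Elliptic

/-! ### The band integrals of the two densities -/

section Bands

variable {a₁ a₂ a₃ a₄ : ℝ}

/-- The numerator of the density of states. -/
noncomputable def dosPoly (a₁ a₂ a₃ a₄ x : ℝ) : ℝ :=
  x ^ 2 - (1 / 2) * l₁ a₁ a₂ a₃ a₄ * x + constA a₁ a₂ a₃ a₄

/-- The numerator of the density of fluxes. -/
noncomputable def dofPoly (a₁ a₂ a₃ a₄ x : ℝ) : ℝ :=
  4 * x ^ 3 - 2 * l₁ a₁ a₂ a₃ a₄ * x ^ 2 + (2 * l₂ a₁ a₂ a₃ a₄ - l₁ a₁ a₂ a₃ a₄ ^ 2 / 2) * x +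
    constB a₁ a₂ a₃ a₄

/-- The derivative of `∏ (x - aⱼ)`. -/
noncomputable def quarticDeriv (a₁ a₂ a₃ a₄ x : ℝ) : ℝ :=
  4 * x ^ 3 - 3 * l₁ a₁ a₂ a₃ a₄ * x ^ 2 + 2 * l₂ a₁ a₂ a₃ a₄ * x -
    (a₁ * a₂ * a₃ + a₁ * a₂ * a₄ + a₁ * a₃ * a₄ + a₂ * a₃ * a₄)

theorem hasDerivAt_quartic (x : ℝ) :
    HasDerivAt (fun x => (x - a₁) * (a₂ - x) * ((a₃ - x) * (a₄ - x)))
      (-quarticDeriv a₁ a₂ a₃ a₄ x) x := by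
  have h1 : HasDerivAt (fun x => x - a₁) 1 x := (hasDerivAt_id' x).sub_const a₁
  have h2 : ∀ a : ℝ, HasDerivAt (fun x => a - x) (-1) x := fun a => (hasDerivAt_id' x).const_sub a
  refine ((h1.fun_mul (h2 a₂)).fun_mul ((h2 a₃).fun_mul (h2 a₄))).congr_deriv ?_
  rw [quarticDeriv, l₁, l₂]
  ring

theorem intervalIntegrable_mul_weight (h₁ : a₁ < a₂) (h₂ : a₂ < a₃) (h₃ : a₃ < a₄) {G : ℝ → ℝ}
    {c d : ℝ} (hcd : c ≤ d) (hG : ContinuousOn G (Icc c d)) :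
    IntervalIntegrable (fun x => G x * weight a₁ a₂ a₃ a₄ x) volume c d :=
  (intervalIntegrable_weight h₁ h₂ h₃ c d).continuousOn_mul (by rwa [uIcc_of_le hcd])

/-- With `V = (x - a₁)(a₂ - x)(a₃ - x)(a₄ - x)`, the integrand is the derivative of `√V g`, which
vanishes at both ends of the band. -/
theorem integral_exact_mul_weight (h₁ : a₁ < a₂) (h₂ : a₂ < a₃) (h₃ : a₃ < a₄) {g g' G : ℝ → ℝ}
    (hg : ∀ x ∈ Icc a₁ a₂, HasDerivAt g (g' x) x) (hG : ContinuousOn G (Icc a₁ a₂))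
    (hGe : ∀ x ∈ Ioo a₁ a₂, G x = -quarticDeriv a₁ a₂ a₃ a₄ x * g x / 2 +
      (x - a₁) * (a₂ - x) * ((a₃ - x) * (a₄ - x)) * g' x) :
    ∫ x in a₁..a₂, G x * weight a₁ a₂ a₃ a₄ x = 0 := by
  have h := intervalIntegral.integral_eq_sub_of_hasDerivAt_of_le h₁.le
    (f := fun x => Real.sqrt ((x - a₁) * (a₂ - x) * ((a₃ - x) * (a₄ - x))) * g x)
    (f' := fun x => G x * weight a₁ a₂ a₃ a₄ x)
    (ContinuousOn.mul (by fun_prop) fun x hx => (hg x hx).continuousAt.continuousWithinAt) (by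
      intro x hx
      have hxc := Ioo_subset_Icc_self hx
      have hpos : 0 < (x - a₁) * (a₂ - x) * ((a₃ - x) * (a₄ - x)) :=
        mul_pos (mul_pos (by linarith [hx.1]) (by linarith [hx.2]))
          (mul_pos (by linarith [hx.2]) (by linarith [hx.2]))
      have h1 := ((hasDerivAt_quartic (a₁ := a₁) (a₂ := a₂) (a₃ := a₃) (a₄ := a₄) x).sqrt
        hpos.ne').fun_mul (hg x hxc)
      refine h1.congr_deriv ?_
      have hs := Real.sqrt_pos.2 hpos
      rw [hGe x hx, weight_eq_inv_sqrt, abs_prod_eq_of_mem_Icc h₂ h₃ hxc]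
      set V := (x - a₁) * (a₂ - x) * ((a₃ - x) * (a₄ - x))
      field_simp
      rw [Real.sq_sqrt hpos.le]
      ring)
    (intervalIntegrable_mul_weight h₁ h₂ h₃ h₁.le hG)
  rw [h]
  simp

/-- Taking `g = 1 / (a₄ - x)` in the exact form trades the quadratic, without the elliptic part of
`A`, for a multiple of `(a₃ - x) / (a₄ - x)`, whose integral is `E`. The elliptic part of `A` is the
multiple of `E / K` that restores balance. -/
theorem integral_dosPoly_left (h₁ : a₁ < a₂) (h₂ : a₂ < a₃) (h₃ : a₃ < a₄) :
    ∫ x in a₁..a₂, dosPoly a₁ a₂ a₃ a₄ x * weight a₁ a₂ a₃ a₄ x = 0 := by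
  have h4 : ∀ x ∈ Icc a₁ a₂, a₄ - x ≠ 0 := fun x hx => by linarith [hx.2]
  have hGc : ContinuousOn (fun x => x ^ 2 - (1 / 2) * l₁ a₁ a₂ a₃ a₄ * x +
      (1 / 2) * (a₃ * a₄ + a₂ * a₁)) (Icc a₁ a₂) := by fun_prop
  have hHc : ContinuousOn (fun x => (a₃ - x) / (a₄ - x)) (Icc a₁ a₂) :=
    ContinuousOn.div (by fun_prop) (by fun_prop) h4
  have hex := integral_exact_mul_weight h₁ h₂ h₃ (g := fun x => 1 / (a₄ - x))
    (g' := fun x => 1 / (a₄ - x) ^ 2)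
    (G := fun x => (x ^ 2 - (1 / 2) * l₁ a₁ a₂ a₃ a₄ * x + (1 / 2) * (a₃ * a₄ + a₂ * a₁)) -
      (1 / 2) * (a₄ - a₁) * (a₄ - a₂) * ((a₃ - x) / (a₄ - x)))
    (by
      intro x hx
      have h1 := ((hasDerivAt_id' x).const_sub a₄).inv (h4 x hx)
      simp_rw [one_div]
      refine h1.congr_deriv ?_
      simp [one_div])
    (hGc.sub (continuousOn_const.mul hHc)) (by
      intro x hx
      have := h4 x (Ioo_subset_Icc_self hx)
      rw [quarticDeriv, l₁, l₂]
      field_simp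
      ring)
  have i1 := intervalIntegrable_mul_weight h₁ h₂ h₃ h₁.le hGc
  have i2 := intervalIntegrable_mul_weight h₁ h₂ h₃ h₁.le hHc
  have i0 := intervalIntegrable_weight h₁ h₂ h₃ a₁ a₂
  have e1 : ∀ x, ((x ^ 2 - (1 / 2) * l₁ a₁ a₂ a₃ a₄ * x + (1 / 2) * (a₃ * a₄ + a₂ * a₁)) -
      (1 / 2) * (a₄ - a₁) * (a₄ - a₂) * ((a₃ - x) / (a₄ - x))) * weight a₁ a₂ a₃ a₄ x =
      (x ^ 2 - (1 / 2) * l₁ a₁ a₂ a₃ a₄ * x + (1 / 2) * (a₃ * a₄ + a₂ * a₁)) *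
        weight a₁ a₂ a₃ a₄ x - (1 / 2) * (a₄ - a₁) * (a₄ - a₂) *
        ((a₃ - x) / (a₄ - x) * weight a₁ a₂ a₃ a₄ x) := fun x => by ring
  simp_rw [e1] at hex
  rw [intervalIntegral.integral_sub i1 (i2.const_mul _), intervalIntegral.integral_const_mul,
    integral_div_mul_weight h₁ h₂ h₃] at hex
  have e2 : ∀ x, dosPoly a₁ a₂ a₃ a₄ x * weight a₁ a₂ a₃ a₄ x =
      (x ^ 2 - (1 / 2) * l₁ a₁ a₂ a₃ a₄ * x + (1 / 2) * (a₃ * a₄ + a₂ * a₁)) *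
        weight a₁ a₂ a₃ a₄ x -
      (ellipticRatio a₁ a₂ a₃ a₄ / 2) * (a₃ - a₁) * (a₄ - a₂) * weight a₁ a₂ a₃ a₄ x := by
    intro x
    rw [dosPoly, constA]
    ring
  simp_rw [e2]
  rw [intervalIntegral.integral_sub i1 (i0.const_mul _), intervalIntegral.integral_const_mul,
    integral_weight h₁ h₂ h₃, ellipticRatio]
  have hK := (ellipticK_pos (ellipticParameter_nonneg h₁ h₂ h₃)
    (ellipticParameter_lt_one h₁ h₂ h₃)).ne'
  have p2 : a₄ - a₁ ≠ 0 := by linarith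
  rw [sub_eq_zero] at hex
  rw [hex]
  field_simp
  ring

theorem weight_neg (x : ℝ) :
    weight a₁ a₂ a₃ a₄ (-x) = weight (-a₄) (-a₃) (-a₂) (-a₁) x := by
  have h : ∀ a : ℝ, |-x - a| = |x - -a| := fun a => by
    rw [← abs_neg]; congr 1; ring
  rw [weight, weight, h, h, h, h]
  ring

/-- The reflection `x ↦ -x` reverses the order of the branch points, interchanges the bands and
preserves `m`, so the left band identity also yields the right one. -/
theorem dosPoly_neg (x : ℝ) :
    dosPoly a₁ a₂ a₃ a₄ (-x) = dosPoly (-a₄) (-a₃) (-a₂) (-a₁) x := by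
  have hm : ellipticParameter (-a₄) (-a₃) (-a₂) (-a₁) = ellipticParameter a₁ a₂ a₃ a₄ := by
    unfold ellipticParameter
    congr 1 <;> ring
  have hr : ellipticRatio (-a₄) (-a₃) (-a₂) (-a₁) = ellipticRatio a₁ a₂ a₃ a₄ := by
    unfold ellipticRatio
    rw [hm]
  rw [dosPoly, dosPoly, constA, constA, hr, l₁, l₁]
  ring

theorem integral_dosPoly_right (h₁ : a₁ < a₂) (h₂ : a₂ < a₃) (h₃ : a₃ < a₄) :
    ∫ x in a₃..a₄, dosPoly a₁ a₂ a₃ a₄ x * weight a₁ a₂ a₃ a₄ x = 0 := by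
  have h := integral_dosPoly_left (neg_lt_neg h₃) (neg_lt_neg h₂) (neg_lt_neg h₁)
  simp_rw [← dosPoly_neg, ← weight_neg] at h
  rw [intervalIntegral.integral_comp_neg
    (fun x => dosPoly a₁ a₂ a₃ a₄ x * weight a₁ a₂ a₃ a₄ x)] at h
  simpa only [neg_neg] using h

theorem integral_quarticDeriv_left (h₁ : a₁ < a₂) (h₂ : a₂ < a₃) (h₃ : a₃ < a₄) :
    ∫ x in a₁..a₂, quarticDeriv a₁ a₂ a₃ a₄ x * weight a₁ a₂ a₃ a₄ x = 0 :=
  integral_exact_mul_weight h₁ h₂ h₃ (g := fun _ => -2) (g' := fun _ => 0)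
    (fun x _ => hasDerivAt_const x _) (by unfold quarticDeriv; fun_prop) fun x _ => by ring

theorem quarticDeriv_neg (x : ℝ) :
    quarticDeriv a₁ a₂ a₃ a₄ (-x) = -quarticDeriv (-a₄) (-a₃) (-a₂) (-a₁) x := by
  rw [quarticDeriv, quarticDeriv, l₁, l₁, l₂, l₂]
  ring

theorem integral_quarticDeriv_right (h₁ : a₁ < a₂) (h₂ : a₂ < a₃) (h₃ : a₃ < a₄) :
    ∫ x in a₃..a₄, quarticDeriv a₁ a₂ a₃ a₄ x * weight a₁ a₂ a₃ a₄ x = 0 := by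
  have h := integral_quarticDeriv_left (neg_lt_neg h₃) (neg_lt_neg h₂) (neg_lt_neg h₁)
  have h' : ∫ x in -a₄..-a₃, quarticDeriv a₁ a₂ a₃ a₄ (-x) * weight a₁ a₂ a₃ a₄ (-x) = 0 := by
    simp_rw [quarticDeriv_neg, weight_neg, neg_mul]
    rw [intervalIntegral.integral_neg, h, neg_zero]
  rw [intervalIntegral.integral_comp_neg
    (fun x => quarticDeriv a₁ a₂ a₃ a₄ x * weight a₁ a₂ a₃ a₄ x)] at h'
  simpa only [neg_neg] using h'

/-- This identity explains the constant: `B` is `l₁ A` minus the third elementary symmetric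
polynomial. The first summand integrates exactly and the second is the density of states. -/
theorem dofPoly_eq (x : ℝ) : dofPoly a₁ a₂ a₃ a₄ x =
    quarticDeriv a₁ a₂ a₃ a₄ x + l₁ a₁ a₂ a₃ a₄ * dosPoly a₁ a₂ a₃ a₄ x := by
  rw [dofPoly, quarticDeriv, dosPoly, constA, constB, l₁, l₂]
  ring

theorem integral_dofPoly (h₁ : a₁ < a₂) (h₂ : a₂ < a₃) (h₃ : a₃ < a₄) :
    (∫ x in a₁..a₂, dofPoly a₁ a₂ a₃ a₄ x * weight a₁ a₂ a₃ a₄ x = 0) ∧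
      ∫ x in a₃..a₄, dofPoly a₁ a₂ a₃ a₄ x * weight a₁ a₂ a₃ a₄ x = 0 := by
  have e : ∀ x, dofPoly a₁ a₂ a₃ a₄ x * weight a₁ a₂ a₃ a₄ x =
      quarticDeriv a₁ a₂ a₃ a₄ x * weight a₁ a₂ a₃ a₄ x +
        l₁ a₁ a₂ a₃ a₄ * (dosPoly a₁ a₂ a₃ a₄ x * weight a₁ a₂ a₃ a₄ x) := fun x => by
    rw [dofPoly_eq]
    ring
  have i1 : ∀ c d : ℝ, c ≤ d → IntervalIntegrable
      (fun x => quarticDeriv a₁ a₂ a₃ a₄ x * weight a₁ a₂ a₃ a₄ x) volume c d := fun c d hcd =>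
    intervalIntegrable_mul_weight h₁ h₂ h₃ hcd (by unfold quarticDeriv; fun_prop)
  have i2 : ∀ c d : ℝ, c ≤ d → IntervalIntegrable
      (fun x => dosPoly a₁ a₂ a₃ a₄ x * weight a₁ a₂ a₃ a₄ x) volume c d := fun c d hcd =>
    intervalIntegrable_mul_weight h₁ h₂ h₃ hcd (by unfold dosPoly; fun_prop)
  simp_rw [e]
  constructor
  · rw [intervalIntegral.integral_add (i1 _ _ h₁.le) ((i2 _ _ h₁.le).const_mul _),
      intervalIntegral.integral_const_mul, integral_quarticDeriv_left h₁ h₂ h₃,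
      integral_dosPoly_left h₁ h₂ h₃, mul_zero, add_zero]
  · rw [intervalIntegral.integral_add (i1 _ _ h₃.le) ((i2 _ _ h₃.le).const_mul _),
      intervalIntegral.integral_const_mul, integral_quarticDeriv_right h₁ h₂ h₃,
      integral_dosPoly_right h₁ h₂ h₃, mul_zero, add_zero]

theorem psqrt_sub_of_le {x a : ℝ} (h : a ≤ x) :
    psqrt ((x : ℂ) - a) = (Real.sqrt |x - a| : ℂ) := by
  rw [← Complex.ofReal_sub, psqrt_ofReal (sub_nonneg.2 h), abs_of_nonneg (sub_nonneg.2 h)]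

theorem psqrt_sub_of_ge {x a : ℝ} (h : x ≤ a) :
    psqrt ((x : ℂ) - a) = Complex.I * (Real.sqrt |x - a| : ℂ) := by
  rcases h.eq_or_lt with rfl | h
  · simp [psqrt]
  · rw [← Complex.ofReal_sub, psqrt_ofReal_of_neg (sub_neg.2 h), abs_of_neg (sub_neg.2 h)]

/-- Three factors are roots of negative numbers, each contributing `i`, so `R = -i |R|` here. On the
right band only one factor is, which gives the opposite sign. -/
theorem inv_surfaceRoot_left (h₁ : a₁ < a₂) (h₂ : a₂ < a₃) (h₃ : a₃ < a₄) {x : ℝ}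
    (hx : x ∈ Icc a₁ a₂) :
    (surfaceRoot a₁ a₂ a₃ a₄ x)⁻¹ = Complex.I * (weight a₁ a₂ a₃ a₄ x : ℂ) := by
  have hx2 := hx.2
  rw [surfaceRoot_eq h₁ h₃, psqrt_sub_of_le hx.1, psqrt_sub_of_ge hx2,
    psqrt_sub_of_ge (show x ≤ a₃ by linarith), psqrt_sub_of_ge (show x ≤ a₄ by linarith), weight]
  push_cast
  simp only [mul_inv, Complex.inv_I]
  linear_combination (-Complex.I * (Real.sqrt |x - a₁| : ℂ)⁻¹ * (Real.sqrt |x - a₂| : ℂ)⁻¹ *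
    (Real.sqrt |x - a₃| : ℂ)⁻¹ * (Real.sqrt |x - a₄| : ℂ)⁻¹) * Complex.I_sq

theorem inv_surfaceRoot_right (h₁ : a₁ < a₂) (h₂ : a₂ < a₃) (h₃ : a₃ < a₄) {x : ℝ}
    (hx : x ∈ Icc a₃ a₄) :
    (surfaceRoot a₁ a₂ a₃ a₄ x)⁻¹ = -Complex.I * (weight a₁ a₂ a₃ a₄ x : ℂ) := by
  have hx1 := hx.1
  rw [surfaceRoot_eq h₁ h₃, psqrt_sub_of_le hx1, psqrt_sub_of_ge hx.2,
    psqrt_sub_of_le (show a₂ ≤ x by linarith), psqrt_sub_of_le (show a₁ ≤ x by linarith), weight]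
  push_cast
  simp only [mul_inv, Complex.inv_I]
  ring

theorem integral_div_surfaceRoot_left (h₁ : a₁ < a₂) (h₂ : a₂ < a₃) (h₃ : a₃ < a₄) {P : ℂ → ℂ}
    {p : ℝ → ℝ} (hP : ∀ x : ℝ, P x = p x) :
    ∫ x in a₁..a₂, 1 / (Real.pi : ℂ) * (P x / surfaceRoot a₁ a₂ a₃ a₄ x) =
      Complex.I / Real.pi * ((∫ x in a₁..a₂, p x * weight a₁ a₂ a₃ a₄ x : ℝ) : ℂ) := by
  rw [← intervalIntegral.integral_ofReal, ← intervalIntegral.integral_const_mul]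
  refine intervalIntegral.integral_congr fun x hx => ?_
  rw [uIcc_of_le h₁.le] at hx
  simp only [hP, div_eq_mul_inv (p x : ℂ), inv_surfaceRoot_left h₁ h₂ h₃ hx, Complex.ofReal_mul]
  ring

theorem integral_div_surfaceRoot_right (h₁ : a₁ < a₂) (h₂ : a₂ < a₃) (h₃ : a₃ < a₄) {P : ℂ → ℂ}
    {p : ℝ → ℝ} (hP : ∀ x : ℝ, P x = p x) :
    ∫ x in a₃..a₄, 1 / (Real.pi : ℂ) * (P x / surfaceRoot a₁ a₂ a₃ a₄ x) =
      -Complex.I / Real.pi * ((∫ x in a₃..a₄, p x * weight a₁ a₂ a₃ a₄ x : ℝ) : ℂ) := by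
  rw [← intervalIntegral.integral_ofReal, ← intervalIntegral.integral_const_mul]
  refine intervalIntegral.integral_congr fun x hx => ?_
  rw [uIcc_of_le h₃.le] at hx
  simp only [hP, div_eq_mul_inv (p x : ℂ), inv_surfaceRoot_right h₁ h₂ h₃ hx, Complex.ofReal_mul]
  ring

end Bands

/-! ### Expansions at infinity -/

section Infinity

variable {a₁ a₂ a₃ a₄ : ℝ}

/-- Rationalize: `p S / R - q = (p² S² - q² R²) / (R (p S + q R))`. The numerator is free of
radicals and the denominator grows like `2 k z^(n + 4)`, so only polynomial cancellation has to be
checked. -/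
theorem tendsto_mul_cutRoot_div_sub {p q : ℂ → ℂ} {n : ℕ} {k : ℂ} (hk : k ≠ 0)
    (hp : Tendsto (fun z => p z / z ^ (n + 1)) (Bornology.cobounded ℂ) (𝓝 k))
    (hq : Tendsto (fun z => q z / z ^ n) (Bornology.cobounded ℂ) (𝓝 k))
    (hN : Tendsto (fun z => (p z ^ 2 * (z ^ 2 - 1) -
      q z ^ 2 * ((z - a₁) * (z - a₂) * (z - a₃) * (z - a₄))) / z ^ (n + 4))
      (Bornology.cobounded ℂ) (𝓝 0)) :
    Tendsto (fun z => p z * cutRoot (-1) 1 z / surfaceRoot a₁ a₂ a₃ a₄ z - q z)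
      (Bornology.cobounded ℂ) (𝓝 0) := by
  have hR := tendsto_surfaceRoot_div a₁ a₂ a₃ a₄
  have hS := tendsto_cutRoot_div (-1) 1
  have hsum := (hp.mul hS).add (hq.mul hR)
  have hden := hR.mul hsum
  have hk2 : (1 : ℂ) * (k * 1 + k * 1) ≠ 0 := by
    rw [show (1 : ℂ) * (k * 1 + k * 1) = 2 * k by ring]
    exact mul_ne_zero two_ne_zero hk
  have h := hN.div hden hk2
  rw [zero_div] at h
  refine h.congr' ?_
  filter_upwards [hden.eventually_ne hk2, Bornology.eventually_ne_cobounded (0 : ℂ)] with z hz hz0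
  have hS2 := cutRoot_unit_sq z
  have hR2 := surfaceRoot_sq a₁ a₂ a₃ a₄ z
  simp only [Pi.div_apply]
  rw [← hS2, ← hR2]
  have hRne : surfaceRoot a₁ a₂ a₃ a₄ z ≠ 0 := by
    intro h0
    simp [h0] at hz
  have hne : p z * cutRoot (-1) 1 z + q z * surfaceRoot a₁ a₂ a₃ a₄ z ≠ 0 := by
    intro h0
    apply hz
    have : p z / z ^ (n + 1) * (cutRoot (-1) 1 z / z) +
        q z / z ^ n * (surfaceRoot a₁ a₂ a₃ a₄ z / z ^ 2) =
        (p z * cutRoot (-1) 1 z + q z * surfaceRoot a₁ a₂ a₃ a₄ z) / z ^ (n + 2) := by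
      field_simp
      ring
    rw [this, h0]
    simp
  have hfac : surfaceRoot a₁ a₂ a₃ a₄ z / z ^ 2 * (p z / z ^ (n + 1) * (cutRoot (-1) 1 z / z) +
        q z / z ^ n * (surfaceRoot a₁ a₂ a₃ a₄ z / z ^ 2)) = surfaceRoot a₁ a₂ a₃ a₄ z *
        (p z * cutRoot (-1) 1 z + q z * surfaceRoot a₁ a₂ a₃ a₄ z) / z ^ (n + 4) := by
    field_simp
    ring
  rw [hfac, div_div_div_cancel_right₀ (pow_ne_zero _ hz0), div_eq_iff (mul_ne_zero hRne hne),
    sub_mul]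
  generalize surfaceRoot a₁ a₂ a₃ a₄ z = R at *
  field_simp
  ring

theorem tendsto_comp_inv_cobounded {f : ℂ → ℂ} (hf : Continuous f) :
    Tendsto (fun z => f z⁻¹) (Bornology.cobounded ℂ) (𝓝 (f 0)) :=
  (hf.tendsto 0).comp tendsto_inv₀_cobounded

theorem tendsto_of_eq_comp_inv {g f : ℂ → ℂ} {k : ℂ} (hf : Continuous f) (hk : f 0 = k)
    (h : ∀ z, z ≠ 0 → g z = f z⁻¹) : Tendsto g (Bornology.cobounded ℂ) (𝓝 k) := by
  rw [← hk]
  refine (tendsto_comp_inv_cobounded hf).congr' ?_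
  filter_upwards [Bornology.eventually_ne_cobounded (0 : ℂ)] with z hz
  exact (h z hz).symm

theorem tendsto_dos_infinity (A : ℂ) :
    Tendsto (fun z => (z ^ 2 - (1 / 2) * (l₁ a₁ a₂ a₃ a₄ : ℂ) * z + A) * cutRoot (-1) 1 z /
      surfaceRoot a₁ a₂ a₃ a₄ z - z) (Bornology.cobounded ℂ) (𝓝 0) := by
  set L : ℂ := (l₁ a₁ a₂ a₃ a₄ : ℂ) with hL
  set M : ℂ := (l₂ a₁ a₂ a₃ a₄ : ℂ) with hM
  set e₃ : ℂ := a₁ * a₂ * a₃ + a₁ * a₂ * a₄ + a₁ * a₃ * a₄ + a₂ * a₃ * a₄ with he₃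
  set e₄ : ℂ := a₁ * a₂ * a₃ * a₄ with he₄
  have hprod : ∀ z : ℂ, (z - a₁) * (z - a₂) * (z - a₃) * (z - a₄) =
      z ^ 4 - L * z ^ 3 + M * z ^ 2 - e₃ * z + e₄ := fun z => by
    rw [hL, hM, he₃, he₄, l₁, l₂]
    push_cast
    ring
  refine tendsto_mul_cutRoot_div_sub (n := 1) one_ne_zero ?_ ?_ ?_
  · refine tendsto_of_eq_comp_inv (f := fun w => 1 - (1 / 2) * L * w + A * w ^ 2) (by fun_prop)
      (by simp) fun z hz => ?_
    field_simp
    ring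
  · refine tendsto_of_eq_comp_inv (f := fun w => 1) (by fun_prop) (by simp) fun z hz => ?_
    field_simp
  · simp_rw [hprod]
    -- The outer factor `w = 1 / z` records that the degrees 6 and 5 cancel, which forces the
    -- coefficient `-l₁ / 2` and leaves `A` free.
    refine tendsto_of_eq_comp_inv (f := fun w => w * (-1 + 2 * A - M + (1 / 4) * L ^ 2 +
      w * (e₃ + L - L * A) + w ^ 2 * (-2 * A + A ^ 2 - e₄ - (1 / 4) * L ^ 2) + w ^ 3 * (L * A) -
      w ^ 4 * A ^ 2)) (by fun_prop) (by simp) fun z hz => ?_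
    field_simp
    ring

theorem tendsto_dof_infinity (B : ℂ) :
    Tendsto (fun z => (4 * z ^ 3 - 2 * (l₁ a₁ a₂ a₃ a₄ : ℂ) * z ^ 2 +
        (2 * (l₂ a₁ a₂ a₃ a₄ : ℂ) - (l₁ a₁ a₂ a₃ a₄ : ℂ) ^ 2 / 2) * z + B) * cutRoot (-1) 1 z /
      surfaceRoot a₁ a₂ a₃ a₄ z - (4 * z ^ 2 - 2)) (Bornology.cobounded ℂ) (𝓝 0) := by
  set L : ℂ := (l₁ a₁ a₂ a₃ a₄ : ℂ) with hL
  set M : ℂ := (l₂ a₁ a₂ a₃ a₄ : ℂ) with hM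
  set e₃ : ℂ := a₁ * a₂ * a₃ + a₁ * a₂ * a₄ + a₁ * a₃ * a₄ + a₂ * a₃ * a₄ with he₃
  set e₄ : ℂ := a₁ * a₂ * a₃ * a₄ with he₄
  have hprod : ∀ z : ℂ, (z - a₁) * (z - a₂) * (z - a₃) * (z - a₄) =
      z ^ 4 - L * z ^ 3 + M * z ^ 2 - e₃ * z + e₄ := fun z => by
    rw [hL, hM, he₃, he₄, l₁, l₂]
    push_cast
    ring
  refine tendsto_mul_cutRoot_div_sub (n := 2) (k := 4) (by norm_num) ?_ ?_ ?_
  · refine tendsto_of_eq_comp_inv (f := fun w => 4 - 2 * L * w + (2 * M - L ^ 2 / 2) * w ^ 2 +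
      B * w ^ 3) (by fun_prop) (by simp) fun z hz => ?_
    field_simp
    ring
  · refine tendsto_of_eq_comp_inv (f := fun w => 4 - 2 * w ^ 2) (by fun_prop) (by simp)
      fun z hz => ?_
    field_simp
  · simp_rw [hprod]
    -- Here the degrees 8, 7 and 6 cancel: this fixes all coefficients of the numerator except `B`.
    refine tendsto_of_eq_comp_inv (f := fun w => w * (8 * B + 16 * e₃ - 8 * L * M + 2 * L ^ 3 +
      w * (-4 - 16 * e₄ + 4 * M ^ 2 - 4 * L * B - 2 * L ^ 2 * M + (1 / 4) * L ^ 4) +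
      w ^ 2 * (-8 * B - 16 * e₃ + 4 * M * B + 4 * L + 8 * L * M - L ^ 2 * B - 2 * L ^ 3) +
      w ^ 3 * (B ^ 2 + 16 * e₄ - 4 * M - 4 * M ^ 2 + 4 * L * B + 2 * L ^ 2 * M -
        (1 / 4) * L ^ 4) +
      w ^ 4 * (4 * e₃ - 4 * M * B + L ^ 2 * B) - w ^ 5 * (B ^ 2 + 4 * e₄))) (by fun_prop)
      (by simp) fun z hz => ?_
    field_simp
    ring

end Infinity

/-! ### The Hilbert transform of the explicit densities -/

section Existence

variable {a₁ a₂ a₃ a₄ : ℝ}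

theorem norm_cutRoot_unit (z : ℂ) : ‖cutRoot (-1) 1 z‖ = Real.sqrt ‖z ^ 2 - 1‖ := by
  rw [eq_comm, Real.sqrt_eq_iff_mul_self_eq (norm_nonneg _) (norm_nonneg _), ← norm_mul, ← sq,
    cutRoot_unit_sq]

/-- After squaring, `(im z)² ≤ |z - c|²` is divided by a simple zero at worst. -/
theorem tendsto_im_div_surfaceRoot (h₁ : a₁ < a₂) (h₂ : a₂ < a₃) (h₃ : a₃ < a₄) (c : ℝ) :
    Tendsto (fun z : ℂ => (z.im : ℂ) / surfaceRoot a₁ a₂ a₃ a₄ z) (𝓝[{z | z.im ≠ 0}] (c : ℂ))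
      (𝓝 0) := by
  suffices h : Tendsto (fun z : ℂ => ‖(z.im : ℂ) / surfaceRoot a₁ a₂ a₃ a₄ z‖ ^ 2)
      (𝓝[{z | z.im ≠ 0}] (c : ℂ)) (𝓝 0) by
    have h1 := h.sqrt
    rw [Real.sqrt_zero] at h1
    refine tendsto_zero_iff_norm_tendsto_zero.2 (h1.congr fun z => ?_)
    rw [Real.sqrt_sq (norm_nonneg _)]
  have hsq : ∀ z : ℂ, ‖(z.im : ℂ) / surfaceRoot a₁ a₂ a₃ a₄ z‖ ^ 2 =
      z.im ^ 2 / ‖surfaceRoot a₁ a₂ a₃ a₄ z ^ 2‖ := fun z => by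
    rw [norm_div, div_pow, norm_pow, Complex.norm_real, Real.norm_eq_abs, sq_abs]
  simp_rw [hsq]
  by_cases hc : (c : ℂ) ∈ branchPoints a₁ a₂ a₃ a₄
  · obtain ⟨q, hqc, hq0, hq⟩ := exists_surfaceRoot_sq_eq h₁ h₂ h₃ hc
    have h1 : Tendsto (fun z : ℂ => ‖z - c‖ / ‖q z‖) (𝓝[{z | z.im ≠ 0}] (c : ℂ)) (𝓝 0) := by
      have h2 : ContinuousAt (fun z : ℂ => ‖z - c‖ / ‖q z‖) (c : ℂ) :=
        ContinuousAt.div (by fun_prop) hqc.norm.continuousAt (norm_ne_zero_iff.2 hq0)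
      have h3 := h2.tendsto
      simp only [sub_self, norm_zero, zero_div] at h3
      exact h3.mono_left nhdsWithin_le_nhds
    refine squeeze_zero (fun z => by positivity) (fun z => ?_) h1
    rw [hq z, norm_mul]
    have h2 : |z.im| ≤ ‖z - c‖ := by simpa using Complex.abs_im_le_norm (z - c)
    rcases eq_or_ne (z - c) 0 with h0 | h0
    · rw [h0, norm_zero, zero_mul, div_zero, zero_div]
    · have h4 := norm_pos_iff.2 h0
      have h5 : z.im ^ 2 ≤ ‖z - c‖ * ‖z - c‖ := by
        rw [← sq_abs, sq]
        gcongr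
      calc z.im ^ 2 / (‖z - c‖ * ‖q z‖) ≤ ‖z - c‖ * ‖z - c‖ / (‖z - c‖ * ‖q z‖) := by gcongr
        _ = ‖z - c‖ / ‖q z‖ := mul_div_mul_left _ _ h4.ne'
  · have h0 := surfaceRoot_ne_zero hc
    simp_rw [surfaceRoot_sq]
    have h2 : ContinuousAt (fun z : ℂ => z.im ^ 2 /
        ‖(z - a₁) * (z - a₂) * (z - a₃) * (z - a₄)‖) (c : ℂ) := by
      refine ContinuousAt.div (by fun_prop) (by fun_prop) ?_
      rw [← surfaceRoot_sq]
      exact norm_ne_zero_iff.2 (pow_ne_zero 2 h0)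
    have h3 := h2.tendsto
    simp only [Complex.ofReal_im, ne_eq, OfNat.ofNat_ne_zero, not_false_eq_true, zero_pow,
      zero_div] at h3
    exact h3.mono_left nhdsWithin_le_nhds

theorem mem_gap_of_mem_interior (h₀ : -1 ≤ a₁) (h₁ : a₁ < a₂) (h₂ : a₂ < a₃) (h₃ : a₃ < a₄)
    (h₄ : a₄ ≤ 1) {x : ℝ} (hx : x ∈ interior (spectralSupport a₁ a₂ a₃ a₄)) :
    x ∈ Ioo (-1) a₁ ∪ Ioo a₂ a₃ ∪ Ioo a₄ 1 := by
  obtain ⟨ε, hε, hball⟩ := Metric.mem_nhds_iff.1 (mem_interior_iff_mem_nhds.1 hx)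
  have key : ∀ t : ℝ, |t| < ε → x + t ∈ spectralSupport a₁ a₂ a₃ a₄ := fun t ht =>
    hball (by simpa [Real.dist_eq] using ht)
  have hsub := spectralSupport_subset h₀ h₁ h₂ h₃ h₄
  have hΓ : x ∈ spectralSupport a₁ a₂ a₃ a₄ := interior_subset hx
  have hl : -1 < x := by
    have := (hsub (key (-(ε / 2)) (by rw [abs_neg, abs_of_pos (by positivity)]; linarith))).1
    linarith
  have hr : x < 1 := by
    have := (hsub (key (ε / 2) (by rw [abs_of_pos (by positivity)]; linarith))).2
    linarith
  have hout : ∀ y, y ∈ spectralSupport a₁ a₂ a₃ a₄ → y ∉ Ioo a₁ a₂ ∧ y ∉ Ioo a₃ a₄ := by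
    rintro y ((hy | hy) | hy) <;> constructor <;> rintro ⟨hy1, hy2⟩ <;> linarith [hy.1, hy.2]
  have hne1 : x ≠ a₁ := by
    intro h
    have hm : 0 < min ε (a₂ - a₁) := lt_min hε (by linarith)
    have h5 := min_le_left ε (a₂ - a₁)
    have h6 := min_le_right ε (a₂ - a₁)
    refine (hout _ (key (min ε (a₂ - a₁) / 2) ?_)).1 ⟨by linarith, by linarith⟩
    rw [abs_of_pos (by positivity)]
    linarith
  have hne2 : x ≠ a₂ := by
    intro h
    have hm : 0 < min ε (a₂ - a₁) := lt_min hε (by linarith)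
    have h5 := min_le_left ε (a₂ - a₁)
    have h6 := min_le_right ε (a₂ - a₁)
    refine (hout _ (key (-(min ε (a₂ - a₁) / 2)) ?_)).1 ⟨by linarith, by linarith⟩
    rw [abs_neg, abs_of_pos (by positivity)]
    linarith
  have hne3 : x ≠ a₃ := by
    intro h
    have hm : 0 < min ε (a₄ - a₃) := lt_min hε (by linarith)
    have h5 := min_le_left ε (a₄ - a₃)
    have h6 := min_le_right ε (a₄ - a₃)
    refine (hout _ (key (min ε (a₄ - a₃) / 2) ?_)).2 ⟨by linarith, by linarith⟩
    rw [abs_of_pos (by positivity)]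
    linarith
  have hne4 : x ≠ a₄ := by
    intro h
    have hm : 0 < min ε (a₄ - a₃) := lt_min hε (by linarith)
    have h5 := min_le_left ε (a₄ - a₃)
    have h6 := min_le_right ε (a₄ - a₃)
    refine (hout _ (key (-(min ε (a₄ - a₃) / 2)) ?_)).2 ⟨by linarith, by linarith⟩
    rw [abs_neg, abs_of_pos (by positivity)]
    linarith
  rcases hΓ with (hy | hy) | hy
  · exact Or.inl (Or.inl ⟨hl, lt_of_le_of_ne hy.2 hne1⟩)
  · exact Or.inl (Or.inr ⟨lt_of_le_of_ne hy.1 hne2.symm, lt_of_le_of_ne hy.2 hne3⟩)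
  · exact Or.inr ⟨lt_of_le_of_ne hy.1 hne4.symm, hr⟩

/-- The closed interval is kept away from the bands and from `±1`, so that both `1 / R` and `√(1 -
z²)` are analytic on a closed box over it. -/
theorem exists_subinterval_of_mem_gap (h₀ : -1 ≤ a₁) (h₁ : a₁ < a₂) (h₂ : a₂ < a₃) (h₃ : a₃ < a₄)
    (h₄ : a₄ ≤ 1) {x : ℝ} (hx : x ∈ Ioo (-1) a₁ ∪ Ioo a₂ a₃ ∪ Ioo a₄ 1) :
    ∃ c d : ℝ, x ∈ Ioo c d ∧ Icc c d ⊆ spectralSupport a₁ a₂ a₃ a₄ ∧ Icc c d ⊆ Ioo (-1) 1 ∧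
      ∀ y ∈ Icc c d, y ∉ Icc a₁ a₂ ∪ Icc a₃ a₄ := by
  have key : ∀ α β : ℝ, x ∈ Ioo α β → Icc α β ⊆ spectralSupport a₁ a₂ a₃ a₄ →
      (∀ y ∈ Ioo α β, y ∉ Icc a₁ a₂ ∪ Icc a₃ a₄) → ∃ c d : ℝ, x ∈ Ioo c d ∧
      Icc c d ⊆ spectralSupport a₁ a₂ a₃ a₄ ∧ Icc c d ⊆ Ioo (-1) 1 ∧
      ∀ y ∈ Icc c d, y ∉ Icc a₁ a₂ ∪ Icc a₃ a₄ := by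
    intro α β hxαβ hsub hout
    have hsub1 := hsub.trans (spectralSupport_subset h₀ h₁ h₂ h₃ h₄)
    have hαβ : α ≤ β := by linarith [hxαβ.1, hxαβ.2]
    have hα := (hsub1 (left_mem_Icc.2 hαβ)).1
    have hβ := (hsub1 (right_mem_Icc.2 hαβ)).2
    have hcd : Icc ((α + x) / 2) ((x + β) / 2) ⊆ Ioo α β := fun y hy =>
      ⟨by linarith [hy.1, hxαβ.1], by linarith [hy.2, hxαβ.2]⟩
    exact ⟨(α + x) / 2, (x + β) / 2, ⟨by linarith [hxαβ.1], by linarith [hxαβ.2]⟩,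
      hcd.trans (Ioo_subset_Icc_self.trans hsub), hcd.trans (Ioo_subset_Ioo hα hβ),
      fun y hy => hout y (hcd hy)⟩
  rcases hx with (hx | hx) | hx
  · refine key _ _ hx (fun y hy => Or.inl (Or.inl hy)) ?_
    rintro y hy (h | h) <;> linarith [hy.1, hy.2, h.1, h.2]
  · refine key _ _ hx (fun y hy => Or.inl (Or.inr hy)) ?_
    rintro y hy (h | h) <;> linarith [hy.1, hy.2, h.1, h.2]
  · refine key _ _ hx (fun y hy => Or.inr hy) ?_
    rintro y hy (h | h) <;> linarith [hy.1, hy.2, h.1, h.2]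

theorem not_mem_bandSet_of_re {z : ℂ} (hz : z.re ∉ Icc a₁ a₂ ∪ Icc a₃ a₄) :
    z ∉ bandSet a₁ a₂ a₃ a₄ := by
  rintro ⟨x, hx, rfl⟩
  exact hz (by simpa using hx)

theorem mem_gap_of_mem_spectralSupport {x : ℝ} (hx : x ∈ spectralSupport a₁ a₂ a₃ a₄)
    (hb : (x : ℂ) ∉ branchPoints a₁ a₂ a₃ a₄ ∪ {-1, 1}) :
    x ∈ Ioo (-1) a₁ ∪ Ioo a₂ a₃ ∪ Ioo a₄ 1 := by
  have h1 : (x : ℂ) ∉ branchPoints a₁ a₂ a₃ a₄ := fun h => hb (Or.inl h)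
  rw [ofReal_mem_branchPoints] at h1
  push Not at h1
  have h2 : x ≠ -1 := by rintro rfl; exact hb (Or.inr (by simp))
  have h3 : x ≠ 1 := by rintro rfl; exact hb (Or.inr (by simp))
  rcases hx with (hy | hy) | hy
  · exact Or.inl (Or.inl ⟨lt_of_le_of_ne hy.1 h2.symm, lt_of_le_of_ne hy.2 h1.1⟩)
  · exact Or.inl (Or.inr ⟨lt_of_le_of_ne hy.1 h1.2.1.symm, lt_of_le_of_ne hy.2 h1.2.2.1⟩)
  · exact Or.inr ⟨lt_of_le_of_ne hy.1 h1.2.2.2.symm, lt_of_le_of_ne hy.2 h3⟩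

/-- The density `p(w) √(1 - w²) / (π R(w))`. -/
noncomputable def weightedDensity (a₁ a₂ a₃ a₄ : ℝ) (p : ℂ → ℂ) (w : ℝ) : ℂ :=
  1 / (Real.pi : ℂ) * (p w / surfaceRoot a₁ a₂ a₃ a₄ w) * (Real.sqrt (1 - w ^ 2) : ℂ)

theorem integrableOn_mul_sqrt {u : ℝ → ℂ} {Γ : Set ℝ} (hΓ : Γ ⊆ Icc (-1) 1)
    (hu : IntegrableOn u (Icc (-1) 1)) :
    IntegrableOn (fun w => u w * (Real.sqrt (1 - w ^ 2) : ℂ)) Γ :=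
  (hu.mul_continuousOn (by fun_prop) isCompact_Icc).mono_set hΓ

theorem integrableOn_weightedDensity (h₀ : -1 ≤ a₁) (h₁ : a₁ < a₂) (h₂ : a₂ < a₃) (h₃ : a₃ < a₄)
    (h₄ : a₄ ≤ 1) {p : ℂ → ℂ} (hp : Continuous p) :
    IntegrableOn (weightedDensity a₁ a₂ a₃ a₄ p) (spectralSupport a₁ a₂ a₃ a₄) :=
  integrableOn_mul_sqrt (spectralSupport_subset h₀ h₁ h₂ h₃ h₄)
    ((integrableOn_div_surfaceRoot h₁ h₂ h₃ hp).const_mul _)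

/-- Local structure of the Cauchy transform of the explicit density inside the spectral support. -/
theorem exists_extension_weightedDensity (h₀ : -1 ≤ a₁) (h₁ : a₁ < a₂) (h₂ : a₂ < a₃)
    (h₃ : a₃ < a₄) (h₄ : a₄ ≤ 1) {p : ℂ → ℂ} (hp : Differentiable ℂ p) {x : ℝ}
    (hx : x ∈ Ioo (-1) a₁ ∪ Ioo a₂ a₃ ∪ Ioo a₄ 1) :
    ∃ H : ℂ → ℂ, AnalyticAt ℂ H x ∧
      (∀ᶠ z in 𝓝 (x : ℂ), z.im ≠ 0 → cauchyTransform (spectralSupport a₁ a₂ a₃ a₄)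
        (weightedDensity a₁ a₂ a₃ a₄ p) z =
        H z + p z * cutRoot (-1) 1 z / surfaceRoot a₁ a₂ a₃ a₄ z) ∧
      Tendsto (fun ε : ℝ => ∫ w in spectralSupport a₁ a₂ a₃ a₄ \ Metric.ball x ε,
        weightedDensity a₁ a₂ a₃ a₄ p w / ((w - x : ℝ) : ℂ)) (𝓝[>] 0) (𝓝 (H x)) := by
  obtain ⟨c, d, hxcd, hsub, hunit, hout⟩ := exists_subinterval_of_mem_gap h₀ h₁ h₂ h₃ h₄ hx
  have hcd : c < d := hxcd.1.trans hxcd.2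
  set h : ℂ → ℂ := fun z => 1 / (Real.pi : ℂ) * (p z / surfaceRoot a₁ a₂ a₃ a₄ z) *
    circleRoot z with hh
  have hhd : DifferentiableOn ℂ h (Icc c d ×ℂ Icc (-1) 1) := by
    intro z hz
    have hre := (Complex.mem_reProdIm.1 hz).1
    have hb := not_mem_bandSet_of_re (hout _ hre)
    refine DifferentiableAt.differentiableWithinAt ?_
    refine DifferentiableAt.mul (DifferentiableAt.const_mul (DifferentiableAt.div (hp z)
      (differentiableAt_surfaceRoot h₁ h₃ hb) ?_) _) (differentiableAt_circleRoot (hunit hre))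
    exact surfaceRoot_ne_zero fun hbr => hb (branchPoints_subset_bandSet h₁ h₃ hbr)
  obtain ⟨H, hHd, hHpos, hHneg, hHpv⟩ := exists_cauchyTransform_extension
    isClosed_spectralSupport.measurableSet
    (integrableOn_weightedDensity h₀ h₁ h₂ h₃ h₄ hp.continuous) one_pos hcd hsub hhd
    (fun w hw => by
      simp only [hh, weightedDensity]
      rw [circleRoot_ofReal (Ioo_subset_Icc_self (hunit hw))])
  have hU : Ioo c d ×ℂ Ioo (-1) 1 ∈ 𝓝 (x : ℂ) :=
    (isOpen_Ioo.reProdIm isOpen_Ioo).mem_nhds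
      (Complex.mem_reProdIm.2 ⟨by simpa using hxcd, by simp⟩)
  have hpi : (Real.pi : ℂ) ≠ 0 := by exact_mod_cast Real.pi_ne_zero
  refine ⟨H, hHd.analyticAt hU, ?_, hHpv x hxcd⟩
  filter_upwards [hU] with z hz hz0
  rcases lt_or_gt_of_ne hz0 with him | him
  · rw [hHneg z hz him, cutRoot_unit_of_im_neg him, hh]
    field_simp
    ring
  · rw [hHpos z hz him, cutRoot_unit_of_im_pos him, hh]
    field_simp

/-- The two sides have the same jump across `Γ`, the singular points are removable, and both decay
at infinity; the difference is therefore an entire function equal to zero. -/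
theorem cauchyTransform_weightedDensity (h₀ : -1 ≤ a₁) (h₁ : a₁ < a₂) (h₂ : a₂ < a₃)
    (h₃ : a₃ < a₄) (h₄ : a₄ ≤ 1) {p q : ℂ → ℂ} (hp : Differentiable ℂ p)
    (hq : Differentiable ℂ q)
    (hlim : Tendsto (fun z => p z * cutRoot (-1) 1 z / surfaceRoot a₁ a₂ a₃ a₄ z - q z)
      (Bornology.cobounded ℂ) (𝓝 0)) {z : ℂ} (hz : z.im ≠ 0) :
    cauchyTransform (spectralSupport a₁ a₂ a₃ a₄) (weightedDensity a₁ a₂ a₃ a₄ p) z =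
      p z * cutRoot (-1) 1 z / surfaceRoot a₁ a₂ a₃ a₄ z - q z := by
  set Γ := spectralSupport a₁ a₂ a₃ a₄ with hΓ
  have hΓc : IsClosed Γ := isClosed_spectralSupport
  have hΓ1 : Γ ⊆ Icc (-1) 1 := spectralSupport_subset h₀ h₁ h₂ h₃ h₄
  set f := weightedDensity a₁ a₂ a₃ a₄ p with hf
  have hfi : IntegrableOn f Γ := integrableOn_weightedDensity h₀ h₁ h₂ h₃ h₄ hp.continuous
  set D : ℂ → ℂ := fun z => cauchyTransform Γ f z -
    (p z * cutRoot (-1) 1 z / surfaceRoot a₁ a₂ a₃ a₄ z - q z) with hD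
  have hbranchΓ : ∀ x : ℝ, (x : ℂ) ∈ branchPoints a₁ a₂ a₃ a₄ → x ∈ Γ := by
    intro x hx
    rw [ofReal_mem_branchPoints] at hx
    rcases hx with rfl | rfl | rfl | rfl
    · exact Or.inl (Or.inl ⟨h₀, le_rfl⟩)
    · exact Or.inl (Or.inr ⟨le_rfl, h₂.le⟩)
    · exact Or.inl (Or.inr ⟨h₂.le, le_rfl⟩)
    · exact Or.inr ⟨le_rfl, h₄⟩
  obtain ⟨E, hE, hED⟩ := exists_entire_of_forall_exists_analyticAt (D := D)
    (S := branchPoints a₁ a₂ a₃ a₄ ∪ {-1, 1}) (finite_branchPoints.union (toFinite _))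
    (by
      rintro z (hz | hz)
      · exact im_eq_zero_of_mem_branchPoints hz
      · rcases hz with rfl | rfl <;> simp)
    (by
      intro z hz
      by_cases hzΓ : ∃ x ∈ Γ, (x : ℂ) = z
      · obtain ⟨x, hx, rfl⟩ := hzΓ
        obtain ⟨H, hH, hev, -⟩ := exists_extension_weightedDensity h₀ h₁ h₂ h₃ h₄ hp
          (mem_gap_of_mem_spectralSupport hx hz)
        refine ⟨fun z => H z + q z, hH.add (hq.analyticAt _), ?_⟩
        filter_upwards [hev] with w hw hw0
        rw [hD]
        beta_reduce
        rw [hw hw0]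
        ring
      · push Not at hzΓ
        -- Off `Γ`, bands included, `S / R` is replaced by `R S / R²`, whose numerator is cut only
        -- along `Γ`.
        set O : Set ℂ := ((fun x : ℝ => (x : ℂ)) '' Γ)ᶜ with hO
        have hOo : IsOpen O :=
          (Complex.isometry_ofReal.isClosedEmbedding.isClosedMap Γ hΓc).isOpen_compl
        have hOmem : ∀ w ∈ O, ∀ x ∈ Γ, (x : ℂ) ≠ w := fun w hw x hx he => hw ⟨x, hx, he⟩
        have hzO : z ∈ O := by
          rintro ⟨x, hx, he⟩
          exact hzΓ x hx he
        have hdiff : DifferentiableOn ℂ (fun z => cauchyTransform Γ f z -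
            (p z * supportRoot a₁ a₂ a₃ a₄ z /
              ((z - a₁) * (z - a₂) * (z - a₃) * (z - a₄)) - q z)) O := by
          intro w hw
          refine DifferentiableAt.differentiableWithinAt ?_
          refine (differentiableAt_cauchyTransform_of_isClosed hΓc hfi (hOmem w hw)).sub
            (DifferentiableAt.sub (DifferentiableAt.div ((hp w).mul
              (differentiableAt_supportRoot h₀ h₂ h₄ (hOmem w hw))) (by fun_prop) ?_) (hq w))
          rw [← surfaceRoot_sq]
          refine pow_ne_zero 2 (surfaceRoot_ne_zero fun hb => ?_)
          have hwr : w = (w.re : ℂ) := by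
            apply Complex.ext
            · simp
            · simp [im_eq_zero_of_mem_branchPoints hb]
          rw [hwr] at hb
          exact hOmem w hw w.re (hbranchΓ _ hb) hwr.symm
        refine ⟨_, hdiff.analyticAt (hOo.mem_nhds hzO), Eventually.of_forall fun w hw0 => ?_⟩
        have hR : surfaceRoot a₁ a₂ a₃ a₄ w ≠ 0 :=
          surfaceRoot_ne_zero fun hb => hw0 (im_eq_zero_of_mem_branchPoints hb)
        rw [hD]
        beta_reduce
        rw [← surfaceRoot_sq, ← surfaceRoot_mul_cutRoot h₀ h₁ h₂ h₃ h₄]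
        field_simp)
    (by
      intro c _
      have t1 := tendsto_im_smul_cauchyTransform hfi c
      have t2 : Tendsto (fun z : ℂ => (z.im : ℂ) / surfaceRoot a₁ a₂ a₃ a₄ z *
          (p z * cutRoot (-1) 1 z)) (𝓝[{z | z.im ≠ 0}] (c : ℂ)) (𝓝 0) := by
        have hcont : Continuous fun z : ℂ => ‖p z‖ * Real.sqrt ‖z ^ 2 - 1‖ := by
          have := hp.continuous
          fun_prop
        have t3 := (tendsto_im_div_surfaceRoot h₁ h₂ h₃ c).norm.mul
          ((hcont.tendsto (c : ℂ)).mono_left (nhdsWithin_le_nhds (s := {z : ℂ | z.im ≠ 0})))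
        rw [norm_zero, zero_mul] at t3
        refine tendsto_zero_iff_norm_tendsto_zero.2 (t3.congr fun z => ?_)
        rw [norm_mul _ (p z * _), norm_mul (p z), norm_cutRoot_unit]
      have t4 : Tendsto (fun z : ℂ => (z.im : ℂ) * q z) (𝓝[{z | z.im ≠ 0}] (c : ℂ)) (𝓝 0) := by
        have hcont : Continuous fun z : ℂ => (z.im : ℂ) * q z := by
          have := hq.continuous
          fun_prop
        have := hcont.tendsto (c : ℂ)
        simp only [Complex.ofReal_im, Complex.ofReal_zero, zero_mul] at this
        exact this.mono_left nhdsWithin_le_nhds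
      have t5 := (t1.sub t2).add t4
      simp only [sub_zero, add_zero] at t5
      refine t5.congr fun z => ?_
      rw [hD]
      ring)
  have hDlim : Tendsto D (Bornology.cobounded ℂ) (𝓝 0) := by
    have := (tendsto_cauchyTransform_cobounded hΓc.measurableSet hΓ1 hfi).sub hlim
    rwa [sub_zero] at this
  obtain ⟨k, hk⟩ := exists_eq_const_of_eventually_bounded hE (C := 1) (by
    have h1 := hDlim.norm
    rw [norm_zero] at h1
    filter_upwards [h1.eventually_lt_const one_pos] with w hw hw0
    rw [hED w hw0]
    exact hw.le)
  -- The decay of `D` is transferred to the constant `E` along the imaginary axis, where the two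
  -- agree.
  have hvert : Tendsto (fun t : ℝ => (t : ℂ) * Complex.I) atTop (Bornology.cobounded ℂ) := by
    rw [← tendsto_norm_atTop_iff_cobounded]
    refine tendsto_abs_atTop_atTop.congr fun t => ?_
    simp
  have hk0 : k = 0 := by
    refine tendsto_nhds_unique ?_ (hDlim.comp hvert)
    refine tendsto_const_nhds.congr' ?_
    filter_upwards [eventually_gt_atTop 0] with t ht
    have : ((t : ℂ) * Complex.I).im ≠ 0 := by simpa using ht.ne'
    rw [Function.comp_apply, ← hED _ this, hk]
  have := hED z hz
  rw [hk z, hk0, hD] at this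
  exact (sub_eq_zero.1 this.symm)

/-- Comparing the local formula `F = H + p S / R` with the global one `F = p S / R - q` identifies
the principal value. -/
theorem tendsto_truncated_weightedDensity (h₀ : -1 ≤ a₁) (h₁ : a₁ < a₂) (h₂ : a₂ < a₃)
    (h₃ : a₃ < a₄) (h₄ : a₄ ≤ 1) {p q : ℂ → ℂ} (hp : Differentiable ℂ p)
    (hq : Differentiable ℂ q)
    (hlim : Tendsto (fun z => p z * cutRoot (-1) 1 z / surfaceRoot a₁ a₂ a₃ a₄ z - q z)
      (Bornology.cobounded ℂ) (𝓝 0)) {x : ℝ}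
    (hx : x ∈ interior (spectralSupport a₁ a₂ a₃ a₄)) :
    Tendsto (fun ε : ℝ => ∫ w in spectralSupport a₁ a₂ a₃ a₄ \ Metric.ball x ε,
        weightedDensity a₁ a₂ a₃ a₄ p w / ((w - x : ℝ) : ℂ)) (𝓝[>] 0) (𝓝 (-q x)) := by
  obtain ⟨H, hH, hev, hpv⟩ := exists_extension_weightedDensity h₀ h₁ h₂ h₃ h₄ hp
    (mem_gap_of_mem_interior h₀ h₁ h₂ h₃ h₄ hx)
  have hne := neBot_nhdsWithin_im_ne_zero (x : ℂ)
  have hHx : H x = -q x := by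
    refine tendsto_nhds_unique (l := 𝓝[{w : ℂ | w.im ≠ 0}] (x : ℂ))
      (hH.continuousAt.tendsto.mono_left nhdsWithin_le_nhds) ?_
    refine Tendsto.congr' ?_
      ((hq.continuous.neg.tendsto (x : ℂ)).mono_left nhdsWithin_le_nhds)
    rw [Filter.EventuallyEq, eventually_nhdsWithin_iff]
    filter_upwards [hev] with z hz hz0
    have h1 := hz hz0
    rw [cauchyTransform_weightedDensity h₀ h₁ h₂ h₃ h₄ hp hq hlim hz0] at h1
    rw [Pi.neg_apply]
    linear_combination h1
  rwa [hHx] at hpv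

end Existence

/-! ### Solutions of the condensate equation -/

section Solutions

variable {a₁ a₂ a₃ a₄ : ℝ}

theorem ae_not_mem_branchPoints : ∀ᵐ x : ℝ, (x : ℂ) ∉ branchPoints a₁ a₂ a₃ a₄ := by
  have h : ∀ a : ℝ, ∀ᵐ x : ℝ, x ≠ a := fun a => by simp [ae_iff]
  filter_upwards [h a₁, h a₂, h a₃, h a₄] with x hx1 hx2 hx3 hx4
  rw [ofReal_mem_branchPoints]
  tauto

theorem ofReal_not_mem_branchPoints_of_mem_band (h₁ : a₁ < a₂) (h₂ : a₂ < a₃) (h₃ : a₃ < a₄)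
    {x : ℝ} (hx : x ∈ Ioo a₁ a₂ ∪ Ioo a₃ a₄) : (x : ℂ) ∉ branchPoints a₁ a₂ a₃ a₄ := by
  rw [ofReal_mem_branchPoints]
  rintro (h | h | h | h) <;> rcases hx with hx | hx <;> linarith [hx.1, hx.2]

theorem integrableOn_div_sub_of_diff_ball {Γ : Set ℝ} (hΓ : MeasurableSet Γ) {f : ℝ → ℂ}
    (hf : IntegrableOn f Γ) (x : ℝ) {ε : ℝ} (hε : 0 < ε) :
    IntegrableOn (fun w : ℝ => f w / ((w - x : ℝ) : ℂ)) (Γ \ Metric.ball x ε) := by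
  have hf' : IntegrableOn f (Γ \ Metric.ball x ε) := hf.mono_set sdiff_subset
  refine (hf'.norm.mul_const (1 / ε)).mono' (hf'.aestronglyMeasurable.div₀ (by fun_prop)) ?_
  refine (ae_restrict_iff' (hΓ.diff Metric.isOpen_ball.measurableSet)).2
    (Eventually.of_forall fun w hw => ?_)
  have := hw.2
  rw [mem_ball_iff_norm, not_lt] at this
  rw [norm_div, div_eq_mul_one_div, Complex.norm_real]
  gcongr

theorem intervalIntegrable_of_integrableOn {u : ℝ → ℂ} (hu : IntegrableOn u (Icc (-1) 1)) {c d : ℝ}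
    (hc : -1 ≤ c) (hcd : c ≤ d) (hd : d ≤ 1) : IntervalIntegrable u volume c d :=
  (intervalIntegrable_iff_integrableOn_Icc_of_le hcd).2 (hu.mono_set (Icc_subset_Icc hc hd))

theorem IsCondensateSolution.congr (h₁ : a₁ < a₂) (h₂ : a₂ < a₃) (h₃ : a₃ < a₄) {g : ℝ → ℝ}
    {u v : ℂ → ℂ} (hv : IsCondensateSolution a₁ a₂ a₃ a₄ g v)
    (huv : EqOn u v (branchPoints a₁ a₂ a₃ a₄)ᶜ) : IsCondensateSolution a₁ a₂ a₃ a₄ g u := by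
  have hae : ∀ᵐ x : ℝ, u x = v x := ae_not_mem_branchPoints.mono fun x hx => huv hx
  have hint : ∀ c d : ℝ, ∫ x in c..d, u (x : ℂ) = ∫ x in c..d, v (x : ℂ) := fun c d =>
    intervalIntegral.integral_congr_ae (hae.mono fun x hx _ => hx)
  refine ⟨?_, ?_, ?_, ?_, ?_, ?_⟩
  · exact hv.differentiableOn.congr fun z hz =>
      huv fun hb => hz (branchPoints_subset_bandSet h₁ h₃ hb)
  · intro x hx
    rw [huv (ofReal_not_mem_branchPoints_of_mem_band h₁ h₂ h₃ hx)]
    refine (hv.boundaryValue x hx).congr' ?_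
    filter_upwards [self_mem_nhdsWithin] with z hz
    exact (huv fun hb => (ne_of_gt hz) (im_eq_zero_of_mem_branchPoints hb)).symm
  · exact hv.integrableOn.congr_fun_ae (ae_restrict_of_ae (hae.mono fun x hx => hx.symm))
  · intro x hx
    obtain ⟨h, hh, he⟩ := hv.hilbert x hx
    refine ⟨h, ?_, he⟩
    unfold HasFiniteHilbertTransform at hh ⊢
    refine hh.congr fun ε => ?_
    congr 1
    exact integral_congr_ae (ae_restrict_of_ae (hae.mono fun w hw => by beta_reduce; rw [hw]))
  · rw [hint, hv.vanish_left]
  · rw [hint, hv.vanish_right]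

theorem IsCondensateSolution.sub (h₀ : -1 ≤ a₁) (h₁ : a₁ < a₂) (h₂ : a₂ < a₃) (h₃ : a₃ < a₄)
    (h₄ : a₄ ≤ 1) {g : ℝ → ℝ} {u v : ℂ → ℂ} (hu : IsCondensateSolution a₁ a₂ a₃ a₄ g u)
    (hv : IsCondensateSolution a₁ a₂ a₃ a₄ g v) :
    IsCondensateSolution a₁ a₂ a₃ a₄ (fun _ => 0) (fun z => u z - v z) := by
  have hΓ : MeasurableSet (spectralSupport a₁ a₂ a₃ a₄) := isClosed_spectralSupport.measurableSet
  have hΓ1 := spectralSupport_subset h₀ h₁ h₂ h₃ h₄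
  refine ⟨hu.differentiableOn.sub hv.differentiableOn, ?_, hu.integrableOn.sub hv.integrableOn,
    ?_, ?_, ?_⟩
  · exact fun x hx => (hu.boundaryValue x hx).sub (hv.boundaryValue x hx)
  · intro x hx
    obtain ⟨h, hh, he⟩ := hu.hilbert x hx
    obtain ⟨k, hk, ke⟩ := hv.hilbert x hx
    refine ⟨h - k, ?_, by rw [mul_sub, he, ke, sub_self, Complex.ofReal_zero]⟩
    unfold HasFiniteHilbertTransform at hh hk ⊢
    refine (hh.sub hk).congr' ?_
    filter_upwards [self_mem_nhdsWithin] with ε hε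
    rw [← mul_sub, ← integral_sub
      (integrableOn_div_sub_of_diff_ball hΓ (integrableOn_mul_sqrt hΓ1 hu.integrableOn) x hε)
      (integrableOn_div_sub_of_diff_ball hΓ (integrableOn_mul_sqrt hΓ1 hv.integrableOn) x hε)]
    congr 2
    funext w
    ring
  · rw [intervalIntegral.integral_sub
      (intervalIntegrable_of_integrableOn hu.integrableOn h₀ h₁.le (by linarith))
      (intervalIntegrable_of_integrableOn hv.integrableOn h₀ h₁.le (by linarith)),
      hu.vanish_left, hv.vanish_left, sub_zero]
  · rw [intervalIntegral.integral_sub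
      (intervalIntegrable_of_integrableOn hu.integrableOn (by linarith) h₃.le h₄)
      (intervalIntegrable_of_integrableOn hv.integrableOn (by linarith) h₃.le h₄),
      hu.vanish_right, hv.vanish_right, sub_zero]

theorem isCondensateSolution_of_tendsto (h₀ : -1 ≤ a₁) (h₁ : a₁ < a₂) (h₂ : a₂ < a₃) (h₃ : a₃ < a₄)
    (h₄ : a₄ ≤ 1) {p q : ℂ → ℂ} {r g : ℝ → ℝ} (hp : Differentiable ℂ p) (hq : Differentiable ℂ q)
    (hlim : Tendsto (fun z => p z * cutRoot (-1) 1 z / surfaceRoot a₁ a₂ a₃ a₄ z - q z)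
      (Bornology.cobounded ℂ) (𝓝 0)) (hpr : ∀ x : ℝ, p x = r x) (hqg : ∀ x : ℝ, -q x = g x)
    (hl : ∫ x in a₁..a₂, r x * weight a₁ a₂ a₃ a₄ x = 0)
    (hr : ∫ x in a₃..a₄, r x * weight a₁ a₂ a₃ a₄ x = 0) :
    IsCondensateSolution a₁ a₂ a₃ a₄ g
      (fun z => 1 / (Real.pi : ℂ) * (p z / surfaceRoot a₁ a₂ a₃ a₄ z)) := by
  have hpi : (Real.pi : ℂ) ≠ 0 := by exact_mod_cast Real.pi_ne_zero
  refine ⟨?_, ?_, (integrableOn_div_surfaceRoot h₁ h₂ h₃ hp.continuous).const_mul _, ?_, ?_, ?_⟩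
  · intro z hz
    refine DifferentiableAt.differentiableWithinAt (DifferentiableAt.const_mul
      (DifferentiableAt.div (hp z) (differentiableAt_surfaceRoot h₁ h₃ hz) ?_) _)
    exact surfaceRoot_ne_zero fun hb => hz (branchPoints_subset_bandSet h₁ h₃ hb)
  · intro x hx
    have hb := ofReal_not_mem_branchPoints_of_mem_band h₁ h₂ h₃ hx
    refine Tendsto.const_mul _ (Tendsto.div ?_ (tendsto_surfaceRoot_upper h₁ h₃ hb)
      (surfaceRoot_ne_zero hb))
    exact (hp.continuous.tendsto (x : ℂ)).mono_left nhdsWithin_le_nhds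
  · intro x hx
    have h := tendsto_truncated_weightedDensity h₀ h₁ h₂ h₃ h₄ hp hq hlim hx
    exact ⟨1 / (Real.pi : ℂ) * -q x, h.const_mul _, by rw [hqg]; field_simp⟩
  · rw [integral_div_surfaceRoot_left h₁ h₂ h₃ hpr, hl, Complex.ofReal_zero, mul_zero]
  · rw [integral_div_surfaceRoot_right h₁ h₂ h₃ hpr, hr, Complex.ofReal_zero, mul_zero]

theorem isCondensateSolution_genusOneDOS (h₀ : -1 ≤ a₁) (h₁ : a₁ < a₂) (h₂ : a₂ < a₃)
    (h₃ : a₃ < a₄) (h₄ : a₄ ≤ 1) :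
    IsCondensateSolution a₁ a₂ a₃ a₄ (fun x => -x) (genusOneDOS a₁ a₂ a₃ a₄) :=
  isCondensateSolution_of_tendsto h₀ h₁ h₂ h₃ h₄ (r := dosPoly a₁ a₂ a₃ a₄) (by fun_prop)
    differentiable_id (tendsto_dos_infinity _) (fun x => by rw [dosPoly]; push_cast; rfl)
    (fun x => by simp) (integral_dosPoly_left h₁ h₂ h₃) (integral_dosPoly_right h₁ h₂ h₃)

theorem isCondensateSolution_genusOneDOF (h₀ : -1 ≤ a₁) (h₁ : a₁ < a₂) (h₂ : a₂ < a₃)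
    (h₃ : a₃ < a₄) (h₄ : a₄ ≤ 1) :
    IsCondensateSolution a₁ a₂ a₃ a₄ (fun x => 2 - 4 * x ^ 2) (genusOneDOF a₁ a₂ a₃ a₄) :=
  isCondensateSolution_of_tendsto h₀ h₁ h₂ h₃ h₄ (r := dofPoly a₁ a₂ a₃ a₄) (by fun_prop)
    (q := fun z => 4 * z ^ 2 - 2) (by fun_prop) (tendsto_dof_infinity _)
    (fun x => by rw [dofPoly]; push_cast; rfl) (fun x => by push_cast; ring)
    (integral_dofPoly h₁ h₂ h₃).1 (integral_dofPoly h₁ h₂ h₃).2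

/-- For a solution of the homogeneous equation, the Cauchy transform of `φ √(1 - w²)` is
`π φ √(z² - 1)`. -/
theorem IsCondensateSolution.cauchyTransform_eq (h₀ : -1 ≤ a₁) (h₁ : a₁ < a₂) (h₂ : a₂ < a₃)
    (h₃ : a₃ < a₄) (h₄ : a₄ ≤ 1) {φ : ℂ → ℂ}
    (hφ : IsCondensateSolution a₁ a₂ a₃ a₄ (fun _ => 0) φ) {z : ℂ} (hz : z.im ≠ 0) :
    cauchyTransform (spectralSupport a₁ a₂ a₃ a₄) (fun w => φ w * (Real.sqrt (1 - w ^ 2) : ℂ)) z =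
      Real.pi * φ z * cutRoot (-1) 1 z := by
  set Γ := spectralSupport a₁ a₂ a₃ a₄ with hΓ
  set f : ℝ → ℂ := fun w => φ w * (Real.sqrt (1 - w ^ 2) : ℂ) with hf
  have hΓc : IsClosed Γ := isClosed_spectralSupport
  have hfi : IntegrableOn f Γ :=
    integrableOn_mul_sqrt (spectralSupport_subset h₀ h₁ h₂ h₃ h₄) hφ.integrableOn
  have hpi : (Real.pi : ℂ) ≠ 0 := by exact_mod_cast Real.pi_ne_zero
  have hφd : ∀ w, w ∉ bandSet a₁ a₂ a₃ a₄ → DifferentiableAt ℂ φ w := fun w hw =>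
    (hφ.differentiableOn w hw).differentiableAt (isClosed_bandSet.isOpen_compl.mem_nhds hw)
  -- A short interval in the middle component `(a₂, a₃)`, nonempty even if `a₁ = -1` and `a₄ = 1`,
  -- meets the closure of both half planes; the identity theorem does the rest.
  obtain ⟨c, d, hxcd, hsub, hunit, hout⟩ := exists_subinterval_of_mem_gap h₀ h₁ h₂ h₃ h₄
    (x := (a₂ + a₃) / 2) (Or.inl (Or.inr ⟨by linarith, by linarith⟩))
  have hcd : c < d := hxcd.1.trans hxcd.2
  have hhd : DifferentiableOn ℂ (fun z => φ z * circleRoot z) (Icc c d ×ℂ Icc (-1) 1) := by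
    intro w hw
    have hre := (Complex.mem_reProdIm.1 hw).1
    exact ((hφd w (not_mem_bandSet_of_re (hout _ hre))).mul
      (differentiableAt_circleRoot (hunit hre))).differentiableWithinAt
  obtain ⟨H, hHd, hHpos, hHneg, hHpv⟩ := exists_cauchyTransform_extension
    hΓc.measurableSet hfi one_pos hcd hsub hhd (fun w hw => by
      simp only [hf]
      rw [circleRoot_ofReal (Ioo_subset_Icc_self (hunit hw))])
  set U := Ioo c d ×ℂ Ioo (-1) 1 with hU
  have hUo : IsOpen U := isOpen_Ioo.reProdIm isOpen_Ioo
  have hUc : IsPreconnected U := (((convex_Ioo c d).linear_preimage Complex.reLm).inter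
    ((convex_Ioo (-1) 1).linear_preimage Complex.imLm)).isPreconnected
  -- The homogeneous equation says that the principal value, hence the analytic part of the Cauchy
  -- transform, vanishes.
  have hH0 : EqOn H (fun _ => 0) U := by
    refine eqOn_of_eq_on_real hUo hUc hHd (differentiableOn_const _) hxcd
      (Complex.mem_reProdIm.2 ⟨by simpa only [Complex.ofReal_re] using hxcd, by simp⟩)
      fun x hx => ?_
    obtain ⟨k, hk, hk0⟩ := hφ.hilbert x (mem_interior_iff_mem_nhds.2
      (mem_of_superset (Icc_mem_nhds hx.1 hx.2) hsub))
    have hk0' : k = 0 := by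
      rw [Complex.ofReal_zero, mul_eq_zero] at hk0
      exact hk0.resolve_left hpi
    unfold HasFiniteHilbertTransform at hk
    rw [hk0'] at hk
    have h5 := hk.const_mul (Real.pi : ℂ)
    rw [mul_zero] at h5
    refine tendsto_nhds_unique (hHpv x hx) (h5.congr fun ε => ?_)
    rw [← mul_assoc, mul_one_div_cancel hpi, one_mul]
  have hloc : ∀ w ∈ U, w.im ≠ 0 → cauchyTransform Γ f w = Real.pi * φ w * cutRoot (-1) 1 w := by
    intro w hw hw0
    rcases lt_or_gt_of_ne hw0 with him | him
    · rw [hHneg w hw him, hH0 hw, cutRoot_unit_of_im_neg him]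
      ring
    · rw [hHpos w hw him, hH0 hw, cutRoot_unit_of_im_pos him]
      ring
  have hglob : ∀ V : Set ℂ, IsOpen V → IsPreconnected V → (∀ w ∈ V, w.im ≠ 0) →
      (U ∩ V).Nonempty → EqOn (cauchyTransform Γ f)
        (fun w => Real.pi * φ w * cutRoot (-1) 1 w) V := by
    rintro V hVo hVc hV0 ⟨w, hwU, hwV⟩
    have hd1 : DifferentiableOn ℂ (cauchyTransform Γ f) V := fun v hv =>
      (differentiableAt_cauchyTransform_of_isClosed hΓc hfi fun x _ =>
        ofReal_ne_of_im_ne_zero (hV0 v hv) x).differentiableWithinAt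
    have hd2 : DifferentiableOn ℂ (fun w => Real.pi * φ w * cutRoot (-1) 1 w) V := fun v hv =>
      (((hφd v (not_mem_bandSet_of_im_ne_zero (hV0 v hv))).const_mul _).mul
        (differentiableAt_cutRoot (by norm_num) fun x _ =>
          ofReal_ne_of_im_ne_zero (hV0 v hv) x)).differentiableWithinAt
    refine (hd1.analyticOnNhd hVo).eqOn_of_preconnected_of_eventuallyEq (hd2.analyticOnNhd hVo)
      hVc hwV ?_
    filter_upwards [hUo.mem_nhds hwU, hVo.mem_nhds hwV] with v hvU hvV
    exact hloc v hvU (hV0 v hvV)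
  rcases lt_or_gt_of_ne hz with him | him
  · refine hglob {w | w.im < 0} (isOpen_lt Complex.continuous_im continuous_const)
      (convex_halfSpace_im_lt 0).isPreconnected (fun w hw => ne_of_lt hw)
      ⟨((a₂ + a₃) / 2 : ℝ) + (-(1 / 2) : ℝ) * Complex.I, ?_, ?_⟩ him
    · rw [hU, Complex.mem_reProdIm]
      refine ⟨?_, ?_⟩
      · simpa only [Complex.add_re, Complex.ofReal_re, Complex.mul_re, Complex.I_re, mul_zero,
          Complex.ofReal_im, Complex.I_im, sub_zero, zero_mul, add_zero] using hxcd
      · simp only [Complex.add_im, Complex.ofReal_re, Complex.mul_im, Complex.I_re, mul_zero,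
          Complex.ofReal_im, Complex.I_im, mul_one, add_zero, zero_add]
        norm_num
    · simp only [mem_ofPred_eq, Complex.add_im, Complex.ofReal_re, Complex.mul_im, Complex.I_re,
        mul_zero, Complex.ofReal_im, Complex.I_im, mul_one, add_zero, zero_add]
      norm_num
  · refine hglob {w | 0 < w.im} (isOpen_lt continuous_const Complex.continuous_im)
      (convex_halfSpace_im_gt 0).isPreconnected (fun w hw => ne_of_gt hw)
      ⟨((a₂ + a₃) / 2 : ℝ) + (1 / 2 : ℝ) * Complex.I, ?_, ?_⟩ him
    · rw [hU, Complex.mem_reProdIm]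
      refine ⟨?_, ?_⟩
      · simpa only [Complex.add_re, Complex.ofReal_re, Complex.mul_re, Complex.I_re, mul_zero,
          Complex.ofReal_im, Complex.I_im, sub_zero, zero_mul, add_zero] using hxcd
      · simp only [Complex.add_im, Complex.ofReal_re, Complex.mul_im, Complex.I_re, mul_zero,
          Complex.ofReal_im, Complex.I_im, mul_one, add_zero, zero_add]
        norm_num
    · simp only [mem_ofPred_eq, Complex.add_im, Complex.ofReal_re, Complex.mul_im, Complex.I_re,
        mul_zero, Complex.ofReal_im, Complex.I_im, mul_one, add_zero, zero_add]
      norm_num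

end Solutions

/-! ### Uniqueness of solutions -/

section Uniqueness

variable {a₁ a₂ a₃ a₄ : ℝ}

/-- A branch point may coincide with `±1`; then the simple pole of `1 / (z² - 1)` is cancelled by
the simple zero of `R²`. -/
theorem exists_norm_surfaceRoot_sq_div_eq (h₁ : a₁ < a₂) (h₂ : a₂ < a₃) (h₃ : a₃ < a₄) {c : ℝ}
    (hc : (c : ℂ) ∈ branchPoints a₁ a₂ a₃ a₄) :
    ∃ b : ℂ → ℂ, ContinuousAt b c ∧
      ∀ z : ℂ, z.im ≠ 0 → surfaceRoot a₁ a₂ a₃ a₄ z ^ 2 / (z ^ 2 - 1) = b z := by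
  obtain ⟨q, hqc, -, hq⟩ := exists_surfaceRoot_sq_eq h₁ h₂ h₃ hc
  simp_rw [hq]
  have hne : ∀ z : ℂ, z.im ≠ 0 → z + 1 ≠ 0 ∧ z - 1 ≠ 0 := by
    intro z hz
    have h1 := ofReal_ne_of_im_ne_zero hz 1
    have h2 := ofReal_ne_of_im_ne_zero hz (-1)
    push_cast at h1 h2
    refine ⟨fun h => h2 ?_, fun h => h1 ?_⟩
    · linear_combination -h
    · linear_combination -h
  rcases eq_or_ne c 1 with rfl | hc1
  · refine ⟨fun z => q z / (z + 1), hqc.continuousAt.div (by fun_prop) (by norm_num),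
      fun z hz => ?_⟩
    obtain ⟨h5, h6⟩ := hne z hz
    rw [div_eq_div_iff (sq_sub_one_ne_zero_of_im_ne_zero hz) h5]
    push_cast
    ring
  rcases eq_or_ne c (-1) with rfl | hc2
  · refine ⟨fun z => q z / (z - 1), hqc.continuousAt.div (by fun_prop) (by norm_num),
      fun z hz => ?_⟩
    obtain ⟨h5, h6⟩ := hne z hz
    rw [div_eq_div_iff (sq_sub_one_ne_zero_of_im_ne_zero hz) h6]
    push_cast
    ring
  · refine ⟨fun z => (z - c) * q z / (z ^ 2 - 1), ContinuousAt.div ?_ (by fun_prop) ?_,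
      fun z _ => rfl⟩
    · exact ((continuous_id.sub continuous_const).mul hqc).continuousAt
    · have h5 : c ^ 2 - 1 ≠ 0 := by
        rw [show c ^ 2 - 1 = (c - 1) * (c - -1) by ring]
        exact mul_ne_zero (sub_ne_zero.2 hc1) (sub_ne_zero.2 hc2)
      exact_mod_cast h5

theorem norm_supportRoot_div_sq (h₀ : -1 ≤ a₁) (h₁ : a₁ < a₂) (h₂ : a₂ < a₃) (h₃ : a₃ < a₄)
    (h₄ : a₄ ≤ 1) {z : ℂ} (hz : z.im ≠ 0) :
    ‖supportRoot a₁ a₂ a₃ a₄ z / (z ^ 2 - 1)‖ ^ 2 =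
      ‖surfaceRoot a₁ a₂ a₃ a₄ z ^ 2 / (z ^ 2 - 1)‖ := by
  have h := sq_sub_one_ne_zero_of_im_ne_zero hz
  rw [← norm_pow, div_pow, ← surfaceRoot_mul_cutRoot h₀ h₁ h₂ h₃ h₄, mul_pow, cutRoot_unit_sq]
  congr 1
  field_simp

/-- A solution of the homogeneous equation without the band conditions is a multiple of `1 / R`. -/
theorem IsCondensateSolution.exists_mul_surfaceRoot_eq (h₀ : -1 ≤ a₁) (h₁ : a₁ < a₂) (h₂ : a₂ < a₃)
    (h₃ : a₃ < a₄) (h₄ : a₄ ≤ 1) {φ : ℂ → ℂ}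
    (hφ : IsCondensateSolution a₁ a₂ a₃ a₄ (fun _ => 0) φ) :
    ∃ k : ℂ, ∀ z, z ∉ branchPoints a₁ a₂ a₃ a₄ → φ z * surfaceRoot a₁ a₂ a₃ a₄ z = k := by
  set Γ := spectralSupport a₁ a₂ a₃ a₄ with hΓ
  set f : ℝ → ℂ := fun w => φ w * (Real.sqrt (1 - w ^ 2) : ℂ) with hf
  have hΓc : IsClosed Γ := isClosed_spectralSupport
  have hΓ1 : Γ ⊆ Icc (-1) 1 := spectralSupport_subset h₀ h₁ h₂ h₃ h₄
  have hfi : IntegrableOn f Γ := integrableOn_mul_sqrt hΓ1 hφ.integrableOn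
  have hpi : (Real.pi : ℂ) ≠ 0 := by exact_mod_cast Real.pi_ne_zero
  have hφd : ∀ w, w ∉ bandSet a₁ a₂ a₃ a₄ → DifferentiableAt ℂ φ w := fun w hw =>
    (hφ.differentiableOn w hw).differentiableAt (isClosed_bandSet.isOpen_compl.mem_nhds hw)
  set D : ℂ → ℂ := fun z => φ z * surfaceRoot a₁ a₂ a₃ a₄ z with hD
  have hDd : DifferentiableOn ℂ D (bandSet a₁ a₂ a₃ a₄)ᶜ := fun w hw =>
    ((hφd w hw).mul (differentiableAt_surfaceRoot h₁ h₃ hw)).differentiableWithinAt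
  -- This form of `φ R` involves only functions cut along `Γ`, so it continues across the open
  -- bands, on which `φ` and `R` separately are not analytic.
  have hDF : ∀ z : ℂ, z.im ≠ 0 → D z =
      cauchyTransform Γ f z / Real.pi * (supportRoot a₁ a₂ a₃ a₄ z / (z ^ 2 - 1)) := by
    intro z hz
    have h5 := sq_sub_one_ne_zero_of_im_ne_zero hz
    rw [hφ.cauchyTransform_eq h₀ h₁ h₂ h₃ h₄ hz, ← surfaceRoot_mul_cutRoot h₀ h₁ h₂ h₃ h₄, hD]
    beta_reduce
    rw [← cutRoot_unit_sq] at h5 ⊢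
    have h6 : cutRoot (-1) 1 z ≠ 0 := fun h => h5 (by rw [h]; simp)
    field_simp
  obtain ⟨E, hE, hED⟩ := exists_entire_of_forall_exists_analyticAt (D := D)
    (S := branchPoints a₁ a₂ a₃ a₄) finite_branchPoints
    (fun z hz => im_eq_zero_of_mem_branchPoints hz)
    (by
      intro z hz
      by_cases hzb : z ∈ bandSet a₁ a₂ a₃ a₄
      · obtain ⟨x, hx, rfl⟩ := hzb
        rw [ofReal_mem_branchPoints] at hz
        push Not at hz
        have hx' : x ∈ Ioo a₁ a₂ ∪ Ioo a₃ a₄ := by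
          rcases hx with hx | hx
          · exact Or.inl ⟨lt_of_le_of_ne hx.1 hz.1.symm, lt_of_le_of_ne hx.2 hz.2.1⟩
          · exact Or.inr ⟨lt_of_le_of_ne hx.1 hz.2.2.1.symm, lt_of_le_of_ne hx.2 hz.2.2.2⟩
        have hxu : -1 < x ∧ x < 1 := by
          rcases hx' with hx' | hx' <;> constructor <;> linarith [hx'.1, hx'.2]
        have hxΓ : x ∉ Γ := by
          rintro ((hy | hy) | hy) <;> rcases hx' with hx' | hx' <;>
            linarith [hx'.1, hx'.2, hy.1, hy.2]
        set O : Set ℂ := ((fun x : ℝ => (x : ℂ)) '' Γ)ᶜ ∩ {z | z ^ 2 - 1 ≠ 0} with hO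
        have hOo : IsOpen O :=
          (Complex.isometry_ofReal.isClosedEmbedding.isClosedMap Γ hΓc).isOpen_compl.inter
            (isOpen_ne_fun (by fun_prop) continuous_const)
        have hxO : (x : ℂ) ∈ O := by
          refine ⟨?_, ?_⟩
          · rintro ⟨y, hy, he⟩
            exact hxΓ (Complex.ofReal_injective he ▸ hy)
          · have : x ^ 2 - 1 ≠ 0 := by nlinarith [hxu.1, hxu.2]
            show (x : ℂ) ^ 2 - 1 ≠ 0
            exact_mod_cast this
        have hdiff : DifferentiableOn ℂ (fun z => cauchyTransform Γ f z / Real.pi *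
            (supportRoot a₁ a₂ a₃ a₄ z / (z ^ 2 - 1))) O := by
          intro w hw
          have hw' : ∀ y ∈ Γ, (y : ℂ) ≠ w := fun y hy he => hw.1 ⟨y, hy, he⟩
          exact (((differentiableAt_cauchyTransform_of_isClosed hΓc hfi hw').div_const _).mul
            ((differentiableAt_supportRoot h₀ h₂ h₄ hw').div (by fun_prop)
              (show w ^ 2 - 1 ≠ 0 from hw.2))).differentiableWithinAt
        exact ⟨_, hdiff.analyticAt (hOo.mem_nhds hxO), Eventually.of_forall hDF⟩
      · exact ⟨D, hDd.analyticAt (isClosed_bandSet.isOpen_compl.mem_nhds hzb),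
          Eventually.of_forall fun w _ => rfl⟩)
    (by
      intro c hc
      obtain ⟨b, hbc, hb⟩ := exists_norm_surfaceRoot_sq_div_eq h₁ h₂ h₃ hc
      have t1 := (tendsto_im_smul_cauchyTransform hfi c).div_const (Real.pi : ℂ)
      have t2 : Tendsto (fun z => Real.sqrt ‖b z‖) (𝓝[{z | z.im ≠ 0}] (c : ℂ))
          (𝓝 (Real.sqrt ‖b c‖)) :=
        (hbc.norm.tendsto.sqrt).mono_left nhdsWithin_le_nhds
      have t3 := t1.norm.mul t2
      rw [zero_div, norm_zero, zero_mul] at t3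
      refine tendsto_zero_iff_norm_tendsto_zero.2 (t3.congr' ?_)
      filter_upwards [self_mem_nhdsWithin] with z hz
      rw [← hb z hz, ← norm_supportRoot_div_sq h₀ h₁ h₂ h₃ h₄ hz, Real.sqrt_sq (norm_nonneg _),
        ← norm_mul, hDF z hz]
      congr 1
      ring)
  -- The Cauchy transform is `O(1 / |z|)` and `R / S` is `O(|z|)`. The factor 8 collects three twos:
  -- from `|z| - 1 ≥ |z| / 2`, from `|R| < 2 |z|²` and from `|S| > |z| / 2`.
  have hbound : ∃ C : ℝ, ∀ᶠ z in Bornology.cobounded ℂ, z.im ≠ 0 → ‖E z‖ ≤ C := by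
    set M := ∫ w in Γ, ‖f w‖ with hM
    have hM0 : 0 ≤ M := integral_nonneg fun w => norm_nonneg _
    have r1 := (tendsto_surfaceRoot_div a₁ a₂ a₃ a₄).norm
    have r2 := (tendsto_cutRoot_div (-1) 1).norm
    rw [norm_one] at r1 r2
    refine ⟨M * 8, ?_⟩
    filter_upwards [r1.eventually_lt_const one_lt_two,
      r2.eventually_const_lt (show (1 / 2 : ℝ) < 1 by norm_num),
      tendsto_norm_cobounded_atTop.eventually_ge_atTop 2] with z hz1 hz2 hz3 hz0
    have hF := norm_cauchyTransform_le hΓc.measurableSet hΓ1 hfi (z := z) (by linarith)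
    have hzpos : 0 < ‖z‖ := by linarith
    have hF2 : ‖cauchyTransform Γ f z‖ ≤ M * 2 / ‖z‖ := by
      refine hF.trans ?_
      rw [div_le_div_iff₀ (by linarith) hzpos]
      nlinarith
    rw [norm_div, norm_pow, div_lt_iff₀ (by positivity)] at hz1
    rw [norm_div, lt_div_iff₀ hzpos] at hz2
    have hS : 0 < ‖cutRoot (-1) 1 z‖ := by linarith
    have hSne := norm_pos_iff.1 hS
    have e : ‖E z‖ * (Real.pi * ‖cutRoot (-1) 1 z‖) =
        ‖cauchyTransform Γ f z‖ * ‖surfaceRoot a₁ a₂ a₃ a₄ z‖ := by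
      rw [hED z hz0, hφ.cauchyTransform_eq h₀ h₁ h₂ h₃ h₄ hz0, hD]
      simp only [norm_mul, Complex.norm_real, Real.norm_of_nonneg Real.pi_pos.le]
      ring
    have h5 : ‖E z‖ * (Real.pi * ‖cutRoot (-1) 1 z‖) ≤ M * 2 / ‖z‖ * (2 * ‖z‖ ^ 2) := by
      rw [e]
      gcongr
    have h6 : M * 2 / ‖z‖ * (2 * ‖z‖ ^ 2) = M * 8 * (1 / 2 * ‖z‖) := by
      field_simp
      ring
    rw [h6] at h5
    have h7 : ‖E z‖ * (1 / 2 * ‖z‖) ≤ ‖E z‖ * (Real.pi * ‖cutRoot (-1) 1 z‖) := by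
      refine mul_le_mul_of_nonneg_left ?_ (norm_nonneg _)
      nlinarith [Real.pi_gt_three]
    exact le_of_mul_le_mul_right (h7.trans h5) (by positivity)
  obtain ⟨C, hC⟩ := hbound
  obtain ⟨k, hk⟩ := exists_eq_const_of_eventually_bounded hE hC
  have hoff : ∀ z : ℂ, z.im ≠ 0 → D z = k := fun z hz => by rw [← hED z hz, hk]
  refine ⟨k, fun z hz => ?_⟩
  by_cases hzb : z ∈ bandSet a₁ a₂ a₃ a₄
  · obtain ⟨x, hx, rfl⟩ := hzb
    have hxb := hz
    rw [ofReal_mem_branchPoints] at hz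
    push Not at hz
    have hx' : x ∈ Ioo a₁ a₂ ∪ Ioo a₃ a₄ := by
      rcases hx with hx | hx
      · exact Or.inl ⟨lt_of_le_of_ne hx.1 hz.1.symm, lt_of_le_of_ne hx.2 hz.2.1⟩
      · exact Or.inr ⟨lt_of_le_of_ne hx.1 hz.2.2.1.symm, lt_of_le_of_ne hx.2 hz.2.2.2⟩
    -- On the bands both factors are limits from the upper half plane, where the product is already
    -- `k`.
    have hlim := (hφ.boundaryValue x hx').mul (tendsto_surfaceRoot_upper h₁ h₃ hxb)
    have hne : (𝓝[{z : ℂ | 0 < z.im}] (x : ℂ)).NeBot := by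
      refine mem_closure_iff_nhdsWithin_neBot.1 ?_
      rw [Complex.closure_setOfPred_lt_im]
      simp
    refine tendsto_nhds_unique hlim (tendsto_const_nhds.congr' ?_)
    filter_upwards [self_mem_nhdsWithin] with w hw
    exact (hoff w (ne_of_gt hw)).symm
  · have hne := neBot_nhdsWithin_im_ne_zero z
    have hc : Tendsto D (𝓝[{w : ℂ | w.im ≠ 0}] z) (𝓝 (D z)) :=
      (hDd.differentiableAt (isClosed_bandSet.isOpen_compl.mem_nhds
        hzb)).continuousAt.tendsto.mono_left nhdsWithin_le_nhds
    refine tendsto_nhds_unique hc (tendsto_const_nhds.congr' ?_)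
    filter_upwards [self_mem_nhdsWithin] with w hw
    exact (hoff w hw).symm

/-- The homogeneous equation leaves the line spanned by `1 / R`. Its integral over the left band is
a nonzero multiple of `K(m)`, so the vanishing condition there kills the coefficient. -/
theorem IsCondensateSolution.eq_zero (h₀ : -1 ≤ a₁) (h₁ : a₁ < a₂) (h₂ : a₂ < a₃)
    (h₃ : a₃ < a₄) (h₄ : a₄ ≤ 1) {φ : ℂ → ℂ}
    (hφ : IsCondensateSolution a₁ a₂ a₃ a₄ (fun _ => 0) φ) {z : ℂ}
    (hz : z ∉ branchPoints a₁ a₂ a₃ a₄) : φ z = 0 := by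
  obtain ⟨k, hk⟩ := hφ.exists_mul_surfaceRoot_eq h₀ h₁ h₂ h₃ h₄
  have hpi : (Real.pi : ℂ) ≠ 0 := by exact_mod_cast Real.pi_ne_zero
  have hint : ∫ x in a₁..a₂, φ (x : ℂ) = k * Real.pi *
      ∫ x in a₁..a₂, 1 / (Real.pi : ℂ) * (1 / surfaceRoot a₁ a₂ a₃ a₄ x) := by
    rw [← intervalIntegral.integral_const_mul]
    refine intervalIntegral.integral_congr_ae ?_
    filter_upwards [ae_not_mem_branchPoints (a₁ := a₁) (a₂ := a₂) (a₃ := a₃) (a₄ := a₄)]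
      with x hx _
    have h5 := surfaceRoot_ne_zero hx
    rw [← hk x hx]
    field_simp
  rw [hφ.vanish_left, integral_div_surfaceRoot_left h₁ h₂ h₃ (P := fun _ => 1) (p := fun _ => 1)
    (by simp)] at hint
  simp only [one_mul] at hint
  rw [integral_weight h₁ h₂ h₃] at hint
  have hK := ellipticK_pos (ellipticParameter_nonneg h₁ h₂ h₃) (ellipticParameter_lt_one h₁ h₂ h₃)
  have hs : 0 < Real.sqrt ((a₄ - a₂) * (a₃ - a₁)) :=
    Real.sqrt_pos.2 (mul_pos (by linarith) (by linarith))
  have hpos : 2 / Real.sqrt ((a₄ - a₂) * (a₃ - a₁)) *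
      ellipticK (ellipticParameter a₁ a₂ a₃ a₄) ≠ 0 := by positivity
  have hk0 : k = 0 := by
    by_contra hk0
    exact mul_ne_zero (mul_ne_zero hk0 hpi) (mul_ne_zero (div_ne_zero Complex.I_ne_zero hpi)
      (Complex.ofReal_ne_zero.2 hpos)) hint.symm
  have := hk z hz
  rw [hk0, mul_eq_zero] at this
  exact this.resolve_right (surfaceRoot_ne_zero hz)

theorem IsCondensateSolution.eqOn (h₀ : -1 ≤ a₁) (h₁ : a₁ < a₂) (h₂ : a₂ < a₃)
    (h₃ : a₃ < a₄) (h₄ : a₄ ≤ 1) {g : ℝ → ℝ} {u v : ℂ → ℂ}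
    (hu : IsCondensateSolution a₁ a₂ a₃ a₄ g u) (hv : IsCondensateSolution a₁ a₂ a₃ a₄ g v) :
    EqOn u v (branchPoints a₁ a₂ a₃ a₄)ᶜ := fun _ hz =>
  sub_eq_zero.1 ((hu.sub h₀ h₁ h₂ h₃ h₄ hv).eq_zero h₀ h₁ h₂ h₃ h₄ hz)

theorem isCondensateSolution_iff_eqOn (h₀ : -1 ≤ a₁) (h₁ : a₁ < a₂) (h₂ : a₂ < a₃)
    (h₃ : a₃ < a₄) (h₄ : a₄ ≤ 1) {g : ℝ → ℝ} {v : ℂ → ℂ}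
    (hv : IsCondensateSolution a₁ a₂ a₃ a₄ g v) (u : ℂ → ℂ) :
    IsCondensateSolution a₁ a₂ a₃ a₄ g u ↔ EqOn u v (branchPoints a₁ a₂ a₃ a₄)ᶜ :=
  ⟨fun hu => hu.eqOn h₀ h₁ h₂ h₃ h₄ hv, hv.congr h₁ h₂ h₃⟩

/-! ### The effective velocity -/

/-- The weight is positive between branch points, so a continuous function without zeros would have
constant sign and a nonzero integral. -/
theorem exists_zero_of_integral_mul_weight_eq_zero (h₁ : a₁ < a₂) (h₂ : a₂ < a₃) (h₃ : a₃ < a₄)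
    {c d : ℝ} (hcd : c < d) (hne : ∀ x ∈ Ioo c d, x ≠ a₁ ∧ x ≠ a₂ ∧ x ≠ a₃ ∧ x ≠ a₄) {G : ℝ → ℝ}
    (hG : Continuous G) (h : ∫ x in c..d, G x * weight a₁ a₂ a₃ a₄ x = 0) :
    ∃ x ∈ Ioo c d, G x = 0 := by
  by_contra! hcon
  have hi := intervalIntegrable_mul_weight h₁ h₂ h₃ hcd.le hG.continuousOn
  have hw : ∀ x ∈ Ioo c d, 0 < weight a₁ a₂ a₃ a₄ x := by
    intro x hx
    obtain ⟨n1, n2, n3, n4⟩ := hne x hx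
    have hs := fun a (ha : x ≠ a) => Real.sqrt_pos.2 (abs_pos.2 (sub_ne_zero.2 ha))
    have s1 := hs a₁ n1
    have s2 := hs a₂ n2
    have s3 := hs a₃ n3
    have s4 := hs a₄ n4
    unfold weight
    positivity
  have hsign : (∀ x ∈ Ioo c d, 0 < G x) ∨ ∀ x ∈ Ioo c d, G x < 0 := by
    by_contra! hs
    obtain ⟨⟨x, hx, hx0⟩, y, hy, hy0⟩ := hs
    obtain ⟨t, ht, ht0⟩ := isPreconnected_Ioo.intermediate_value hx hy hG.continuousOn
      ⟨hx0, hy0⟩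
    exact hcon t ht ht0
  rcases hsign with hs | hs
  · have := intervalIntegral.intervalIntegral_pos_of_pos_on hi
      (fun x hx => mul_pos (hs x hx) (hw x hx)) hcd
    exact this.ne' h
  · have := intervalIntegral.intervalIntegral_pos_of_pos_on hi.neg
      (fun x hx => neg_pos.2 (mul_neg_of_neg_of_pos (hs x hx) (hw x hx))) hcd
    simp only [Pi.neg_apply] at this
    rw [intervalIntegral.integral_neg, h, neg_zero] at this
    exact lt_irrefl _ this

/-- Both zeros of the numerator of the density of states lie in the open bands. -/
theorem dosPoly_ne_zero (h₁ : a₁ < a₂) (h₂ : a₂ < a₃) (h₃ : a₃ < a₄) {z : ℝ}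
    (hz : z ∈ spectralSupport a₁ a₂ a₃ a₄) : dosPoly a₁ a₂ a₃ a₄ z ≠ 0 := by
  have hc : Continuous (dosPoly a₁ a₂ a₃ a₄) := by unfold dosPoly; fun_prop
  obtain ⟨x, hx, hx0⟩ := exists_zero_of_integral_mul_weight_eq_zero h₁ h₂ h₃ h₁
    (fun x hx => ⟨hx.1.ne', hx.2.ne, by linarith [hx.2], by linarith [hx.2]⟩) hc
    (integral_dosPoly_left h₁ h₂ h₃)
  obtain ⟨y, hy, hy0⟩ := exists_zero_of_integral_mul_weight_eq_zero h₁ h₂ h₃ h₃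
    (fun x hx => ⟨by linarith [hx.1], by linarith [hx.1], hx.1.ne', hx.2.ne⟩) hc
    (integral_dosPoly_right h₁ h₂ h₃)
  intro hz0
  rw [dosPoly] at hx0 hy0 hz0
  have hzx : z ≠ x := by
    rintro rfl
    rcases hz with (h | h) | h <;> linarith [h.1, h.2, hx.1, hx.2]
  have hzy : z ≠ y := by
    rintro rfl
    rcases hz with (h | h) | h <;> linarith [h.1, h.2, hy.1, hy.2]
  have hxy : x ≠ y := by linarith [hx.2, hy.1]
  -- A root on `Γ` would be a third root of a monic quadratic: by Vieta it and `y` would both be `l₁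
  -- / 2 - x`.
  have e1 : z + x = (1 / 2) * l₁ a₁ a₂ a₃ a₄ :=
    mul_left_cancel₀ (sub_ne_zero.2 hzx) (by linarith)
  have e2 : y + x = (1 / 2) * l₁ a₁ a₂ a₃ a₄ :=
    mul_left_cancel₀ (sub_ne_zero.2 hxy.symm) (by linarith)
  exact hzy (by linarith)

/-- Division with remainder by the numerator of `u`: the quotient is exactly `4 x`, and `C = 4 A - 2
l₂ + l₁² / 2`. -/
theorem dofPoly_eq_sub (x : ℝ) : dofPoly a₁ a₂ a₃ a₄ x =
    4 * x * dosPoly a₁ a₂ a₃ a₄ x - (constC a₁ a₂ a₃ a₄ * x - constB a₁ a₂ a₃ a₄) := by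
  rw [dofPoly, dosPoly, constA, constC, l₁, l₂]
  ring

theorem genusOneDOS_ofReal (x : ℝ) : genusOneDOS a₁ a₂ a₃ a₄ x =
    1 / (Real.pi : ℂ) * ((dosPoly a₁ a₂ a₃ a₄ x : ℂ) / surfaceRoot a₁ a₂ a₃ a₄ x) := by
  rw [genusOneDOS, dosPoly]
  push_cast
  rfl

theorem genusOneDOF_ofReal (x : ℝ) : genusOneDOF a₁ a₂ a₃ a₄ x =
    1 / (Real.pi : ℂ) * ((dofPoly a₁ a₂ a₃ a₄ x : ℂ) / surfaceRoot a₁ a₂ a₃ a₄ x) := by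
  rw [genusOneDOF, dofPoly]
  push_cast
  rfl

end Uniqueness

end DefNLS

/-! ### The main theorem -/

theorem mainTheorem8 (a₁ a₂ a₃ a₄ : ℝ) (h₀ : -1 ≤ a₁) (h₁ : a₁ < a₂) (h₂ : a₂ < a₃)
    (h₃ : a₃ < a₄) (h₄ : a₄ ≤ 1) :
    (∀ u : ℂ → ℂ, DefNLS.IsCondensateSolution a₁ a₂ a₃ a₄ (fun x => -x) u ↔
      Set.EqOn u (DefNLS.genusOneDOS a₁ a₂ a₃ a₄) (DefNLS.branchPoints a₁ a₂ a₃ a₄)ᶜ) ∧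
    (∀ v : ℂ → ℂ, DefNLS.IsCondensateSolution a₁ a₂ a₃ a₄ (fun x => 2 - 4 * x ^ 2) v ↔
      Set.EqOn v (DefNLS.genusOneDOF a₁ a₂ a₃ a₄) (DefNLS.branchPoints a₁ a₂ a₃ a₄)ᶜ) ∧
    (∀ u v : ℂ → ℂ, DefNLS.IsCondensateSolution a₁ a₂ a₃ a₄ (fun x => -x) u →
      DefNLS.IsCondensateSolution a₁ a₂ a₃ a₄ (fun x => 2 - 4 * x ^ 2) v →
      ∀ z ∈ DefNLS.spectralSupport a₁ a₂ a₃ a₄,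
        z ^ 2 - (1 / 2) * DefNLS.l₁ a₁ a₂ a₃ a₄ * z + DefNLS.constA a₁ a₂ a₃ a₄ ≠ 0 ∧
        ((z : ℂ) ∉ DefNLS.branchPoints a₁ a₂ a₃ a₄ →
          u z ≠ 0 ∧
          DefNLS.effectiveVelocity u v z =
            ((4 * z - (DefNLS.constC a₁ a₂ a₃ a₄ * z - DefNLS.constB a₁ a₂ a₃ a₄) /
              (z ^ 2 - (1 / 2) * DefNLS.l₁ a₁ a₂ a₃ a₄ * z + DefNLS.constA a₁ a₂ a₃ a₄) : ℝ) :
                ℂ))) := by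
  have hdos := DefNLS.isCondensateSolution_genusOneDOS h₀ h₁ h₂ h₃ h₄
  have hdof := DefNLS.isCondensateSolution_genusOneDOF h₀ h₁ h₂ h₃ h₄
  refine ⟨DefNLS.isCondensateSolution_iff_eqOn h₀ h₁ h₂ h₃ h₄ hdos,
    DefNLS.isCondensateSolution_iff_eqOn h₀ h₁ h₂ h₃ h₄ hdof, fun u v hu hv z hz => ?_⟩
  have hp : DefNLS.dosPoly a₁ a₂ a₃ a₄ z ≠ 0 := DefNLS.dosPoly_ne_zero h₁ h₂ h₃ hz
  have hpi : (Real.pi : ℂ) ≠ 0 := by exact_mod_cast Real.pi_ne_zero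
  have hpC : (DefNLS.dosPoly a₁ a₂ a₃ a₄ z : ℂ) ≠ 0 := Complex.ofReal_ne_zero.2 hp
  refine ⟨hp, fun hzb => ?_⟩
  have hR := DefNLS.surfaceRoot_ne_zero hzb
  have hue : u z = _ := (hu.eqOn h₀ h₁ h₂ h₃ h₄ hdos hzb).trans (DefNLS.genusOneDOS_ofReal z)
  have hve : v z = _ := (hv.eqOn h₀ h₁ h₂ h₃ h₄ hdof hzb).trans (DefNLS.genusOneDOF_ofReal z)
  refine ⟨?_, ?_⟩
  · rw [hue]
    exact mul_ne_zero (one_div_ne_zero hpi) (div_ne_zero hpC hR)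
  -- The factors `1 / (π R)` cancel in `v / u`, so only the real ratio of numerators remains.
  · have e : 4 * z - (DefNLS.constC a₁ a₂ a₃ a₄ * z - DefNLS.constB a₁ a₂ a₃ a₄) /
        (z ^ 2 - (1 / 2) * DefNLS.l₁ a₁ a₂ a₃ a₄ * z + DefNLS.constA a₁ a₂ a₃ a₄) =
        DefNLS.dofPoly a₁ a₂ a₃ a₄ z / DefNLS.dosPoly a₁ a₂ a₃ a₄ z := by
      change 4 * z - _ / DefNLS.dosPoly a₁ a₂ a₃ a₄ z = _
      rw [DefNLS.dofPoly_eq_sub, sub_div (4 * z * _), mul_div_cancel_right₀ _ hp]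
    rw [e, DefNLS.effectiveVelocity, hue, hve, Complex.ofReal_div]
    field_simp
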